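/- **Setting.** Three-sorted structures: numbers $x,i,\dots$, strings $X,Y,\dots$ and hyper strings $\mathcal X,\mathcal Z,\dots$, with the vocabulary $\mathcal L^3_A$ consisting of $0,1,+,\cdot,|X|,=_1,=_2,\le$, $X(i)$ (bit $i$ of $X$ is $1$) and $\mathcal X(Y)$. Here $(\exists X\le t)\varphi$ means $\exists X(|X|\le t\wedge\varphi)$, and similarly for $\forall$. $\Sigma^B_0$ is the class of formulas in the number and string sorts all of whose quantifiers are bounded number quantifiers. $\boldsymbol\Sigma^{\mathcal B}_0$ is the class of $\mathcal L^3_A$-formulas whose quantifiers are bounded number or bounded string quantifiers; $\boldsymbol\Sigma^{\mathcal B}_1$ (resp. $\boldsymbol\Pi^{\mathcal B}_1$) consists of the formulas $\exists\vec{\mathcal Z}\,\psi$ (resp. $\forall\vec{\mathcal Z}\,\psi$) with $\psi\in\boldsymbol\Sigma^{\mathcal B}_0$. Skelley's system $W^1_1$ has the basic axioms B1–B12, L1, L2, SE of Cook and Nguyen, induction on numbers for formulas $(\forall\vec Y\le\vec t\,)\exists\vec{\mathcal Z}\,\psi$ with $\psi\in\boldsymbol\Sigma^{\mathcal B}_0$,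 and for $\varphi\in\boldsymbol\Sigma^{\mathcal B}_0$ the comprehension axioms $(\exists Y\le x)(\forall i<x)[Y(i)\leftrightarrow\varphi(i)]$ and $\exists\mathcal Z(\forall Y\le x)[\mathcal Z(Y)\leftrightarrow\varphi(Y)]$. A formula is provable in a system if it is a logical consequence of its axioms. $\emptyset$, $S(X)$ and $U+V$ are the empty string, string successor and string addition, given by their usual $\Sigma^B_0$ bit graphs. For every $\Sigma^B_0$ formula $\varphi(i,X)$, possibly with parameters, let $P_\varphi(i,x,X)$ and $P_\varphi(i,x,X,Y)$ be new predicate symbols (which also take the parameters of $\varphi$ as arguments), and let $P^X_{\varphi,x}$, resp. $P^X_{\varphi,x}[Y]$, be the string of all $j<x$ with $P_\varphi(j,x,X)$, resp. $P_\varphi(j,x,X,Y)$. Their defining axioms are $$(\forall i<x)[P_\varphi(i,x,\emptyset)\leftrightarrow i<0],\qquad (\forall X\le x+1)(\forall i<x)[P_\varphi(i,x,S(X))\leftrightarrow\varphi(i,P^X_{\varphi,x})],$$ $$(\forall i<x)[P_\varphi(i,x,\emptyset,Y)\leftrightarrow Y(i)],\qquad (\forall X\le x+1)(\forall i<x)[P_\varphi(i,x,S(X),Y)\leftrightarrow\varphi(i,P^X_{\varphi,x}[Y])].$$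 Let $W^1_1(\mathcal L_{ID})$ be $W^1_1$, with its schemes taken for formulas with the new predicate symbols, together with these defining axioms. The axiom of inductive definitions for $\varphi$ is $$(\exists U,V\le x+1)\bigl[V\ne\emptyset\wedge(\forall i<x)(P_\varphi(i,x,U+V)\leftrightarrow P_\varphi(i,x,U))\bigr]\tag{ID}$$ and its relativised form is $$(\forall Y\le x)(\exists U,V\le x+1)\bigl[V\ne\emptyset\wedge(\forall i<x)(P_\varphi(i,x,U+V,Y)\leftrightarrow P_\varphi(i,x,U,Y))\bigr].\tag{RID}$$ **Theorem.** Let $\varphi\in\Sigma^B_0$. The axiom (ID) for $\varphi$, and likewise its relativised form (RID), holds in $W^1_1$ in the following translated sense. There is a $\boldsymbol\Sigma^{\mathcal B}_1$ formula $D_\varphi(i,x,X)$ (resp. $D_\varphi(i,x,X,Y)$) of $\mathcal L^3_A$, with the same parameters as $\varphi$, such that: 1. $D_\varphi$ is equivalent in $W^1_1$ to a $\boldsymbol\Pi^{\mathcal B}_1$ formula; 2. when $P_\varphi$ is replaced by $D_\varphi$, $W^1_1$ proves that the string $P^X_{\varphi,x}$ (resp. $P^X_{\varphi,x}[Y]$)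 exists and has length at most $x$ for every $X$, and proves the defining axioms, even without the bound $X\le x+1$; 3. when $P_\varphi$ is replaced by $D_\varphi$, $W^1_1$ proves (ID) (resp. (RID)); 4. $W^1_1(\mathcal L_{ID})$ proves that $P_\varphi$ and $D_\varphi$ are equivalent for all $i<x$ and all $X$ with $|X|\le x+1$; 5. there is a $\boldsymbol\Sigma^{\mathcal B}_1$ formula $\psi'$ of $\mathcal L^3_A$ with the same free variables as (ID) (resp. (RID)) which is provable in $W^1_1$, equivalent in $W^1_1$ to the translation of the axiom, and equivalent in $W^1_1(\mathcal L_{ID})$ to the axiom itself. -/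

import Mathlib

namespace BoundedArith

/-! ### Third order formulas -/

/-- Additional predicate symbols, each with a number of numerical and of string arguments. -/
structure Sig where
  Sym : Type
  nAr : Sym → ℕ
  sAr : Sym → ℕ

/-- No additional predicate symbols. -/
def Sig.none : Sig := ⟨Empty, fun r => r.elim, fun r => r.elim⟩

/-- Numerical terms over `0, 1, +, ·, |X|`, with `n` number variables and `m` string variables
(variables are de Bruijn indices: a quantifier binds the variable `0`). -/
inductive Tm (n m : ℕ) : Type
  | var (i : Fin n)
  | zero
  | one
  | add (s t : Tm n m)
  | mul (s t : Tm n m)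
  | len (X : Fin m)

/-- Formulas of the third order vocabulary expanded by the symbols in `R`, with `n` number, `m`
string and `k` hyper string variables, all of whose number and string quantifiers are bounded:
`exN t φ` is `(∃ x ≤ t) φ` and `exS t φ` is `(∃ X ≤ t) φ`, that is `∃ X (|X| ≤ t ∧ φ)`; the
quantifiers `exH`, `allH` over hyper strings carry no bound. -/
inductive Fm (R : Sig) : ℕ → ℕ → ℕ → Type
  | eqN {n m k : ℕ} (s t : Tm n m) : Fm R n m k
  | le {n m k : ℕ} (s t : Tm n m) : Fm R n m k
  | eqS {n m k : ℕ} (X Y : Fin m) : Fm R n m k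
  | mem {n m k : ℕ} (t : Tm n m) (X : Fin m) : Fm R n m k
  | hmem {n m k : ℕ} (X : Fin m) (Z : Fin k) : Fm R n m k
  | rel {n m k : ℕ} (r : R.Sym) (ts : Fin (R.nAr r) → Tm n m) (Xs : Fin (R.sAr r) → Fin m) :
      Fm R n m k
  | neg {n m k : ℕ} (φ : Fm R n m k) : Fm R n m k
  | conj {n m k : ℕ} (φ ψ : Fm R n m k) : Fm R n m k
  | disj {n m k : ℕ} (φ ψ : Fm R n m k) : Fm R n m k
  | exN {n m k : ℕ} (t : Tm n m) (φ : Fm R (n + 1) m k) : Fm R n m k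
  | allN {n m k : ℕ} (t : Tm n m) (φ : Fm R (n + 1) m k) : Fm R n m k
  | exS {n m k : ℕ} (t : Tm n m) (φ : Fm R n (m + 1) k) : Fm R n m k
  | allS {n m k : ℕ} (t : Tm n m) (φ : Fm R n (m + 1) k) : Fm R n m k
  | exH {n m k : ℕ} (φ : Fm R n m (k + 1)) : Fm R n m k
  | allH {n m k : ℕ} (φ : Fm R n m (k + 1)) : Fm R n m k

/-- No hyper string quantifiers: the third order class `𝚺^B_0`. -/
def Fm.NoH {R : Sig} : {n m k : ℕ} → Fm R n m k → Prop
  | _, _, _, .eqN _ _ => True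
  | _, _, _, .le _ _ => True
  | _, _, _, .eqS _ _ => True
  | _, _, _, .mem _ _ => True
  | _, _, _, .hmem _ _ => True
  | _, _, _, .rel _ _ _ => True
  | _, _, _, .neg φ => φ.NoH
  | _, _, _, .conj φ ψ => φ.NoH ∧ ψ.NoH
  | _, _, _, .disj φ ψ => φ.NoH ∧ ψ.NoH
  | _, _, _, .exN _ φ => φ.NoH
  | _, _, _, .allN _ φ => φ.NoH
  | _, _, _, .exS _ φ => φ.NoH
  | _, _, _, .allS _ φ => φ.NoH
  | _, _, _, .exH _ => False
  | _, _, _, .allH _ => False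

/-- All quantifiers are bounded number quantifiers. For formulas without hyper string variables
and without additional symbols this is the second order class `Σ^B_0`. -/
def Fm.NumOnly {R : Sig} : {n m k : ℕ} → Fm R n m k → Prop
  | _, _, _, .eqN _ _ => True
  | _, _, _, .le _ _ => True
  | _, _, _, .eqS _ _ => True
  | _, _, _, .mem _ _ => True
  | _, _, _, .hmem _ _ => True
  | _, _, _, .rel _ _ _ => True
  | _, _, _, .neg φ => φ.NumOnly
  | _, _, _, .conj φ ψ => φ.NumOnly ∧ ψ.NumOnly
  | _, _, _, .disj φ ψ => φ.NumOnly ∧ ψ.NumOnly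
  | _, _, _, .exN _ φ => φ.NumOnly
  | _, _, _, .allN _ φ => φ.NumOnly
  | _, _, _, .exS _ _ => False
  | _, _, _, .allS _ _ => False
  | _, _, _, .exH _ => False
  | _, _, _, .allH _ => False

/-- `𝚺^B_1` formulas: `∃ 𝒵₁ ⋯ ∃ 𝒵ᵣ ψ`, with `ψ` free of hyper string quantifiers. -/
inductive Fm.IsSigma1 {R : Sig} : {n m k : ℕ} → Fm R n m k → Prop
  | base {n m k : ℕ} {φ : Fm R n m k} : φ.NoH → φ.IsSigma1
  | ex {n m k : ℕ} {φ : Fm R n m (k + 1)} : φ.IsSigma1 → (Fm.exH φ).IsSigma1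

/-- `𝚷^B_1` formulas: `∀ 𝒵₁ ⋯ ∀ 𝒵ᵣ ψ`, with `ψ` free of hyper string quantifiers. -/
inductive Fm.IsPi1 {R : Sig} : {n m k : ℕ} → Fm R n m k → Prop
  | base {n m k : ℕ} {φ : Fm R n m k} : φ.NoH → φ.IsPi1
  | all {n m k : ℕ} {φ : Fm R n m (k + 1)} : φ.IsPi1 → (Fm.allH φ).IsPi1

/-- `∀²𝚺^B_1` formulas: a `𝚺^B_1` formula preceded by bounded universal string quantifiers.
This is the class for which `W^1_1` has induction (in it every non-prenex `𝚺^B_1` formula is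
provably equivalent to one of this form). -/
inductive Fm.IsAllSigma1 {R : Sig} : {n m k : ℕ} → Fm R n m k → Prop
  | base {n m k : ℕ} {φ : Fm R n m k} : φ.IsSigma1 → φ.IsAllSigma1
  | all {n m k : ℕ} (t : Tm n m) {φ : Fm R n (m + 1) k} :
      φ.IsAllSigma1 → (Fm.allS t φ).IsAllSigma1

/-! ### Structures and satisfaction -/

/-- A structure for the third order vocabulary: `N` numbers, `S` strings, `H` hyper strings.
Both equality symbols are interpreted by equality. -/
structure Struct where
  N : Type
  S : Type
  H : Type
  zero : N
  one : N
  add : N → N → N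
  mul : N → N → N
  len : S → N
  le : N → N → Prop
  mem : N → S → Prop
  hmem : S → H → Prop

/-- An interpretation in `M` of the symbols in `R`. -/
abbrev Interp (R : Sig) (M : Struct) : Type :=
  (r : R.Sym) → (Fin (R.nAr r) → M.N) → (Fin (R.sAr r) → M.S) → Prop

def Interp.none (M : Struct) : Interp Sig.none M := fun r => r.elim

def Tm.val (M : Struct) {n m : ℕ} (e : Fin n → M.N) (E : Fin m → M.S) : Tm n m → M.N
  | .var i => e i
  | .zero => M.zero
  | .one => M.one
  | .add s t => M.add (s.val M e E) (t.val M e E)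
  | .mul s t => M.mul (s.val M e E) (t.val M e E)
  | .len X => M.len (E X)

/-- Tarskian satisfaction; `e`, `E`, `F` assign values to the free variables. -/
def Fm.Holds {R : Sig} (M : Struct) (I : Interp R M) : {n m k : ℕ} → Fm R n m k →
    (Fin n → M.N) → (Fin m → M.S) → (Fin k → M.H) → Prop
  | _, _, _, .eqN s t, e, E, _ => s.val M e E = t.val M e E
  | _, _, _, .le s t, e, E, _ => M.le (s.val M e E) (t.val M e E)
  | _, _, _, .eqS X Y, _, E, _ => E X = E Y
  | _, _, _, .mem t X, e, E, _ => M.mem (t.val M e E) (E X)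
  | _, _, _, .hmem X Z, _, E, F => M.hmem (E X) (F Z)
  | _, _, _, .rel r ts Xs, e, E, _ => I r (fun i => (ts i).val M e E) (fun i => E (Xs i))
  | _, _, _, .neg φ, e, E, F => ¬ φ.Holds M I e E F
  | _, _, _, .conj φ ψ, e, E, F => φ.Holds M I e E F ∧ ψ.Holds M I e E F
  | _, _, _, .disj φ ψ, e, E, F => φ.Holds M I e E F ∨ ψ.Holds M I e E F
  | _, _, _, .exN t φ, e, E, F =>
      ∃ b : M.N, M.le b (t.val M e E) ∧ φ.Holds M I (Fin.cons b e) E F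
  | _, _, _, .allN t φ, e, E, F =>
      ∀ b : M.N, M.le b (t.val M e E) → φ.Holds M I (Fin.cons b e) E F
  | _, _, _, .exS t φ, e, E, F =>
      ∃ B : M.S, M.le (M.len B) (t.val M e E) ∧ φ.Holds M I e (Fin.cons B E) F
  | _, _, _, .allS t φ, e, E, F =>
      ∀ B : M.S, M.le (M.len B) (t.val M e E) → φ.Holds M I e (Fin.cons B E) F
  | _, _, _, .exH φ, e, E, F => ∃ Z : M.H, φ.Holds M I e E (Fin.cons Z F)
  | _, _, _, .allH φ, e, E, F => ∀ Z : M.H, φ.Holds M I e E (Fin.cons Z F)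

/-- Satisfaction of an `L^3_A`-formula without free hyper string variables. -/
def Fm.Sat (M : Struct) {n m : ℕ} (φ : Fm Sig.none n m 0) (e : Fin n → M.N)
    (E : Fin m → M.S) : Prop :=
  φ.Holds M (Interp.none M) e E Fin.elim0

namespace Struct

variable (M : Struct)

def lt (a b : M.N) : Prop := M.le a b ∧ a ≠ b

def succN (a : M.N) : M.N := M.add a M.one

/-! ### The system `W^1_1` -/

/-- `M` satisfies the basic axioms B1-B12, L1, L2, SE of second order bounded arithmetic. -/
structure IsBasic : Prop where
  b1 : ∀ x, M.succN x ≠ M.zero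
  b2 : ∀ x y, M.succN x = M.succN y → x = y
  b3 : ∀ x, M.add x M.zero = x
  b4 : ∀ x y, M.add x (M.succN y) = M.succN (M.add x y)
  b5 : ∀ x, M.mul x M.zero = M.zero
  b6 : ∀ x y, M.mul x (M.succN y) = M.add (M.mul x y) x
  b7 : ∀ x y, M.le x y → M.le y x → x = y
  b8 : ∀ x y, M.le x (M.add x y)
  b9 : ∀ x, M.le M.zero x
  b10 : ∀ x y, M.le x y ∨ M.le y x
  b11 : ∀ x y, M.le x y ↔ M.lt x (M.succN y)
  b12 : ∀ x, x ≠ M.zero → ∃ y, M.le y x ∧ M.succN y = x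
  l1 : ∀ X y, M.mem y X → M.lt y (M.len X)
  l2 : ∀ X y, M.succN y = M.len X → M.mem y X
  se : ∀ X Y, M.len X = M.len Y → (∀ i, M.lt i (M.len X) → (M.mem i X ↔ M.mem i Y)) → X = Y

/-- The pair `(M, I)` satisfies the axioms of `W^1_1`, with the schemes of induction,
comprehension and third order comprehension for formulas of the vocabulary expanded by `R`
(all free variables other than the displayed one are parameters). -/
structure IsW11With (R : Sig) (I : Interp R M) : Prop where
  basic : M.IsBasic
  ind : ∀ (n m k : ℕ) (φ : Fm R (n + 1) m k), φ.IsAllSigma1 →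
    ∀ (e : Fin n → M.N) (E : Fin m → M.S) (F : Fin k → M.H),
      φ.Holds M I (Fin.cons M.zero e) E F →
      (∀ b : M.N, φ.Holds M I (Fin.cons b e) E F →
        φ.Holds M I (Fin.cons (M.succN b) e) E F) →
      ∀ b : M.N, φ.Holds M I (Fin.cons b e) E F
  comp : ∀ (n m k : ℕ) (φ : Fm R (n + 1) m k), φ.NoH →
    ∀ (e : Fin n → M.N) (E : Fin m → M.S) (F : Fin k → M.H) (x : M.N),
      ∃ Y : M.S, M.le (M.len Y) x ∧
        ∀ i : M.N, M.lt i x → (M.mem i Y ↔ φ.Holds M I (Fin.cons i e) E F)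
  comp3 : ∀ (n m k : ℕ) (φ : Fm R n (m + 1) k), φ.NoH →
    ∀ (e : Fin n → M.N) (E : Fin m → M.S) (F : Fin k → M.H) (x : M.N),
      ∃ Z : M.H, ∀ Y : M.S, M.le (M.len Y) x →
        (M.hmem Y Z ↔ φ.Holds M I e (Fin.cons Y E) F)

/-- `M` is a model of `W^1_1`. A statement is provable in `W^1_1` if it holds in all of these. -/
def IsW11 : Prop := M.IsW11With Sig.none (Interp.none M)

/-! ### Functions on strings, given by their bit graphs -/

def IsEmptyStr (X : M.S) : Prop := ∀ i, M.mem i X ↔ M.lt i M.zero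

/-- `Z = S(X)`, the string successor. -/
def IsSucc (X Z : M.S) : Prop :=
  ∀ i, M.mem i Z ↔ M.le i (M.len X) ∧
    ((M.mem i X ∧ ∃ j, M.lt j i ∧ ¬ M.mem j X) ∨ (¬ M.mem i X ∧ ∀ j, M.lt j i → M.mem j X))

def Carry (i : M.N) (X Y : M.S) : Prop :=
  ∃ k, M.lt k i ∧ M.mem k X ∧ M.mem k Y ∧
    ∀ j, M.lt j i → M.lt k j → M.mem j X ∨ M.mem j Y

/-- `Z = X + Y`, the string addition. -/
def IsAdd (X Y Z : M.S) : Prop :=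
  ∀ i, M.mem i Z ↔ M.lt i (M.add (M.len X) (M.len Y)) ∧
    Xor (Xor (M.mem i X) (M.mem i Y)) (M.Carry i X Y)

end Struct

/-! ### Iterated operators and inductive definitions -/

/-- A `Σ^B_0` formula `φ(i, X)` of the second order vocabulary, with `p` further number variables
and `q` further string variables as parameters. Number variable `0` is `i`, string variable `0`
is `X`. -/
structure Operator where
  p : ℕ
  q : ℕ
  body : Fm Sig.none (p + 1) (q + 1) 0
  isSigma0 : body.NumOnly

/-- The truth of `φ(i, Z)` in `M` at the parameters `a`, `A`. -/
def Operator.App (φ : Operator) (M : Struct) (a : Fin φ.p → M.N) (A : Fin φ.q → M.S)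
    (i : M.N) (Z : M.S) : Prop :=
  φ.body.Sat M (Fin.cons i a) (Fin.cons Z A)

/-- For each `φ`, the predicate symbols `P_φ(i, x, X)` (left copy) and `P_φ(i, x, X, Y)`
(right copy, for the relativised form), which also take the parameters of `φ` as arguments. -/
def LID : Sig where
  Sym := Operator ⊕ Operator
  nAr := Sum.elim (fun φ => φ.p + 2) (fun φ => φ.p + 2)
  sAr := Sum.elim (fun φ => φ.q + 1) (fun φ => φ.q + 2)

/-- The meaning of the symbol `P_φ(i, x, X)` under `I`, at the parameters `a`, `A`. -/
def Operator.P (φ : Operator) {M : Struct} (I : Interp LID M) (a : Fin φ.p → M.N)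
    (A : Fin φ.q → M.S) (i x : M.N) (X : M.S) : Prop :=
  I (Sum.inl φ) (Fin.cons i (Fin.cons x a) : Fin (φ.p + 2) → M.N)
    (Fin.cons X A : Fin (φ.q + 1) → M.S)

/-- The meaning of the symbol `P_φ(i, x, X, Y)` under `I`, at the parameters `a`, `A`. -/
def Operator.PRel (φ : Operator) {M : Struct} (I : Interp LID M) (a : Fin φ.p → M.N)
    (A : Fin φ.q → M.S) (Y : M.S) (i x : M.N) (X : M.S) : Prop :=
  I (Sum.inr φ) (Fin.cons i (Fin.cons x a) : Fin (φ.p + 2) → M.N)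
    (Fin.cons X (Fin.cons Y A) : Fin (φ.q + 2) → M.S)

/-- The meaning of a formula `D(i, x, X)` put in the place of `P_φ(i, x, X)`. -/
def Operator.T (φ : Operator) (D : Fm Sig.none (φ.p + 2) (φ.q + 1) 0) (M : Struct)
    (a : Fin φ.p → M.N) (A : Fin φ.q → M.S) (i x : M.N) (X : M.S) : Prop :=
  D.Sat M (Fin.cons i (Fin.cons x a)) (Fin.cons X A)

/-- The meaning of a formula `D(i, x, X, Y)` put in the place of `P_φ(i, x, X, Y)`. -/
def Operator.TRel (φ : Operator) (D : Fm Sig.none (φ.p + 2) (φ.q + 2) 0) (M : Struct)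
    (a : Fin φ.p → M.N) (A : Fin φ.q → M.S) (Y : M.S) (i x : M.N) (X : M.S) : Prop :=
  D.Sat M (Fin.cons i (Fin.cons x a)) (Fin.cons X (Fin.cons Y A))

namespace Struct

variable (M : Struct)

/-- `Z` is the string `P^X_x` of those `j < x` with `P(j, x, X)`. -/
def IsIterate (P : M.N → M.N → M.S → Prop) (x : M.N) (X Z : M.S) : Prop :=
  ∀ j, M.mem j Z ↔ P j x X ∧ M.lt j x

/-- `(∀ i < x) [P(i, x, ∅) ↔ B(i)]`. -/
def BaseAx (P : M.N → M.N → M.S → Prop) (B : M.N → Prop) (x : M.N) : Prop :=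
  ∀ O : M.S, M.IsEmptyStr O → ∀ i, M.lt i x → (P i x O ↔ B i)

/-- The recursion clause `(∀ i < x) [P(i, x, S(X)) ↔ φ(i, P^X_x)]` at `x` and `X`, where `P^X_x`
is the string `Z` of all `j < x` with `P(j, x, X)`. -/
def StepAx (P : M.N → M.N → M.S → Prop) (φ : M.N → M.S → Prop) (x : M.N) (X : M.S) : Prop :=
  ∀ X' Z : M.S, M.IsSucc X X' → M.IsIterate P x X Z → ∀ i, M.lt i x → (P i x X' ↔ φ i Z)

/-- The instance of the axiom of inductive definitions at `x`:
`(∃ U, V ≤ x + 1) [V ≠ ∅ ∧ (∀ i < x) (P(i, x, U + V) ↔ P(i, x, U))]`. -/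
def IDAx (P : M.N → M.N → M.S → Prop) (x : M.N) : Prop :=
  ∃ U V W : M.S, M.le (M.len U) (M.succN x) ∧ M.le (M.len V) (M.succN x) ∧
    ¬ M.IsEmptyStr V ∧ M.IsAdd U V W ∧ ∀ i, M.lt i x → (P i x W ↔ P i x U)

/-- The instance at `x` of the relativised axiom: `(∀ Y ≤ x) (∃ U, V ≤ x + 1) [⋯]`. -/
def RIDAx (P : M.S → M.N → M.N → M.S → Prop) (x : M.N) : Prop :=
  ∀ Y : M.S, M.le (M.len Y) x → M.IDAx (P Y) x

/-- `(M, I)` is a model of `W^1_1(LID)`: the axioms of `W^1_1` with the schemes for formulas with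
the symbols `P_φ`, and the defining axioms of all symbols `P_φ`. -/
structure IsW11LID (I : Interp LID M) : Prop where
  w11 : M.IsW11With LID I
  base : ∀ (φ : Operator) (a : Fin φ.p → M.N) (A : Fin φ.q → M.S) (x : M.N),
    M.BaseAx (φ.P I a A) (fun i => M.lt i M.zero) x
  step : ∀ (φ : Operator) (a : Fin φ.p → M.N) (A : Fin φ.q → M.S) (x : M.N) (X : M.S),
    M.le (M.len X) (M.succN x) → M.StepAx (φ.P I a A) (φ.App M a A) x X
  baseRel : ∀ (φ : Operator) (a : Fin φ.p → M.N) (A : Fin φ.q → M.S) (Y : M.S) (x : M.N),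
    M.BaseAx (φ.PRel I a A Y) (fun i => M.mem i Y) x
  stepRel : ∀ (φ : Operator) (a : Fin φ.p → M.N) (A : Fin φ.q → M.S) (Y : M.S) (x : M.N)
    (X : M.S), M.le (M.len X) (M.succN x) → M.StepAx (φ.PRel I a A Y) (φ.App M a A) x X

/-- `P` provides a string `P^X_x` of length at most `x` for every `X`, starts from `B` and
satisfies the recursion clause of `φ` for every `X`. -/
def IsIteration (P : M.N → M.N → M.S → Prop) (φ : M.N → M.S → Prop) (B : M.N → Prop)
    (x : M.N) : Prop :=
  (∀ X : M.S, ∃ Z : M.S, M.le (M.len Z) x ∧ M.IsIterate P x X Z) ∧ M.BaseAx P B x ∧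
    ∀ X : M.S, M.StepAx P φ x X

end Struct

/-- `D` is a `𝚺^B_1` formula and, provably in `W^1_1`, equivalent to a `𝚷^B_1` formula. -/
def Fm.IsDelta1 {n m : ℕ} (D : Fm Sig.none n m 0) : Prop :=
  D.IsSigma1 ∧ ∃ D' : Fm Sig.none n m 0, D'.IsPi1 ∧
    ∀ M : Struct, M.IsW11 → ∀ (e : Fin n → M.N) (E : Fin m → M.S), D.Sat M e E ↔ D'.Sat M e E

end BoundedArith

/-! (ID) is a pigeonhole principle for an exponentially long computation. The iteration of `φ` has
strings of length at most `x` as values, while the counters range over the strings of length at most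
`x + 1`. So two counters `U < W` give the same value, and `V` is the difference of `W` and `U`. What
has to be shown is that `W^1_1` can carry this out.

Runs. A hyper string codes a function on strings by the codes of its pairs (argument, value). Call
the set of strings that agree with `s` from bit `j` on a cube of dimension `j`. A run on a cube of
dimension `j + 1` consists of two runs on cubes of dimension `j`, the second started one step after
the last value of the first. "For every base point and every start there is a run" is a `∀²𝚺^B_1`
statement, so induction on the number `j` yields runs of exponential length (`exists_runOn`). The
same doubling turns number induction into induction on strings (`string_induction`), which makes
runs unique (`RunOn.hmem_iff`). By existence and uniqueness, "some run has a value at `X` containing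
`i`" and "every run has" are equivalent. This is `D_φ` in its `𝚺^B_1` and `𝚷^B_1` forms. String
induction in the expanded vocabulary identifies `P_φ` with `D_φ` on counters of length at most `x +
1` (`IsIter.iff_mem`).

Pigeonhole. For an injective `W`, let `c t w` count the `v < w` among the values `W s` with `s < t`.
Let `T` be the binary number `2^x`, which exceeds all values. Then `c t w ≤ w` by induction on `w`,
and `c t T = t` for `t ≤ T + 1` by induction on `t`; `t = T + 1` is contradictory
(`exists_collision`). The count is itself defined by a recursion on strings, with parameter `t`;
pairs `(w, t)` are run through in the order of their codes (`exists_rec_pair`).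

The formula `ψ'` says that one hyper string codes the iterations and shows the collision. For (RID)
this hyper string covers all starts `Y` at once, so that the quantifier over `Y` stays inside the
hyper string quantifier (`exists_runAll`). Both `ψ'` and the axiom are provable, hence they are
equivalent. -/

namespace BoundedArith

/-! ### Formulas without additional symbols in an expanded vocabulary -/

/-- A formula of the plain vocabulary, seen as one of the vocabulary expanded by `R`. -/
def Fm.lift {R : Sig} : {n m k : ℕ} → Fm Sig.none n m k → Fm R n m k
  | _, _, _, .eqN s t => .eqN s t
  | _, _, _, .le s t => .le s t
  | _, _, _, .eqS X Y => .eqS X Y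
  | _, _, _, .mem t X => .mem t X
  | _, _, _, .hmem X Z => .hmem X Z
  | _, _, _, .rel r _ _ => r.elim
  | _, _, _, .neg φ => .neg φ.lift
  | _, _, _, .conj φ ψ => .conj φ.lift ψ.lift
  | _, _, _, .disj φ ψ => .disj φ.lift ψ.lift
  | _, _, _, .exN t φ => .exN t φ.lift
  | _, _, _, .allN t φ => .allN t φ.lift
  | _, _, _, .exS t φ => .exS t φ.lift
  | _, _, _, .allS t φ => .allS t φ.lift
  | _, _, _, .exH φ => .exH φ.lift
  | _, _, _, .allH φ => .allH φ.lift

theorem Fm.holds_lift {R : Sig} {M : Struct} (I : Interp R M) {n m k : ℕ}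
    (φ : Fm Sig.none n m k) (e : Fin n → M.N) (E : Fin m → M.S) (F : Fin k → M.H) :
    (φ.lift : Fm R n m k).Holds M I e E F ↔ φ.Holds M (Interp.none M) e E F := by
  induction φ with
  | rel r => exact r.elim
  | _ => simp_all [Fm.lift, Fm.Holds]

theorem Fm.NoH.lift {R : Sig} {n m k : ℕ} {φ : Fm Sig.none n m k} (h : φ.NoH) :
    (φ.lift : Fm R n m k).NoH := by
  induction φ with
  | rel r => exact r.elim
  | _ => simp_all [Fm.lift, Fm.NoH]

theorem Fm.IsSigma1.lift {R : Sig} {n m k : ℕ} {φ : Fm Sig.none n m k} (h : φ.IsSigma1) :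
    (φ.lift : Fm R n m k).IsSigma1 := by
  induction h with
  | base h => exact .base h.lift
  | ex _ ih => exact .ex ih

theorem Fm.IsAllSigma1.lift {R : Sig} {n m k : ℕ} {φ : Fm Sig.none n m k} (h : φ.IsAllSigma1) :
    (φ.lift : Fm R n m k).IsAllSigma1 := by
  induction h with
  | base h => exact .base h.lift
  | all t _ ih => exact .all t ih

theorem Fm.NumOnly.noH {R : Sig} {n m k : ℕ} {φ : Fm R n m k} (h : φ.NumOnly) : φ.NoH := by
  induction φ <;> simp_all [Fm.NumOnly, Fm.NoH]

/-- Each scheme for plain formulas is part of the scheme for the expanded vocabulary, so all that is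
proved in `W^1_1` can be used in models of `W^1_1(LID)`. -/
theorem Struct.IsW11With.isW11 {R : Sig} {M : Struct} {I : Interp R M} (h : M.IsW11With R I) :
    M.IsW11 where
  basic := h.basic
  ind n m k φ hφ e E F h0 hs b := by
    have := h.ind n m k φ.lift hφ.lift e E F
    simp only [Fm.holds_lift] at this
    exact this h0 hs b
  comp n m k φ hφ e E F x := by
    have := h.comp n m k φ.lift hφ.lift e E F x
    simpa only [Fm.holds_lift] using this
  comp3 n m k φ hφ e E F x := by
    have := h.comp3 n m k φ.lift hφ.lift e E F x
    simpa only [Fm.holds_lift] using this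

/-! ### Definable predicates -/

namespace Struct

variable (M : Struct)

instance : LE M.N := ⟨M.le⟩
instance : LT M.N := ⟨M.lt⟩
instance : Zero M.N := ⟨M.zero⟩
instance : One M.N := ⟨M.one⟩
instance : Add M.N := ⟨M.add⟩

/-- The model `M` satisfies the axioms of `W^1_1`. -/
class W11 : Prop where
  out : M.IsW11

end Struct

/-- A family of expanded models indexed by `Γ`, with assignments to `n` number, `m` string and
`k` hyper string variables. Predicates on `Γ` are semantic counterparts of formulas. -/
structure Ctx (R : Sig) (Γ : Type 1) (n m k : ℕ) where
  M : Γ → Struct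
  I : (γ : Γ) → Interp R (M γ)
  ok : ∀ γ, (M γ).W11
  e : (γ : Γ) → Fin n → (M γ).N
  E : (γ : Γ) → Fin m → (M γ).S
  F : (γ : Γ) → Fin k → (M γ).H

namespace Ctx

variable {R : Sig} {Γ : Type 1} {n m k : ℕ}

/-- The context `C` with a further number variable. -/
abbrev consN (C : Ctx R Γ n m k) : Ctx R (Σ γ : Γ, (C.M γ).N) (n + 1) m k where
  M p := C.M p.1
  I p := C.I p.1
  ok p := C.ok p.1
  e p := Fin.cons p.2 (C.e p.1)
  E p := C.E p.1
  F p := C.F p.1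

/-- The context `C` with a further string variable. -/
abbrev consS (C : Ctx R Γ n m k) : Ctx R (Σ γ : Γ, (C.M γ).S) n (m + 1) k where
  M p := C.M p.1
  I p := C.I p.1
  ok p := C.ok p.1
  e p := C.e p.1
  E p := Fin.cons p.2 (C.E p.1)
  F p := C.F p.1

/-- The context `C` with a further hyper string variable. -/
abbrev consH (C : Ctx R Γ n m k) : Ctx R (Σ γ : Γ, (C.M γ).H) n m (k + 1) where
  M p := C.M p.1
  I p := C.I p.1
  ok p := C.ok p.1
  e p := C.e p.1
  E p := C.E p.1
  F p := Fin.cons p.2 (C.F p.1)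

/-- The context given by a fixed model and a fixed assignment. -/
abbrev fixed (M : Struct) [h : M.W11] (I : Interp R M) (e : Fin n → M.N) (E : Fin m → M.S)
    (F : Fin k → M.H) : Ctx R PUnit n m k where
  M _ := M
  I _ := I
  ok _ := h
  e _ := e
  E _ := E
  F _ := F

variable (C : Ctx R Γ n m k)

/-- `f` is given by a numerical term. -/
class IsTm {T : Γ → Type} (f : (γ : Γ) → T γ) : Prop where
  out : ∃ t : Tm n m, ∀ γ, t.val (C.M γ) (C.e γ) (C.E γ) ≍ f γ

/-- `f` is given by a string variable. -/
class IsSVar {T : Γ → Type} (f : (γ : Γ) → T γ) : Prop where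
  out : ∃ i : Fin m, ∀ γ, C.E γ i ≍ f γ

/-- `f` is given by a hyper string variable. -/
class IsHVar {T : Γ → Type} (f : (γ : Γ) → T γ) : Prop where
  out : ∃ i : Fin k, ∀ γ, C.F γ i ≍ f γ

/-- All components of `f` are given by numerical terms. -/
class IsTms {a : ℕ} {T : Γ → Type} (f : (γ : Γ) → Fin a → T γ) : Prop where
  out : ∀ i, C.IsTm (fun γ => f γ i)

/-- All components of `f` are given by string variables. -/
class IsSVars {a : ℕ} {T : Γ → Type} (f : (γ : Γ) → Fin a → T γ) : Prop where
  out : ∀ i, C.IsSVar (fun γ => f γ i)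

/-- All components of `f` are given by hyper string variables. -/
class IsHVars {a : ℕ} {T : Γ → Type} (f : (γ : Γ) → Fin a → T γ) : Prop where
  out : ∀ i, C.IsHVar (fun γ => f γ i)

/-- `P` is given by a formula without hyper string quantifiers. -/
class Def (P : Γ → Prop) : Prop where
  out : ∃ φ : Fm R n m k, φ.NoH ∧ ∀ γ, φ.Holds (C.M γ) (C.I γ) (C.e γ) (C.E γ) (C.F γ) ↔ P γ

/-- `P` is given by a `𝚺^B_1` formula. -/
class Sig1 (P : Γ → Prop) : Prop where
  out : ∃ φ : Fm R n m k, φ.IsSigma1 ∧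
    ∀ γ, φ.Holds (C.M γ) (C.I γ) (C.e γ) (C.E γ) (C.F γ) ↔ P γ

/-- `P` is given by a `𝚷^B_1` formula. -/
class Pi1 (P : Γ → Prop) : Prop where
  out : ∃ φ : Fm R n m k, φ.IsPi1 ∧
    ∀ γ, φ.Holds (C.M γ) (C.I γ) (C.e γ) (C.E γ) (C.F γ) ↔ P γ

/-- `P` is given by a `∀²𝚺^B_1` formula. -/
class AllSig1 (P : Γ → Prop) : Prop where
  out : ∃ φ : Fm R n m k, φ.IsAllSigma1 ∧
    ∀ γ, φ.Holds (C.M γ) (C.I γ) (C.e γ) (C.E γ) (C.F γ) ↔ P γ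

/-- `x` is one of the parameters in `v`. -/
class Param {α : Type*} {a : ℕ} (x : α) (v : Fin a → α) : Prop where
  out : ∃ i, v i = x

instance {α : Type*} {a : ℕ} (v : Fin a → α) (i : Fin a) : Param (v i) v := ⟨i, rfl⟩

instance {α : Type*} {a : ℕ} (x : α) (v : Fin a → α) : Param x (Matrix.vecCons x v) :=
  ⟨0, rfl⟩

instance {α : Type*} {a : ℕ} (x y : α) (v : Fin a → α) [h : Param x v] :
    Param x (Matrix.vecCons y v) := by
  obtain ⟨i, hi⟩ := h.out
  exact ⟨i.succ, hi⟩

variable {C}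

/-- Definability only concerns truth values in models of `W^1_1`. Hence a predicate may be replaced
by any provably equivalent one, for instance by one with bounded quantifiers. -/
theorem Def.congr {P Q : Γ → Prop} (hP : C.Def P) (h : ∀ γ, Q γ ↔ P γ) : C.Def Q := by
  obtain ⟨φ, h1, h2⟩ := hP.out
  exact ⟨φ, h1, fun γ => (h2 γ).trans (h γ).symm⟩

/-! #### Terms and variables -/

/-- The variables of `C` are among those of `C'`, along the projection `g`. -/
class IsProj {R : Sig} {Γ Γ' : Type 1} {n' m' k' : ℕ} {n m k : outParam ℕ}
    (C' : Ctx R Γ' n' m' k') (g : Γ' → Γ) (C : outParam (Ctx R Γ n m k)) : Prop where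
  M : ∀ p, C.M (g p) = C'.M p
  I : ∀ p, C.I (g p) ≍ C'.I p
  e : ∃ ρ : Fin n → Fin n', ∀ p i, C.e (g p) i ≍ C'.e p (ρ i)
  E : ∃ ρ : Fin m → Fin m', ∀ p i, C.E (g p) i ≍ C'.E p (ρ i)
  F : ∃ ρ : Fin k → Fin k', ∀ p i, C.F (g p) i ≍ C'.F p (ρ i)

/-- `C'` is the context `C` with a further variable. -/
class IsExt {R : Sig} {Γ : Type 1} {n' m' k' : ℕ} {n m k : outParam ℕ} {β : Γ → Type}
    (C' : Ctx R (Sigma β) n' m' k') (C : outParam (Ctx R Γ n m k)) : Prop where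
  out : IsProj C' Sigma.fst C

instance : IsExt (no_index C.consN) C :=
  ⟨⟨fun _ => rfl, fun _ => .rfl, ⟨Fin.succ, fun _ _ => .rfl⟩, ⟨id, fun _ _ => .rfl⟩, ⟨id, fun _ _ => .rfl⟩⟩⟩

instance : IsExt (no_index C.consS) C :=
  ⟨⟨fun _ => rfl, fun _ => .rfl, ⟨id, fun _ _ => .rfl⟩, ⟨Fin.succ, fun _ _ => .rfl⟩, ⟨id, fun _ _ => .rfl⟩⟩⟩

instance : IsExt (no_index C.consH) C :=
  ⟨⟨fun _ => rfl, fun _ => .rfl, ⟨id, fun _ _ => .rfl⟩, ⟨id, fun _ _ => .rfl⟩, ⟨Fin.succ, fun _ _ => .rfl⟩⟩⟩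

instance : IsProj C (fun γ => γ) C :=
  ⟨fun _ => rfl, fun _ => .rfl, ⟨id, fun _ _ => .rfl⟩, ⟨id, fun _ _ => .rfl⟩, ⟨id, fun _ _ => .rfl⟩⟩

theorem IsProj.comp {Γ₁ Γ₂ : Type 1} {n₁ m₁ k₁ n₂ m₂ k₂ : ℕ} {C₁ : Ctx R Γ₁ n₁ m₁ k₁}
    {C₂ : Ctx R Γ₂ n₂ m₂ k₂} {g : Γ₂ → Γ₁} {f : Γ₁ → Γ} (hg : IsProj C₂ g C₁)
    (hf : IsProj C₁ f C) : IsProj C₂ (fun p => f (g p)) C := by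
  obtain ⟨hM, hI, ⟨ρ, hρ⟩, ⟨σ, hσ⟩, ⟨τ, hτ⟩⟩ := hg
  obtain ⟨hM', hI', ⟨ρ', hρ'⟩, ⟨σ', hσ'⟩, ⟨τ', hτ'⟩⟩ := hf
  exact ⟨fun p => (hM' _).trans (hM p), fun p => (hI' _).trans (hI p), ⟨ρ ∘ ρ', fun p i => (hρ' _ i).trans (hρ p _)⟩,
    ⟨σ ∘ σ', fun p i => (hσ' _ i).trans (hσ p _)⟩, ⟨τ ∘ τ', fun p i => (hτ' _ i).trans (hτ p _)⟩⟩

/-- Lets instance search follow a projection such as `p.1.1.1` back through the nested contexts, one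
variable at a time. -/
instance isProj_fst {Γ' : Type 1} {n' m' k' n₁ m₁ k₁ : ℕ} {C' : Ctx R Γ' n' m' k'}
    {β : Γ → Type} {C₁ : Ctx R (Sigma β) n₁ m₁ k₁} (g : Γ' → Sigma β) [hg : IsProj C' g C₁]
    [h : IsExt C₁ C] : IsProj C' (fun p => (g p).1) C := hg.comp h.out

def _root_.BoundedArith.Tm.ren {n m n' m' : ℕ} (f : Fin n → Fin n') (g : Fin m → Fin m') :
    Tm n m → Tm n' m'
  | .var i => .var (f i)
  | .zero => .zero
  | .one => .one
  | .add s t => .add (s.ren f g) (t.ren f g)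
  | .mul s t => .mul (s.ren f g) (t.ren f g)
  | .len X => .len (g X)

theorem _root_.BoundedArith.Tm.val_ren {M M' : Struct} (h : M = M') {n m n' m' : ℕ}
    (f : Fin n → Fin n') (g : Fin m → Fin m') (t : Tm n m) {e : Fin n → M.N} {E : Fin m → M.S}
    {e' : Fin n' → M'.N} {E' : Fin m' → M'.S} (he : ∀ i, e i ≍ e' (f i))
    (hE : ∀ i, E i ≍ E' (g i)) : (t.ren f g).val M' e' E' ≍ t.val M e E := by
  subst h
  simp only [heq_eq_eq] at *
  induction t <;> simp_all [Tm.ren, Tm.val]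

instance isTm_head : (no_index C.consN).IsTm (fun p => p.2) := ⟨.var 0, fun _ => .rfl⟩

instance isSVar_head : (no_index C.consS).IsSVar (fun p => p.2) := ⟨0, fun _ => .rfl⟩

instance isHVar_head : (no_index C.consH).IsHVar (fun p => p.2) := ⟨0, fun _ => .rfl⟩

section

variable {Γ' : Type 1} {n' m' k' : ℕ} {C' : Ctx R Γ' n' m' k'} {T : Γ → Type}

/-- Weakening: a term stays a term when further variables are added. Equality is heterogeneous
because the models of the two contexts are only propositionally equal. -/
instance (priority := 900) isTm_proj (f : (γ : Γ) → T γ) (g : Γ' → Γ) [hg : IsProj C' g C]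
    [hf : C.IsTm f] : C'.IsTm (fun p => f (g p)) := by
  obtain ⟨hM, -, ⟨ρ, hρ⟩, ⟨σ, hσ⟩, -⟩ := hg
  obtain ⟨t, ht⟩ := hf.out
  exact ⟨t.ren ρ σ, fun p => (Tm.val_ren (hM p) ρ σ t (hρ p) (hσ p)).trans (ht _)⟩

instance (priority := 900) isSVar_proj (f : (γ : Γ) → T γ) (g : Γ' → Γ) [hg : IsProj C' g C]
    [hf : C.IsSVar f] : C'.IsSVar (fun p => f (g p)) := by
  obtain ⟨-, -, -, ⟨σ, hσ⟩, -⟩ := hg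
  obtain ⟨i, hi⟩ := hf.out
  exact ⟨σ i, fun p => (hσ p i).symm.trans (hi _)⟩

instance (priority := 900) isHVar_proj (f : (γ : Γ) → T γ) (g : Γ' → Γ) [hg : IsProj C' g C]
    [hf : C.IsHVar f] : C'.IsHVar (fun p => f (g p)) := by
  obtain ⟨-, -, -, -, ⟨σ, hσ⟩⟩ := hg
  obtain ⟨i, hi⟩ := hf.out
  exact ⟨σ i, fun p => (hσ p i).symm.trans (hi _)⟩

instance (priority := 900) isTms_proj {a : ℕ} (f : (γ : Γ) → Fin a → T γ) (g : Γ' → Γ)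
    [hg : IsProj C' g C] [hf : C.IsTms f] : C'.IsTms (fun p => f (g p)) :=
  ⟨fun i => by have := hf.out i; exact isTm_proj (fun γ => f γ i) g⟩

instance (priority := 900) isSVars_proj {a : ℕ} (f : (γ : Γ) → Fin a → T γ) (g : Γ' → Γ)
    [hg : IsProj C' g C] [hf : C.IsSVars f] : C'.IsSVars (fun p => f (g p)) :=
  ⟨fun i => by have := hf.out i; exact isSVar_proj (fun γ => f γ i) g⟩

instance (priority := 900) isHVars_proj {a : ℕ} (f : (γ : Γ) → Fin a → T γ) (g : Γ' → Γ)
    [hg : IsProj C' g C] [hf : C.IsHVars f] : C'.IsHVars (fun p => f (g p)) :=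
  ⟨fun i => by have := hf.out i; exact isHVar_proj (fun γ => f γ i) g⟩

end

section

variable {M : Struct} [M.W11] {I : Interp R M} {e : Fin n → M.N} {E : Fin m → M.S}
  {F : Fin k → M.H}

instance isTm_fixed (x : M.N) [h : Param x e] :
    (no_index (fixed M I e E F)).IsTm (fun _ => x) := by
  obtain ⟨i, hi⟩ := h.out
  exact ⟨.var i, fun _ => heq_of_eq hi⟩

instance isSVar_fixed (X : M.S) [h : Param X E] :
    (no_index (fixed M I e E F)).IsSVar (fun _ => X) := by
  obtain ⟨i, hi⟩ := h.out
  exact ⟨i, fun _ => heq_of_eq hi⟩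

instance isHVar_fixed (Z : M.H) [h : Param Z F] :
    (no_index (fixed M I e E F)).IsHVar (fun _ => Z) := by
  obtain ⟨i, hi⟩ := h.out
  exact ⟨i, fun _ => heq_of_eq hi⟩

end

section

variable {T : Type} {n' m' k' : ℕ} {β : Γ → Type} {C' : Ctx R (Sigma β) n' m' k'}

/-- Over a fixed model the parameters are constant functions, in which no projection is visible;
this is the form of weakening for them. -/
instance isTm_const (x : T) [hC : IsExt C' C] [h : C.IsTm (fun _ => x)] :
    C'.IsTm (fun _ => x) := by
  have := hC.out
  exact isTm_proj (fun _ => x) (Sigma.fst : Sigma β → Γ)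

instance isSVar_const (x : T) [hC : IsExt C' C] [h : C.IsSVar (fun _ => x)] :
    C'.IsSVar (fun _ => x) := by
  have := hC.out
  exact isSVar_proj (fun _ => x) (Sigma.fst : Sigma β → Γ)

instance isHVar_const (x : T) [hC : IsExt C' C] [h : C.IsHVar (fun _ => x)] :
    C'.IsHVar (fun _ => x) := by
  have := hC.out
  exact isHVar_proj (fun _ => x) (Sigma.fst : Sigma β → Γ)

end

instance isTms_const {a : ℕ} {T : Type} (v : Fin a → T) [h : ∀ i, C.IsTm (fun _ => v i)] :
    C.IsTms (fun _ => v) := ⟨h⟩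

instance isSVars_const {a : ℕ} {T : Type} (v : Fin a → T) [h : ∀ i, C.IsSVar (fun _ => v i)] :
    C.IsSVars (fun _ => v) := ⟨h⟩

instance isHVars_const {a : ℕ} {T : Type} (v : Fin a → T) [h : ∀ i, C.IsHVar (fun _ => v i)] :
    C.IsHVars (fun _ => v) := ⟨h⟩

instance isTm_zero : C.IsTm (fun γ => (C.M γ).zero) := ⟨.zero, fun _ => .rfl⟩
instance isTm_zero' : C.IsTm (fun γ => (0 : (C.M γ).N)) := ⟨.zero, fun _ => .rfl⟩
instance isTm_one : C.IsTm (fun γ => (C.M γ).one) := ⟨.one, fun _ => .rfl⟩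
instance isTm_one' : C.IsTm (fun γ => (1 : (C.M γ).N)) := ⟨.one, fun _ => .rfl⟩

instance isTm_add (f g : (γ : Γ) → (C.M γ).N) [hf : C.IsTm f] [hg : C.IsTm g] :
    C.IsTm (fun γ => (C.M γ).add (f γ) (g γ)) := by
  obtain ⟨s, hs⟩ := hf.out
  obtain ⟨t, ht⟩ := hg.out
  exact ⟨.add s t, fun γ => by
    rw [Tm.val, eq_of_heq (hs γ), eq_of_heq (ht γ)]⟩

instance isTm_add' (f g : (γ : Γ) → (C.M γ).N) [hf : C.IsTm f] [hg : C.IsTm g] :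
    C.IsTm (fun γ => f γ + g γ) := isTm_add f g

instance isTm_mul (f g : (γ : Γ) → (C.M γ).N) [hf : C.IsTm f] [hg : C.IsTm g] :
    C.IsTm (fun γ => (C.M γ).mul (f γ) (g γ)) := by
  obtain ⟨s, hs⟩ := hf.out
  obtain ⟨t, ht⟩ := hg.out
  exact ⟨.mul s t, fun γ => by
    rw [Tm.val, eq_of_heq (hs γ), eq_of_heq (ht γ)]⟩

instance isTm_succN (f : (γ : Γ) → (C.M γ).N) [hf : C.IsTm f] :
    C.IsTm (fun γ => (C.M γ).succN (f γ)) := isTm_add f _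

instance isTm_len (X : (γ : Γ) → (C.M γ).S) [hX : C.IsSVar X] :
    C.IsTm (fun γ => (C.M γ).len (X γ)) := by
  obtain ⟨i, hi⟩ := hX.out
  exact ⟨.len i, fun γ => by rw [Tm.val, eq_of_heq (hi γ)]⟩

instance isTms_cons {a : ℕ} {T : Γ → Type} (f : (γ : Γ) → T γ) (v : (γ : Γ) → Fin a → T γ)
    [hf : C.IsTm f] [hv : C.IsTms v] :
    C.IsTms (a := a + 1) (fun γ => (Fin.cons (f γ) (v γ) : Fin (a + 1) → T γ)) :=
  ⟨fun i => by
    induction i using Fin.cases with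
    | zero => exact hf
    | succ i => exact hv.out i⟩

instance isSVars_cons {a : ℕ} {T : Γ → Type} (f : (γ : Γ) → T γ) (v : (γ : Γ) → Fin a → T γ)
    [hf : C.IsSVar f] [hv : C.IsSVars v] :
    C.IsSVars (a := a + 1) (fun γ => (Fin.cons (f γ) (v γ) : Fin (a + 1) → T γ)) :=
  ⟨fun i => by
    induction i using Fin.cases with
    | zero => exact hf
    | succ i => exact hv.out i⟩

instance isHVars_elim0 {T : Γ → Type} :
    C.IsHVars (a := 0) (T := T) (fun _ => Fin.elim0) := ⟨fun i => i.elim0⟩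

/-! #### Closure properties of definability -/

instance def_eqN (f g : (γ : Γ) → (C.M γ).N) [hf : C.IsTm f] [hg : C.IsTm g] :
    C.Def (fun γ => f γ = g γ) := by
  obtain ⟨s, hs⟩ := hf.out
  obtain ⟨t, ht⟩ := hg.out
  exact ⟨.eqN s t, trivial, fun γ => by
    rw [Fm.Holds, eq_of_heq (hs γ), eq_of_heq (ht γ)]⟩

instance def_le (f g : (γ : Γ) → (C.M γ).N) [hf : C.IsTm f] [hg : C.IsTm g] :
    C.Def (fun γ => (C.M γ).le (f γ) (g γ)) := by
  obtain ⟨s, hs⟩ := hf.out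
  obtain ⟨t, ht⟩ := hg.out
  exact ⟨.le s t, trivial, fun γ => by
    rw [Fm.Holds, eq_of_heq (hs γ), eq_of_heq (ht γ)]⟩

instance def_le' (f g : (γ : Γ) → (C.M γ).N) [hf : C.IsTm f] [hg : C.IsTm g] :
    C.Def (fun γ => f γ ≤ g γ) := def_le f g

instance def_eqS (X Y : (γ : Γ) → (C.M γ).S) [hX : C.IsSVar X] [hY : C.IsSVar Y] :
    C.Def (fun γ => X γ = Y γ) := by
  obtain ⟨i, hi⟩ := hX.out
  obtain ⟨j, hj⟩ := hY.out
  exact ⟨.eqS i j, trivial, fun γ => by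
    rw [Fm.Holds, eq_of_heq (hi γ), eq_of_heq (hj γ)]⟩

instance def_mem (f : (γ : Γ) → (C.M γ).N) (X : (γ : Γ) → (C.M γ).S) [hf : C.IsTm f]
    [hX : C.IsSVar X] : C.Def (fun γ => (C.M γ).mem (f γ) (X γ)) := by
  obtain ⟨s, hs⟩ := hf.out
  obtain ⟨i, hi⟩ := hX.out
  exact ⟨.mem s i, trivial, fun γ => by
    rw [Fm.Holds, eq_of_heq (hs γ), eq_of_heq (hi γ)]⟩

instance def_hmem (X : (γ : Γ) → (C.M γ).S) (Z : (γ : Γ) → (C.M γ).H) [hX : C.IsSVar X]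
    [hZ : C.IsHVar Z] : C.Def (fun γ => (C.M γ).hmem (X γ) (Z γ)) := by
  obtain ⟨i, hi⟩ := hX.out
  obtain ⟨j, hj⟩ := hZ.out
  exact ⟨.hmem i j, trivial, fun γ => by
    rw [Fm.Holds, eq_of_heq (hi γ), eq_of_heq (hj γ)]⟩

instance def_not (P : Γ → Prop) [hP : C.Def P] : C.Def (fun γ => ¬ P γ) := by
  obtain ⟨φ, h1, h2⟩ := hP.out
  exact ⟨.neg φ, h1, fun γ => by rw [Fm.Holds, h2]⟩

instance def_and (P Q : Γ → Prop) [hP : C.Def P] [hQ : C.Def Q] :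
    C.Def (fun γ => P γ ∧ Q γ) := by
  obtain ⟨φ, h1, h2⟩ := hP.out
  obtain ⟨ψ, h3, h4⟩ := hQ.out
  exact ⟨.conj φ ψ, ⟨h1, h3⟩, fun γ => by rw [Fm.Holds, h2, h4]⟩

instance def_or (P Q : Γ → Prop) [hP : C.Def P] [hQ : C.Def Q] :
    C.Def (fun γ => P γ ∨ Q γ) := by
  obtain ⟨φ, h1, h2⟩ := hP.out
  obtain ⟨ψ, h3, h4⟩ := hQ.out
  exact ⟨.disj φ ψ, ⟨h1, h3⟩, fun γ => by rw [Fm.Holds, h2, h4]⟩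

instance def_imp (P Q : Γ → Prop) [C.Def P] [C.Def Q] : C.Def (fun γ => P γ → Q γ) :=
  (def_or (fun γ => ¬ P γ) Q).congr fun _ => by tauto

instance def_iff (P Q : Γ → Prop) [C.Def P] [C.Def Q] : C.Def (fun γ => P γ ↔ Q γ) :=
  (def_and (fun γ => P γ → Q γ) (fun γ => Q γ → P γ)).congr fun _ => by tauto

instance def_lt (f g : (γ : Γ) → (C.M γ).N) [hf : C.IsTm f] [hg : C.IsTm g] :
    C.Def (fun γ => (C.M γ).lt (f γ) (g γ)) :=
  def_and (fun γ => (C.M γ).le (f γ) (g γ)) (fun γ => ¬ f γ = g γ)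

instance def_lt' (f g : (γ : Γ) → (C.M γ).N) [hf : C.IsTm f] [hg : C.IsTm g] :
    C.Def (fun γ => f γ < g γ) := def_lt f g

instance def_exN (t : (γ : Γ) → (C.M γ).N) (Q : (γ : Γ) → (C.M γ).N → Prop) [ht : C.IsTm t]
    [hQ : C.consN.Def (fun p => Q p.1 p.2)] : C.Def (fun γ => ∃ i, i ≤ t γ ∧ Q γ i) := by
  obtain ⟨s, hs⟩ := ht.out
  obtain ⟨φ, h1, h2⟩ := hQ.out
  refine ⟨.exN s φ, h1, fun γ => ?_⟩
  rw [Fm.Holds, eq_of_heq (hs γ)]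
  exact exists_congr fun b => and_congr Iff.rfl (h2 ⟨γ, b⟩)

instance def_allN (t : (γ : Γ) → (C.M γ).N) (Q : (γ : Γ) → (C.M γ).N → Prop) [ht : C.IsTm t]
    [hQ : C.consN.Def (fun p => Q p.1 p.2)] : C.Def (fun γ => ∀ i, i ≤ t γ → Q γ i) := by
  obtain ⟨s, hs⟩ := ht.out
  obtain ⟨φ, h1, h2⟩ := hQ.out
  refine ⟨.allN s φ, h1, fun γ => ?_⟩
  rw [Fm.Holds, eq_of_heq (hs γ)]
  exact forall_congr' fun b => imp_congr Iff.rfl (h2 ⟨γ, b⟩)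

instance def_exN_lt (t : (γ : Γ) → (C.M γ).N) (Q : (γ : Γ) → (C.M γ).N → Prop)
    [ht : C.IsTm t] [hQ : C.consN.Def (fun p => Q p.1 p.2)] :
    C.Def (fun γ => ∃ i, i < t γ ∧ Q γ i) :=
  (def_exN t (fun γ i => ¬ i = t γ ∧ Q γ i)).congr fun _ => exists_congr fun _ => and_assoc

instance def_allN_lt (t : (γ : Γ) → (C.M γ).N) (Q : (γ : Γ) → (C.M γ).N → Prop)
    [ht : C.IsTm t] [hQ : C.consN.Def (fun p => Q p.1 p.2)] :
    C.Def (fun γ => ∀ i, i < t γ → Q γ i) :=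
  (def_allN t (fun γ i => ¬ i = t γ → Q γ i)).congr fun _ => forall_congr' fun _ => and_imp

instance def_exS (t : (γ : Γ) → (C.M γ).N) (Q : (γ : Γ) → (C.M γ).S → Prop) [ht : C.IsTm t]
    [hQ : C.consS.Def (fun p => Q p.1 p.2)] :
    C.Def (fun γ => ∃ X, (C.M γ).len X ≤ t γ ∧ Q γ X) := by
  obtain ⟨s, hs⟩ := ht.out
  obtain ⟨φ, h1, h2⟩ := hQ.out
  refine ⟨.exS s φ, h1, fun γ => ?_⟩
  rw [Fm.Holds, eq_of_heq (hs γ)]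
  exact exists_congr fun b => and_congr Iff.rfl (h2 ⟨γ, b⟩)

instance def_allS (t : (γ : Γ) → (C.M γ).N) (Q : (γ : Γ) → (C.M γ).S → Prop) [ht : C.IsTm t]
    [hQ : C.consS.Def (fun p => Q p.1 p.2)] :
    C.Def (fun γ => ∀ X, (C.M γ).len X ≤ t γ → Q γ X) := by
  obtain ⟨s, hs⟩ := ht.out
  obtain ⟨φ, h1, h2⟩ := hQ.out
  refine ⟨.allS s φ, h1, fun γ => ?_⟩
  rw [Fm.Holds, eq_of_heq (hs γ)]
  exact forall_congr' fun b => imp_congr Iff.rfl (h2 ⟨γ, b⟩)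

instance sig1_of_def (P : Γ → Prop) [h : C.Def P] : C.Sig1 P := by
  obtain ⟨φ, h1, h2⟩ := h.out
  exact ⟨φ, .base h1, h2⟩

instance sig1_exH (Q : (γ : Γ) → (C.M γ).H → Prop)
    [hQ : C.consH.Sig1 (fun p => Q p.1 p.2)] : C.Sig1 (fun γ => ∃ Z, Q γ Z) := by
  obtain ⟨φ, h1, h2⟩ := hQ.out
  refine ⟨.exH φ, .ex h1, fun γ => ?_⟩
  rw [Fm.Holds]
  exact exists_congr fun b => h2 ⟨γ, b⟩

instance pi1_of_def (P : Γ → Prop) [h : C.Def P] : C.Pi1 P := by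
  obtain ⟨φ, h1, h2⟩ := h.out
  exact ⟨φ, .base h1, h2⟩

instance pi1_allH (Q : (γ : Γ) → (C.M γ).H → Prop)
    [hQ : C.consH.Pi1 (fun p => Q p.1 p.2)] : C.Pi1 (fun γ => ∀ Z, Q γ Z) := by
  obtain ⟨φ, h1, h2⟩ := hQ.out
  refine ⟨.allH φ, .all h1, fun γ => ?_⟩
  rw [Fm.Holds]
  exact forall_congr' fun b => h2 ⟨γ, b⟩

instance allSig1_of_sig1 (P : Γ → Prop) [h : C.Sig1 P] : C.AllSig1 P := by
  obtain ⟨φ, h1, h2⟩ := h.out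
  exact ⟨φ, .base h1, h2⟩

instance allSig1_allS (t : (γ : Γ) → (C.M γ).N) (Q : (γ : Γ) → (C.M γ).S → Prop)
    [ht : C.IsTm t] [hQ : C.consS.AllSig1 (fun p => Q p.1 p.2)] :
    C.AllSig1 (fun γ => ∀ X, (C.M γ).len X ≤ t γ → Q γ X) := by
  obtain ⟨s, hs⟩ := ht.out
  obtain ⟨φ, h1, h2⟩ := hQ.out
  refine ⟨.allS s φ, .all s h1, fun γ => ?_⟩
  rw [Fm.Holds, eq_of_heq (hs γ)]
  exact forall_congr' fun b => imp_congr Iff.rfl (h2 ⟨γ, b⟩)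

end Ctx
end BoundedArith

/-! ### Substitution into formulas; the schemes for definable predicates -/

namespace BoundedArith
namespace Ctx

theorem isTm_val {R : Sig} {Γ : Type 1} {n m k n' m' : ℕ} {C : Ctx R Γ n m k} (t : Tm n' m')
    (e : (γ : Γ) → Fin n' → (C.M γ).N) (E : (γ : Γ) → Fin m' → (C.M γ).S)
    [he : C.IsTms e] [hE : C.IsSVars E] : C.IsTm (fun γ => t.val (C.M γ) (e γ) (E γ)) := by
  induction t with
  | var i => exact he.out i
  | zero => exact isTm_zero
  | one => exact isTm_one
  | add s t hs ht => exact isTm_add _ _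
  | mul s t hs ht => exact isTm_mul _ _
  | len X => have := hE.out X; exact isTm_len (fun γ => E γ X)

/-- The substitution lemma in semantic form. It returns from a formula to a predicate of an
arbitrary context, and so allows a predicate known only to be definable to occur inside larger ones.
-/
theorem def_holds {R : Sig} {Γ : Type 1} {n m k n' m' k' : ℕ} {C : Ctx R Γ n m k} {ψ : Fm R n' m' k'}
    (hψ : ψ.NoH) (e : (γ : Γ) → Fin n' → (C.M γ).N) (E : (γ : Γ) → Fin m' → (C.M γ).S)
    (F : (γ : Γ) → Fin k' → (C.M γ).H) [he : C.IsTms e] [hE : C.IsSVars E] [hF : C.IsHVars F] :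
    C.Def (fun γ => ψ.Holds (C.M γ) (C.I γ) (e γ) (E γ) (F γ)) := by
  induction ψ generalizing Γ n m k with
  | eqN s t => have := isTm_val s e E; have := isTm_val t e E; exact def_eqN _ _
  | le s t => have := isTm_val s e E; have := isTm_val t e E; exact def_le _ _
  | eqS X Y => have := hE.out X; have := hE.out Y; exact def_eqS (fun γ => E γ X) (fun γ => E γ Y)
  | mem t X =>
    have := isTm_val t e E; have := hE.out X
    exact def_mem (fun γ => t.val (C.M γ) (e γ) (E γ)) (fun γ => E γ X)
  | hmem X Z =>
    have := hE.out X; have := hF.out Z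
    exact def_hmem (fun γ => E γ X) (fun γ => F γ Z)
  | rel r ts Xs =>
    choose t ht using fun i => (isTm_val (ts i) e E).out
    choose X hX using fun i => (hE.out (Xs i)).out
    refine ⟨.rel r t X, trivial, fun γ => ?_⟩
    have h1 : (fun i => (t i).val (C.M γ) (C.e γ) (C.E γ)) = fun i => (ts i).val (C.M γ) (e γ) (E γ) :=
      funext fun i => eq_of_heq (ht i γ)
    have h2 : (fun i => C.E γ (X i)) = fun i => E γ (Xs i) := funext fun i => eq_of_heq (hX i γ)
    simp only [Fm.Holds, h1, h2]
  | neg φ ih => have := ih hψ e E F; exact def_not _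
  | conj φ ψ ih1 ih2 =>
    have := ih1 hψ.1 e E F; have := ih2 hψ.2 e E F; exact def_and _ _
  | disj φ ψ ih1 ih2 =>
    have := ih1 hψ.1 e E F; have := ih2 hψ.2 e E F; exact def_or _ _
  | exN t φ ih =>
    have := isTm_val t e E
    have := ih (C := C.consN) hψ (fun p => Fin.cons p.2 (e p.1)) (fun p => E p.1) (fun p => F p.1)
    exact def_exN _ (fun γ b => φ.Holds (C.M γ) (C.I γ) (Fin.cons b (e γ)) (E γ) (F γ))
  | allN t φ ih =>
    have := isTm_val t e E
    have := ih (C := C.consN) hψ (fun p => Fin.cons p.2 (e p.1)) (fun p => E p.1) (fun p => F p.1)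
    exact def_allN _ (fun γ b => φ.Holds (C.M γ) (C.I γ) (Fin.cons b (e γ)) (E γ) (F γ))
  | exS t φ ih =>
    have := isTm_val t e E
    have := ih (C := C.consS) hψ (fun p => e p.1) (fun p => Fin.cons p.2 (E p.1)) (fun p => F p.1)
    exact def_exS _ (fun γ b => φ.Holds (C.M γ) (C.I γ) (e γ) (Fin.cons b (E γ)) (F γ))
  | allS t φ ih =>
    have := isTm_val t e E
    have := ih (C := C.consS) hψ (fun p => e p.1) (fun p => Fin.cons p.2 (E p.1)) (fun p => F p.1)
    exact def_allS _ (fun γ b => φ.Holds (C.M γ) (C.I γ) (e γ) (Fin.cons b (E γ)) (F γ))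
  | exH φ => exact hψ.elim
  | allH φ => exact hψ.elim

theorem def_holds_of_eq {R : Sig} {Γ : Type 1} {n m k n' m' k' : ℕ} {C : Ctx R Γ n m k}
    {ψ : Fm R n' m' k'} (hψ : ψ.NoH) {M : Γ → Struct} {I : (γ : Γ) → Interp R (M γ)}
    (hM : ∀ γ, M γ = C.M γ) (hI : ∀ γ, I γ ≍ C.I γ) (e : (γ : Γ) → Fin n' → (M γ).N)
    (E : (γ : Γ) → Fin m' → (M γ).S) (F : (γ : Γ) → Fin k' → (M γ).H) [C.IsTms e] [C.IsSVars E]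
    [C.IsHVars F] : C.Def (fun γ => ψ.Holds (M γ) (I γ) (e γ) (E γ) (F γ)) := by
  obtain rfl : M = C.M := funext hM
  obtain rfl : I = C.I := funext fun γ => eq_of_heq (hI γ)
  exact def_holds hψ e E F

/-- The context `C` extends a fixed context. -/
class Over {R : Sig} {Γ : Type 1} {n m k n' m' k' : ℕ} (C : Ctx R Γ n m k) (M : Struct) [M.W11]
    (I : Interp R M) (e : Fin n' → M.N) (E : Fin m' → M.S) (F : Fin k' → M.H) : Prop where
  out : IsProj C (fun _ => PUnit.unit) (fixed M I e E F)

section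

variable {R : Sig} {n m k : ℕ} {M : Struct} [M.W11] {I : Interp R M} {e : Fin n → M.N}
  {E : Fin m → M.S} {F : Fin k → M.H} {Γ : Type 1} {n' m' k' : ℕ} {C : Ctx R Γ n' m' k'}

instance : Over (no_index (fixed M I e E F)) M I e E F :=
  ⟨⟨fun _ => rfl, fun _ => .rfl, ⟨id, fun _ _ => .rfl⟩, ⟨id, fun _ _ => .rfl⟩,
    ⟨id, fun _ _ => .rfl⟩⟩⟩

instance over_ext {n₁ m₁ k₁ : ℕ} {β : Γ → Type} {C' : Ctx R (Sigma β) n₁ m₁ k₁}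
    [h : IsExt C' C] [hC : Over C M I e E F] : Over C' M I e E F :=
  ⟨h.out.comp hC.out⟩

theorem Over.isTms (hC : Over C M I e E F) : C.IsTms (fun _ => e) :=
  let ⟨ρ, hρ⟩ := hC.out.e
  ⟨fun i => ⟨.var (ρ i), fun γ => (hρ γ i).symm⟩⟩

theorem Over.isSVars (hC : Over C M I e E F) : C.IsSVars (fun _ => E) :=
  let ⟨σ, hσ⟩ := hC.out.E
  ⟨fun i => ⟨σ i, fun γ => (hσ γ i).symm⟩⟩

theorem Over.isHVars (hC : Over C M I e E F) : C.IsHVars (fun _ => F) :=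
  let ⟨τ, hτ⟩ := hC.out.F
  ⟨fun i => ⟨τ i, fun γ => (hτ γ i).symm⟩⟩

/-- The argument of `A` may be any string variable of an extended context. The induction formulas
built from an arbitrary definable `A` need this. -/
theorem Over.def_consS (hC : Over C M I e E F) {A : M.S → Prop}
    (hA : (fixed M I e E F).consS.Def (fun p => A p.2)) (X : Γ → M.S) [C.IsSVar X] :
    C.Def (fun γ => A (X γ)) := by
  obtain ⟨φ, h1, h2⟩ := hA.out
  have := hC.isTms
  have := hC.isSVars
  have := hC.isHVars
  exact (def_holds_of_eq h1 hC.out.M hC.out.I (fun _ => e) (fun γ => Fin.cons (X γ) E)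
    (fun _ => F)).congr fun γ => (h2 ⟨⟨⟩, X γ⟩).symm

theorem Over.def_consS_consS_consS (hC : Over C M I e E F) {G : M.S → M.S → M.S → Prop}
    (hG : (fixed M I e E F).consS.consS.consS.Def (fun p => G p.1.1.2 p.1.2 p.2))
    (X Y Z : Γ → M.S) [C.IsSVar X] [C.IsSVar Y] [C.IsSVar Z] :
    C.Def (fun γ => G (X γ) (Y γ) (Z γ)) := by
  obtain ⟨φ, h1, h2⟩ := hG.out
  have := hC.isTms
  have := hC.isSVars
  have := hC.isHVars
  exact (def_holds_of_eq h1 hC.out.M hC.out.I (fun _ => e)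
    (fun γ => Fin.cons (Z γ) (Fin.cons (Y γ) (Fin.cons (X γ) E)))
    (fun _ => F)).congr fun γ => (h2 ⟨⟨⟨⟨⟩, X γ⟩, Y γ⟩, Z γ⟩).symm

end

theorem def_app (φ : Operator) {R : Sig} {Γ : Type 1} {n m k : ℕ} {C : Ctx R Γ n m k}
    (a : (γ : Γ) → Fin φ.p → (C.M γ).N) (A : (γ : Γ) → Fin φ.q → (C.M γ).S)
    (i : (γ : Γ) → (C.M γ).N) (Z : (γ : Γ) → (C.M γ).S)
    [C.IsTms a] [C.IsSVars A] [C.IsTm i] [C.IsSVar Z] :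
    C.Def (fun γ => φ.App (C.M γ) (a γ) (A γ) (i γ) (Z γ)) :=
  (def_holds (R := R) φ.isSigma0.noH.lift (fun γ => Fin.cons (i γ) (a γ))
    (fun γ => Fin.cons (Z γ) (A γ)) (fun _ => Fin.elim0)).congr fun _ => (Fm.holds_lift ..).symm

attribute [instance] def_app

end Ctx

namespace Struct

variable {R : Sig} {M : Struct} {I : Interp R M} {n m k : ℕ}

theorem IsW11With.w11 (h : M.IsW11With R I) : M.W11 := ⟨h.isW11⟩

/-- Induction on numbers. -/
theorem IsW11With.num_induction [M.W11] (h : M.IsW11With R I) (e : Fin n → M.N)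
    (E : Fin m → M.S) (F : Fin k → M.H) (A : M.N → Prop)
    [hA : (Ctx.fixed M I e E F).consN.AllSig1 (fun p => A p.2)] (h0 : A 0)
    (hs : ∀ b, A b → A (M.succN b)) (b : M.N) : A b := by
  obtain ⟨φ, h1, h2⟩ := hA.out
  have key (b : M.N) : φ.Holds M I (Fin.cons b e) E F ↔ A b := h2 ⟨⟨⟩, b⟩
  have := h.ind n m k φ h1 e E F
  simp only [key] at this
  exact this h0 hs b

/-- Comprehension. -/
theorem IsW11With.exists_str [M.W11] (h : M.IsW11With R I) (e : Fin n → M.N)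
    (E : Fin m → M.S) (F : Fin k → M.H) (x : M.N) (A : M.N → Prop)
    [hA : (Ctx.fixed M I e E F).consN.Def (fun p => A p.2)] :
    ∃ Y, M.len Y ≤ x ∧ ∀ i, i < x → (M.mem i Y ↔ A i) := by
  obtain ⟨φ, h1, h2⟩ := hA.out
  have key (b : M.N) : φ.Holds M I (Fin.cons b e) E F ↔ A b := h2 ⟨⟨⟩, b⟩
  have := h.comp n m k φ h1 e E F x
  simp only [key] at this
  exact this

/-- Comprehension for hyper strings. -/
theorem IsW11With.exists_hyp [M.W11] (h : M.IsW11With R I) (e : Fin n → M.N)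
    (E : Fin m → M.S) (F : Fin k → M.H) (x : M.N) (A : M.S → Prop)
    [hA : (Ctx.fixed M I e E F).consS.Def (fun p => A p.2)] :
    ∃ Z, ∀ Y, M.len Y ≤ x → (M.hmem Y Z ↔ A Y) := by
  obtain ⟨φ, h1, h2⟩ := hA.out
  have key (Y : M.S) : φ.Holds M I e (Fin.cons Y E) F ↔ A Y := h2 ⟨⟨⟩, Y⟩
  have := h.comp3 n m k φ h1 e E F x
  simp only [key] at this
  exact this

variable [hM : M.W11]

theorem w11 : M.IsW11 := hM.out

theorem basic : M.IsBasic := M.w11.basic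

/-! ### Arithmetic of numbers -/

theorem le_of_eq_add {x y z : M.N} (h : z = x + y) : x ≤ z := h ▸ M.basic.b8 x y

theorem N_le_refl (x : M.N) : x ≤ x := le_of_eq_add (M.basic.b3 x).symm

theorem N_le_iff (x y : M.N) : x ≤ y ↔ x < M.succN y := M.basic.b11 x y

theorem N_zero_le (x : M.N) : 0 ≤ x := M.basic.b9 x

theorem N_antisymm {x y : M.N} (h1 : x ≤ y) (h2 : y ≤ x) : x = y := M.basic.b7 x y h1 h2

theorem N_le_succ_iff {x y : M.N} : x ≤ M.succN y ↔ x ≤ y ∨ x = M.succN y := by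
  rw [N_le_iff x y]
  change _ ↔ (x ≤ M.succN y ∧ x ≠ M.succN y) ∨ _
  constructor
  · tauto
  · rintro (h | rfl)
    exacts [h.1, N_le_refl _]

/-- Transitivity is not among the basic axioms. It follows by induction on `z`: `y ≤ 0` forces `y =
0`, and `y ≤ b + 1` means `y ≤ b` or `y = b + 1`. -/
theorem N_le_trans {x y z : M.N} (h1 : x ≤ y) (h2 : y ≤ z) : x ≤ z := by
  refine M.w11.num_induction ![x, y] ![] ![] (fun z => y ≤ z → x ≤ z) ?_ ?_ z h2
  · intro h
    rwa [← N_antisymm h (N_zero_le y)]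
  · intro b ih h
    rcases N_le_succ_iff.1 h with h | rfl
    exacts [N_le_succ_iff.2 (.inl (ih h)), h1]

end Struct
end BoundedArith

/-! ### The linear order of numbers; least and greatest number principles -/

namespace BoundedArith
namespace Struct

variable {M : Struct} [hM : M.W11]

/-- The order relations are those of the model, so general order lemmas apply directly to what
formulas express. -/
noncomputable instance : LinearOrder M.N where
  le := M.le
  lt := M.lt
  le_refl := N_le_refl
  le_trans _ _ _ := N_le_trans
  lt_iff_le_not_ge a b := by
    change M.le a b ∧ a ≠ b ↔ _
    constructor
    · rintro ⟨h1, h2⟩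
      exact ⟨h1, fun h => h2 (N_antisymm h1 h)⟩
    · rintro ⟨h1, h2⟩
      exact ⟨h1, fun h => h2 (h ▸ N_le_refl _)⟩
  le_antisymm _ _ := N_antisymm
  le_total := M.basic.b10
  toDecidableLE := Classical.decRel _

theorem lt_succN_iff {x y : M.N} : x < M.succN y ↔ x ≤ y := (N_le_iff x y).symm

theorem lt_succN (x : M.N) : x < M.succN x := lt_succN_iff.2 le_rfl

theorem N_not_lt_zero (x : M.N) : ¬ x < 0 := not_lt.2 (N_zero_le x)

theorem exists_pred {x : M.N} (h : 0 < x) : ∃ y, M.succN y = x := by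
  obtain ⟨y, -, hy⟩ := M.basic.b12 x h.ne'
  exact ⟨y, hy⟩

theorem succN_le_iff {x y : M.N} : M.succN x ≤ y ↔ x < y := by
  constructor
  · exact fun h => (lt_succN x).trans_le h
  · intro h
    obtain ⟨z, rfl⟩ := exists_pred ((N_zero_le x).trans_lt h)
    have h1 := lt_succN_iff.1 h
    by_contra h2
    exact absurd ((lt_succN_iff.1 (not_le.1 h2)).trans h1) (not_le.2 (lt_succN z))

theorem succN_lt_succN {x y : M.N} : M.succN x < M.succN y ↔ x < y := by
  rw [lt_succN_iff, succN_le_iff]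

theorem succN_le_succN {x y : M.N} : M.succN x ≤ M.succN y ↔ x ≤ y := by
  rw [succN_le_iff, lt_succN_iff]

theorem N_add_zero (x : M.N) : x + 0 = x := M.basic.b3 x

theorem N_add_succN (x y : M.N) : x + M.succN y = M.succN (x + y) := M.basic.b4 x y

theorem N_le_add_right (x y : M.N) : x ≤ x + y := M.basic.b8 x y

theorem N_le_add_left (x y : M.N) : y ≤ x + y := by
  refine M.w11.num_induction ![x] ![] ![] (fun y => y ≤ x + y) (N_zero_le _) ?_ y
  intro b ih
  rw [N_add_succN, succN_le_succN]
  exact ih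

theorem N_add_lt_add (x : M.N) {y z : M.N} (h : y < z) : x + y < x + z := by
  refine M.w11.num_induction ![x, y] ![] ![] (fun z => y < z → x + y < x + z) ?_ ?_ z h
  · exact fun h => absurd h (N_not_lt_zero _)
  · intro b ih h
    rw [N_add_succN, lt_succN_iff]
    rcases (lt_succN_iff.1 h).eq_or_lt with rfl | h
    exacts [le_rfl, (ih h).le]

theorem N_add_lt_add_iff {x y z : M.N} : x + y < x + z ↔ y < z := by
  refine ⟨fun h => ?_, N_add_lt_add x⟩
  rcases lt_trichotomy y z with h1 | rfl | h1
  exacts [h1, absurd h (lt_irrefl _), absurd h (N_add_lt_add x h1).not_gt]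

theorem N_add_left_cancel {x y z : M.N} (h : x + y = x + z) : y = z := by
  rcases lt_trichotomy y z with h1 | h1 | h1
  exacts [absurd h (N_add_lt_add x h1).ne, h1, absurd h (N_add_lt_add x h1).ne']

/-- The bound `z ≤ y` is what makes the induction formula bounded. -/
theorem exists_add_of_le {x y : M.N} (h : x ≤ y) : ∃ z, z ≤ y ∧ y = x + z := by
  refine M.w11.num_induction ![x] ![] ![] (fun y => x ≤ y → ∃ z, z ≤ y ∧ y = x + z) ?_ ?_ y h
  · intro h
    exact ⟨0, le_rfl, by rw [N_add_zero]; exact le_antisymm (N_zero_le _) h⟩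
  · intro b ih h
    rcases h.eq_or_lt with rfl | h
    · exact ⟨0, N_zero_le _, (N_add_zero _).symm⟩
    · obtain ⟨z, h1, h2⟩ := ih (lt_succN_iff.1 h)
      exact ⟨M.succN z, succN_le_succN.2 h1, by rw [N_add_succN, ← h2]⟩

section

variable {R : Sig} {I : Interp R M} {n m k : ℕ}

/-- The least number principle. -/
theorem IsW11With.exists_least (h : M.IsW11With R I) (e : Fin n → M.N)
    (E : Fin m → M.S) (F : Fin k → M.H) (A : M.N → Prop)
    [hA : (Ctx.fixed M I e E F).consN.Def (fun p => A p.2)] {b : M.N} (hb : A b) :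
    ∃ i, A i ∧ ∀ j, j < i → ¬ A j := by
  by_contra! hne
  obtain ⟨φ, h1, h2⟩ := hA.out
  have key (b : M.N) : φ.Holds M I (Fin.cons b e) E F ↔ A b := h2 ⟨⟨⟩, b⟩
  have (b : M.N) : ∀ i, i ≤ b → ¬ A i := by
    have : (Ctx.fixed M I e E F).consN.Def (fun p => ∀ i, i ≤ p.2 → ¬ A i) := by
      simp only [← key]
      have := Ctx.def_holds (C := (Ctx.fixed M I e E F).consN.consN) h1
        (fun p => Fin.cons p.2 e) (fun _ => E) (fun _ => F)
      exact Ctx.def_allN (C := (Ctx.fixed M I e E F).consN) (fun p => p.2)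
        (fun _ i => ¬ φ.Holds M I (Fin.cons i e) E F)
    refine h.num_induction e E F (fun b => ∀ i, i ≤ b → ¬ A i) ?_ ?_ b
    · intro i hi hA
      obtain ⟨j, hj, -⟩ := hne i hA
      exact N_not_lt_zero _ (hj.trans_le hi)
    · intro b ih i hi hA
      obtain ⟨j, hj, hA⟩ := hne i hA
      exact ih j (lt_succN_iff.1 (hj.trans_le hi)) hA
  exact this b b le_rfl hb

/-- The greatest number principle. -/
theorem IsW11With.exists_greatest (h : M.IsW11With R I) (e : Fin n → M.N)
    (E : Fin m → M.S) (F : Fin k → M.H) (A : M.N → Prop)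
    [hA : (Ctx.fixed M I e E F).consN.Def (fun p => A p.2)] {b c : M.N} (hb : A b)
    (hc : ∀ i, A i → i < c) : ∃ i, A i ∧ ∀ j, i < j → ¬ A j := by
  obtain ⟨φ, h1, h2⟩ := hA.out
  have key (b : M.N) : φ.Holds M I (Fin.cons b e) E F ↔ A b := h2 ⟨⟨⟩, b⟩
  have : (Ctx.fixed M I (Matrix.vecCons c e) E F).consN.Def
      (fun p => ∀ i, i ≤ c → A i → i < p.2) := by
    simp only [← key]
    have := Ctx.def_holds (C := (Ctx.fixed M I (Matrix.vecCons c e) E F).consN.consN) h1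
      (fun p => Fin.cons p.2 e) (fun _ => E) (fun _ => F)
    exact Ctx.def_allN (C := (Ctx.fixed M I (Matrix.vecCons c e) E F).consN) (fun _ => c)
      (fun p i => φ.Holds M I (Fin.cons i e) E F → i < p.2)
  -- The greatest element is the predecessor of the least strict upper bound `u`.
  obtain ⟨u, hu, hmin⟩ := h.exists_least (Matrix.vecCons c e) E F
    (fun u => ∀ i, i ≤ c → A i → i < u) (b := c) fun i _ hi => hc i hi
  obtain ⟨i, rfl⟩ := exists_pred ((N_zero_le b).trans_lt (hu b (hc b hb).le hb))
  have hle (j) (hj : A j) : j ≤ i := lt_succN_iff.1 (hu j (hc j hj).le hj)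
  refine ⟨i, ?_, fun j hj hA => not_le.2 hj (hle j hA)⟩
  by_contra hi
  refine hmin i (lt_succN i) fun j _ hj => (hle j hj).lt_of_ne ?_
  rintro rfl
  exact hi hj

end

end Struct
end BoundedArith

namespace BoundedArith
namespace Struct

variable (M : Struct)

/-! ### Strings -/

/-- The string successor, where it exists. -/
noncomputable def ssucc (X : M.S) : M.S := @Classical.epsilon M.S ⟨X⟩ (M.IsSucc X)

/-- `D` codes the pair of `X` and `V`: it has the bits of `X` below `l`, and those of `V` shifted
by `l`. -/
def IsPair (l : M.N) (X V D : M.S) : Prop :=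
  ∀ i, M.mem i D ↔ (i < l ∧ M.mem i X) ∨ ∃ j, j ≤ i ∧ i = l + j ∧ M.mem j V

/-- The string coding the pair of `X` and `V`, where it exists. -/
noncomputable def spair (l : M.N) (X V : M.S) : M.S :=
  @Classical.epsilon M.S ⟨X⟩ (M.IsPair l X V)

/-- The numerical order of strings, as binary numbers. -/
instance : LT M.S := ⟨fun X Y =>
  ∃ i, ¬ M.mem i X ∧ M.mem i Y ∧ ∀ j, i < j → (M.mem j X ↔ M.mem j Y)⟩

variable {M} {R : Sig} {I : Interp R M} {n m k : ℕ}

theorem slt_irrefl (X : M.S) : ¬ X < X := fun ⟨_, h1, h2, _⟩ => h1 h2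

variable [hM : M.W11]

theorem lt_len {i : M.N} {X : M.S} (h : M.mem i X) : i < M.len X := M.basic.l1 X i h

theorem len_le_iff {X : M.S} {x : M.N} : M.len X ≤ x ↔ ∀ i, M.mem i X → i < x := by
  refine ⟨fun h i hi => (lt_len hi).trans_le h, fun h => ?_⟩
  by_contra! hx
  obtain ⟨y, hy⟩ := exists_pred ((N_zero_le x).trans_lt hx)
  exact absurd (h y (M.basic.l2 X y hy)) (not_lt.2 (lt_succN_iff.1 (hy ▸ hx)))

theorem str_ext {X Y : M.S} (h : ∀ i, M.mem i X ↔ M.mem i Y) : X = Y := by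
  have h1 : M.len X = M.len Y := le_antisymm (len_le_iff.2 fun i hi => lt_len ((h i).1 hi))
    (len_le_iff.2 fun i hi => lt_len ((h i).2 hi))
  exact M.basic.se X Y h1 fun i _ => h i

/-- Comprehension for bounded sets of numbers. -/
theorem IsW11With.exists_str_of_bdd (h : M.IsW11With R I) (e : Fin n → M.N)
    (E : Fin m → M.S) (F : Fin k → M.H) (x : M.N) (A : M.N → Prop)
    [hA : (Ctx.fixed M I e E F).consN.Def (fun p => A p.2)] (hx : ∀ i, A i → i < x) :
    ∃ Y, ∀ i, M.mem i Y ↔ A i := by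
  obtain ⟨Y, h1, h2⟩ := h.exists_str e E F x A
  exact ⟨Y, fun i => ⟨fun hi => (h2 i ((lt_len hi).trans_le h1)).1 hi,
    fun hi => (h2 i (hx i hi)).2 hi⟩⟩

theorem exists_empty (M : Struct) [M.W11] : ∃ O, ∀ i, ¬ M.mem i O := by
  obtain ⟨Y, hY⟩ := M.w11.exists_str_of_bdd ![] ![] ![] 0 (fun i => i < 0) fun _ => id
  exact ⟨Y, fun i hi => N_not_lt_zero _ ((hY i).1 hi)⟩

/-- The empty string. -/
noncomputable def empty (M : Struct) [M.W11] : M.S := (exists_empty M).choose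

theorem not_mem_empty (i : M.N) : ¬ M.mem i M.empty := (exists_empty M).choose_spec i

theorem eq_empty_iff {X : M.S} : X = M.empty ↔ ∀ i, ¬ M.mem i X :=
  ⟨fun h i => h ▸ not_mem_empty i, fun h => str_ext fun i =>
    iff_of_false (h i) (not_mem_empty i)⟩

theorem isEmptyStr_iff {X : M.S} : M.IsEmptyStr X ↔ X = M.empty := by
  rw [eq_empty_iff]
  exact forall_congr' fun i => iff_false_right (N_not_lt_zero i)

theorem len_le_zero_iff {X : M.S} : M.len X ≤ 0 ↔ X = M.empty := by
  rw [eq_empty_iff, len_le_iff]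
  exact forall_congr' fun i => imp_congr_right fun _ => iff_false_intro (N_not_lt_zero i)

theorem len_empty : M.len M.empty = 0 :=
  le_antisymm (len_le_zero_iff.2 rfl) (N_zero_le _)

theorem len_empty_le (x : M.N) : M.len M.empty ≤ x := by rw [len_empty]; exact N_zero_le x

theorem exists_lowest_zero (X : M.S) : ∃ z, ¬ M.mem z X ∧ ∀ j, j < z → M.mem j X := by
  obtain ⟨z, h1, h2⟩ := M.w11.exists_least ![] ![X] ![] (fun i => ¬ M.mem i X)
    (fun h => lt_irrefl _ (lt_len h) : ¬ M.mem (M.len X) X)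
  exact ⟨z, h1, fun j hj => not_not.1 (h2 j hj)⟩

/-- Binary increment in working form: with `z` the lowest zero of `X`, the bits below `z` are
cleared, bit `z` is set, and the bits above are kept. -/
theorem isSucc_iff {X Z : M.S} {z : M.N} (h1 : ¬ M.mem z X) (h2 : ∀ j, j < z → M.mem j X) :
    M.IsSucc X Z ↔ ∀ i, M.mem i Z ↔ (z < i ∧ M.mem i X) ∨ i = z := by
  refine forall_congr' fun i => iff_congr Iff.rfl ?_
  change i ≤ M.len X ∧ ((M.mem i X ∧ ∃ j, j < i ∧ ¬ M.mem j X) ∨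
    (¬ M.mem i X ∧ ∀ j, j < i → M.mem j X)) ↔ _
  constructor
  · rintro ⟨-, ⟨h3, j, h4, h5⟩ | ⟨h3, h4⟩⟩
    · exact .inl ⟨(not_lt.1 fun h => h5 (h2 j h)).trans_lt h4, h3⟩
    · right
      rcases lt_trichotomy i z with h | h | h
      exacts [absurd (h2 i h) h3, h, absurd (h4 z h) h1]
  · rintro (⟨h3, h4⟩ | rfl)
    · exact ⟨(lt_len h4).le, .inl ⟨h4, z, h3, h1⟩⟩
    · exact ⟨not_lt.1 fun h => lt_irrefl _ (lt_len (h2 _ h)), .inr ⟨h1, h2⟩⟩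

theorem exists_succ (X : M.S) : ∃ Z, M.IsSucc X Z := by
  obtain ⟨z, h1, h2⟩ := exists_lowest_zero X
  obtain ⟨Z, hZ⟩ := M.w11.exists_str_of_bdd ![z] ![X] ![] (z + M.succN (M.len X))
    (fun i => (z < i ∧ M.mem i X) ∨ i = z) (by
      rintro i (⟨-, h⟩ | rfl)
      · exact ((lt_len h).trans (lt_succN _)).trans_le (N_le_add_left _ _)
      · rw [N_add_succN]
        exact lt_succN_iff.2 (N_le_add_right _ _))
  exact ⟨Z, (isSucc_iff h1 h2).2 hZ⟩

theorem isSucc_ssucc (X : M.S) : M.IsSucc X (M.ssucc X) :=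
  @Classical.epsilon_spec_aux M.S ⟨X⟩ _ (exists_succ X)

theorem isSucc_iff_eq {X Z : M.S} : M.IsSucc X Z ↔ Z = M.ssucc X := by
  refine ⟨fun h => str_ext fun i => ?_, fun h => h ▸ isSucc_ssucc X⟩
  rw [h i, isSucc_ssucc X i]

theorem mem_ssucc {X : M.S} {z : M.N} (h1 : ¬ M.mem z X) (h2 : ∀ j, j < z → M.mem j X) (i : M.N) :
    M.mem i (M.ssucc X) ↔ (z < i ∧ M.mem i X) ∨ i = z :=
  (isSucc_iff h1 h2).1 (isSucc_ssucc X) i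

theorem len_ssucc_le (X : M.S) : M.len (M.ssucc X) ≤ M.succN (M.len X) :=
  len_le_iff.2 fun i hi => lt_succN_iff.2 ((isSucc_ssucc X i).1 hi).1

theorem len_le_len_ssucc (X : M.S) : M.len X ≤ M.len (M.ssucc X) := by
  obtain ⟨z, h1, h2⟩ := exists_lowest_zero X
  have hz : z < M.len (M.ssucc X) := lt_len ((mem_ssucc h1 h2 z).2 (.inr rfl))
  refine len_le_iff.2 fun i hi => ?_
  rcases lt_or_ge z i with h | h
  · exact lt_len ((mem_ssucc h1 h2 i).2 (.inl ⟨h, hi⟩))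
  · exact h.trans_lt hz

theorem not_slt_empty (X : M.S) : ¬ X < M.empty := fun ⟨_, _, h, _⟩ => not_mem_empty _ h

/-- Discreteness of the numerical order. Everything turns on the lowest zero `z` of `Y`: `Y` and its
successor agree above `z`. -/
theorem slt_ssucc_iff {X Y : M.S} : X < M.ssucc Y ↔ X < Y ∨ X = Y := by
  obtain ⟨z, h1, h2⟩ := exists_lowest_zero Y
  have hS := mem_ssucc h1 h2
  constructor
  · rintro ⟨i, h3, h4, h5⟩
    rcases (hS i).1 h4 with ⟨h6, h7⟩ | rfl
    · refine .inl ⟨i, h3, h7, fun j hj => ?_⟩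
      rw [h5 j hj, hS]
      have := h6.trans hj
      simp [this, this.ne']
    · have h6 (j) (hj : i < j) : M.mem j X ↔ M.mem j Y := by
        rw [h5 j hj, hS]
        simp [hj, hj.ne']
      -- Here `X` agrees with `Y` from bit `i` on, and `Y` has only ones below `i`. Either `X` has
      -- only ones there too and equals `Y`, or its highest zero below `i` shows that `X < Y`.
      by_cases hX : ∃ j, j < i ∧ ¬ M.mem j X
      · obtain ⟨j, hj⟩ := hX
        obtain ⟨l, ⟨hl1, hl2⟩, hl3⟩ := M.w11.exists_greatest ![i] ![X] ![]
          (fun j => j < i ∧ ¬ M.mem j X) hj fun j h => h.1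
        refine .inl ⟨l, hl2, h2 l hl1, fun j hj => ?_⟩
        rcases lt_trichotomy j i with h | rfl | h
        · exact iff_of_true (by_contra fun h' => hl3 j hj ⟨h, h'⟩) (h2 j h)
        · exact iff_of_false h3 h1
        · exact h6 j h
      · push Not at hX
        refine .inr (str_ext fun j => ?_)
        rcases lt_trichotomy j i with h | rfl | h
        · exact iff_of_true (hX j h) (h2 j h)
        · exact iff_of_false h3 h1
        · exact h6 j h
  · rintro (⟨i, h3, h4, h5⟩ | rfl)
    · rcases lt_trichotomy i z with h | rfl | h
      · refine ⟨z, by rwa [h5 z h], (hS z).2 (.inr rfl), fun j hj => ?_⟩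
        rw [h5 j (h.trans hj), hS]
        simp [hj, hj.ne']
      · exact absurd h4 h1
      · refine ⟨i, h3, (hS i).2 (.inl ⟨h, h4⟩), fun j hj => ?_⟩
        rw [h5 j hj, hS]
        simp [h.trans hj, (h.trans hj).ne']
    · refine ⟨z, h1, (hS z).2 (.inr rfl), fun j hj => ?_⟩
      rw [hS]
      simp [hj, hj.ne']

theorem len_le_of_slt {X Y : M.S} (h : X < Y) : M.len X ≤ M.len Y := by
  obtain ⟨i, h1, h2, h3⟩ := h
  refine len_le_iff.2 fun j hj => ?_
  rcases lt_trichotomy i j with h | rfl | h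
  exacts [lt_len ((h3 j h).1 hj), absurd hj h1, h.trans (lt_len h2)]

/-! #### Pairs of strings -/

theorem exists_pair (l : M.N) (X V : M.S) : ∃ D, M.IsPair l X V D := by
  refine M.w11.exists_str_of_bdd ![l] ![X, V] ![] (l + M.len V)
    (fun i => (i < l ∧ M.mem i X) ∨ ∃ j, j ≤ i ∧ i = l + j ∧ M.mem j V) ?_
  rintro i (⟨h, -⟩ | ⟨j, -, rfl, h⟩)
  · exact h.trans_le (N_le_add_right _ _)
  · exact N_add_lt_add _ (lt_len h)

theorem isPair_spair (l : M.N) (X V : M.S) : M.IsPair l X V (M.spair l X V) :=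
  @Classical.epsilon_spec_aux M.S ⟨X⟩ _ (exists_pair l X V)

theorem isPair_iff_eq {l : M.N} {X V D : M.S} : M.IsPair l X V D ↔ D = M.spair l X V := by
  refine ⟨fun h => str_ext fun i => ?_, fun h => h ▸ isPair_spair l X V⟩
  rw [h i, isPair_spair l X V i]

theorem len_spair_le (l : M.N) (X V : M.S) : M.len (M.spair l X V) ≤ l + M.len V := by
  refine len_le_iff.2 fun i hi => ?_
  rcases (isPair_spair l X V i).1 hi with ⟨h, -⟩ | ⟨j, -, rfl, h⟩
  · exact h.trans_le (N_le_add_right _ _)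
  · exact N_add_lt_add _ (lt_len h)

theorem N_add_le_add (x : M.N) {y z : M.N} (h : y ≤ z) : x + y ≤ x + z := by
  rcases h.eq_or_lt with rfl | h
  exacts [le_rfl, (N_add_lt_add x h).le]

theorem len_spair_le_of_le {l b : M.N} {X V : M.S} (h : M.len V ≤ b) :
    M.len (M.spair l X V) ≤ l + b := (len_spair_le l X V).trans (N_add_le_add l h)

theorem mem_spair_low {l i : M.N} (h : i < l) (X V : M.S) :
    M.mem i (M.spair l X V) ↔ M.mem i X := by
  rw [isPair_spair l X V i]
  refine ⟨?_, fun hi => .inl ⟨h, hi⟩⟩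
  rintro (⟨-, hi⟩ | ⟨j, -, rfl, -⟩)
  exacts [hi, absurd h (not_lt.2 (N_le_add_right _ _))]

theorem mem_spair_high (l i : M.N) (X V : M.S) :
    M.mem (l + i) (M.spair l X V) ↔ M.mem i V := by
  rw [isPair_spair l X V]
  refine ⟨?_, fun hi => .inr ⟨i, N_le_add_left _ _, rfl, hi⟩⟩
  rintro (⟨h, -⟩ | ⟨j, -, h, hj⟩)
  exacts [absurd h (not_lt.2 (N_le_add_right _ _)), N_add_left_cancel h ▸ hj]

theorem spair_inj {l : M.N} {X X' V V' : M.S} (hX : M.len X ≤ l) (hX' : M.len X' ≤ l) :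
    M.spair l X V = M.spair l X' V' ↔ X = X' ∧ V = V' := by
  refine ⟨fun h => ⟨str_ext fun i => ?_, str_ext fun i => ?_⟩, by rintro ⟨rfl, rfl⟩; rfl⟩
  · by_cases hi : i < l
    · rw [← mem_spair_low hi X V, h, mem_spair_low hi]
    · exact iff_of_false (fun h => hi ((lt_len h).trans_le hX))
        (fun h => hi ((lt_len h).trans_le hX'))
  · rw [← mem_spair_high l i X V, h, mem_spair_high]

end Struct

/-! ### Definability of the string relations -/

namespace Ctx

variable {R : Sig} {Γ : Type 1} {n m k : ℕ} {C : Ctx R Γ n m k}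

instance def_isEmptyStr (X : (γ : Γ) → (C.M γ).S) [C.IsSVar X] :
    C.Def (fun γ => (C.M γ).IsEmptyStr (X γ)) := by
  have h : C.Def (fun γ => (C.M γ).len (X γ) ≤ 0) := inferInstance
  refine h.congr fun γ => ?_
  have := C.ok γ
  rw [Struct.isEmptyStr_iff, Struct.len_le_zero_iff]

/-- Bit graphs quantify over all positions. Beyond the lengths involved both sides of the
equivalence are false, so the quantifier can be bounded by a term. -/
theorem forall_iff_forall_le {M : Struct} [M.W11] {A : M.N → Prop} (t : M.N)
    (h : ∀ i, t ≤ i → A i) : (∀ i, A i) ↔ ∀ i, i ≤ t → A i :=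
  ⟨fun h i _ => h i, fun h' i => (le_total i t).elim (h' i) (h i)⟩

theorem not_mem_of_le {M : Struct} [M.W11] {x y i : M.N} {X : M.S}
    (h : x + (M.len X + y) ≤ i) : ¬ M.mem i X := fun hi =>
  absurd (((Struct.N_le_add_right _ _).trans (Struct.N_le_add_left _ _)).trans h)
    (not_le.2 (Struct.lt_len hi))

instance def_isSucc (X Z : (γ : Γ) → (C.M γ).S) [C.IsSVar X] [C.IsSVar Z] :
    C.Def (fun γ => (C.M γ).IsSucc (X γ) (Z γ)) := by
  have h : C.Def (fun γ => ∀ i, i ≤ (C.M γ).len (Z γ) + ((C.M γ).len (X γ) + 1) →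
      ((C.M γ).mem i (Z γ) ↔ (C.M γ).le i ((C.M γ).len (X γ)) ∧
      (((C.M γ).mem i (X γ) ∧ ∃ j, (C.M γ).lt j i ∧ ¬ (C.M γ).mem j (X γ)) ∨
        (¬ (C.M γ).mem i (X γ) ∧ ∀ j, (C.M γ).lt j i → (C.M γ).mem j (X γ))))) := inferInstance
  refine h.congr fun γ => ?_
  have := C.ok γ
  refine forall_iff_forall_le _ fun i hi => iff_of_false (fun h => ?_) (fun h => ?_)
  · exact absurd ((Struct.N_le_add_right _ _).trans hi) (not_le.2 (Struct.lt_len h))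
  · have h1 : (C.M γ).succN ((C.M γ).len (X γ)) ≤ i := (Struct.N_le_add_left _ _).trans hi
    exact absurd h.1 (not_le.2 ((Struct.lt_succN _).trans_le h1))

instance def_slt (X Y : (γ : Γ) → (C.M γ).S) [C.IsSVar X] [C.IsSVar Y] :
    C.Def (fun γ => X γ < Y γ) := by
  have h : C.Def (fun γ => ∃ i, i ≤ (C.M γ).len (Y γ) ∧ ¬ (C.M γ).mem i (X γ) ∧
      (C.M γ).mem i (Y γ) ∧ ∀ j, j ≤ (C.M γ).len (X γ) + ((C.M γ).len (Y γ) + 0) →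
        i < j → ((C.M γ).mem j (X γ) ↔ (C.M γ).mem j (Y γ))) := inferInstance
  refine h.congr fun γ => ?_
  have := C.ok γ
  refine exists_congr fun i => ?_
  rw [forall_iff_forall_le ((C.M γ).len (X γ) + ((C.M γ).len (Y γ) + 0))]
  · exact ⟨fun h => ⟨(Struct.lt_len h.2.1).le, h⟩, fun h => h.2⟩
  · intro j hj _
    exact iff_of_false
      (fun h => absurd ((Struct.N_le_add_right _ _).trans hj) (not_le.2 (Struct.lt_len h)))
      (not_mem_of_le hj)

instance def_isPair (l : (γ : Γ) → (C.M γ).N) (X V D : (γ : Γ) → (C.M γ).S) [C.IsTm l]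
    [C.IsSVar X] [C.IsSVar V] [C.IsSVar D] :
    C.Def (fun γ => (C.M γ).IsPair (l γ) (X γ) (V γ) (D γ)) := by
  have h : C.Def (fun γ => ∀ i, i ≤ (C.M γ).len (D γ) + (l γ + (C.M γ).len (V γ)) →
      ((C.M γ).mem i (D γ) ↔ (i < l γ ∧ (C.M γ).mem i (X γ)) ∨
        ∃ j, j ≤ i ∧ i = l γ + j ∧ (C.M γ).mem j (V γ))) := inferInstance
  refine h.congr fun γ => ?_
  have := C.ok γ
  refine forall_iff_forall_le _ fun i hi => iff_of_false (fun h => ?_) ?_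
  · exact absurd ((Struct.N_le_add_right _ _).trans hi) (not_le.2 (Struct.lt_len h))
  · have hi := (Struct.N_le_add_left _ _).trans hi
    rintro (⟨h, -⟩ | ⟨j, -, rfl, h⟩)
    · exact absurd ((Struct.N_le_add_right _ _).trans hi) (not_le.2 h)
    · exact absurd hi (not_le.2 (Struct.N_add_lt_add _ (Struct.lt_len h)))

/-- Pairing is not a function of the vocabulary. The pair is eliminated by a bounded quantifier over
its code. -/
instance def_hmem_spair (l : (γ : Γ) → (C.M γ).N) (X V : (γ : Γ) → (C.M γ).S)
    (Z : (γ : Γ) → (C.M γ).H) [C.IsTm l] [C.IsSVar X] [C.IsSVar V] [C.IsHVar Z] :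
    C.Def (fun γ => (C.M γ).hmem ((C.M γ).spair (l γ) (X γ) (V γ)) (Z γ)) := by
  have h : C.Def (fun γ => ∃ D, (C.M γ).len D ≤ l γ + (C.M γ).len (V γ) ∧
      (C.M γ).IsPair (l γ) (X γ) (V γ) D ∧ (C.M γ).hmem D (Z γ)) := inferInstance
  refine h.congr fun γ => ?_
  have := C.ok γ
  simp only [Struct.isPair_iff_eq]
  exact ⟨fun h => ⟨_, Struct.len_spair_le _ _ _, rfl, h⟩, by rintro ⟨_, -, rfl, h⟩; exact h⟩

instance def_eq_ssucc (X Z : (γ : Γ) → (C.M γ).S) [C.IsSVar X] [C.IsSVar Z] :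
    C.Def (fun γ => Z γ = (C.M γ).ssucc (X γ)) :=
  (def_isSucc X Z).congr fun γ => by have := C.ok γ; rw [Struct.isSucc_iff_eq]

instance def_xor (P Q : Γ → Prop) [C.Def P] [C.Def Q] : C.Def (fun γ => Xor (P γ) (Q γ)) :=
  (def_or (fun γ => P γ ∧ ¬ Q γ) (fun γ => Q γ ∧ ¬ P γ)).congr fun _ => Iff.rfl

instance def_carry (i : (γ : Γ) → (C.M γ).N) (X Y : (γ : Γ) → (C.M γ).S) [C.IsTm i]
    [C.IsSVar X] [C.IsSVar Y] : C.Def (fun γ => (C.M γ).Carry (i γ) (X γ) (Y γ)) := by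
  unfold Struct.Carry
  infer_instance

instance def_isAdd (X Y Z : (γ : Γ) → (C.M γ).S) [C.IsSVar X] [C.IsSVar Y] [C.IsSVar Z] :
    C.Def (fun γ => (C.M γ).IsAdd (X γ) (Y γ) (Z γ)) := by
  have h : C.Def (fun γ => ∀ i, i ≤ (C.M γ).len (Z γ) +
      ((C.M γ).len (X γ) + (C.M γ).len (Y γ)) → ((C.M γ).mem i (Z γ) ↔
        (C.M γ).lt i ((C.M γ).add ((C.M γ).len (X γ)) ((C.M γ).len (Y γ))) ∧
        Xor (Xor ((C.M γ).mem i (X γ)) ((C.M γ).mem i (Y γ))) ((C.M γ).Carry i (X γ) (Y γ)))) :=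
    inferInstance
  refine h.congr fun γ => ?_
  have := C.ok γ
  refine forall_iff_forall_le _ fun i hi => iff_of_false (fun h => ?_) fun h => ?_
  · exact absurd ((Struct.N_le_add_right _ _).trans hi) (not_le.2 (Struct.lt_len h))
  · exact absurd ((Struct.N_le_add_left _ _).trans hi) (not_le.2 h.1)

end Ctx
end BoundedArith

/-! ### Cubes and induction on strings -/

namespace BoundedArith
namespace Struct

/-- `X` agrees with `s` on the bits from `j` to `l`. -/
def Cube (M : Struct) (l j : M.N) (s X : M.S) : Prop :=
  ∀ i, i < l → j ≤ i → (M.mem i X ↔ M.mem i s)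

end Struct

instance Ctx.def_cube {R : Sig} {Γ : Type 1} {n m k : ℕ} {C : Ctx R Γ n m k}
    (l j : (γ : Γ) → (C.M γ).N) (s X : (γ : Γ) → (C.M γ).S) [C.IsTm l] [C.IsTm j] [C.IsSVar s]
    [C.IsSVar X] : C.Def (fun γ => (C.M γ).Cube (l γ) (j γ) (s γ) (X γ)) := by
  unfold Struct.Cube
  infer_instance

namespace Struct

variable {M : Struct} [hM : M.W11]

theorem Cube.mem_iff {l j i : M.N} {s X : M.S} (h : M.Cube l j s X) (hs : M.len s ≤ l)
    (hX : M.len X ≤ l) (hi : j ≤ i) : M.mem i X ↔ M.mem i s := by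
  by_cases hl : i < l
  · exact h i hl hi
  · exact iff_of_false (fun h' => hl ((lt_len h').trans_le hX))
      (fun h' => hl ((lt_len h').trans_le hs))

theorem Cube.of_succN {l j : M.N} {s X : M.S} (h : M.Cube l (M.succN j) s X)
    (hj : M.mem j X ↔ M.mem j s) : M.Cube l j s X := by
  intro i hi hji
  rcases hji.eq_or_lt with rfl | hji
  exacts [hj, h i hi (succN_le_iff.2 hji)]

theorem Cube.eq_of_zero {l : M.N} {s X : M.S} (h : M.Cube l 0 s X) (hs : M.len s ≤ l)
    (hX : M.len X ≤ l) : X = s := str_ext fun i => h.mem_iff hs hX (N_zero_le i)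

/-- The last element of a cube of dimension `j`, and its successor. -/
theorem exists_cube_last {l j : M.N} {s : M.S} (hj : j < l) (hs : M.len s ≤ l)
    (h : ∀ i, i < M.succN j → ¬ M.mem i s) :
    ∃ L, M.len L ≤ l ∧ M.len (M.ssucc L) ≤ l ∧ (∀ i, M.mem i L ↔ i < j ∨ M.mem i s) ∧
      ∀ i, M.mem i (M.ssucc L) ↔ i = j ∨ M.mem i s := by
  obtain ⟨L, hL⟩ := M.w11.exists_str_of_bdd ![j] ![s] ![] (j + M.len s)
    (fun i => i < j ∨ M.mem i s) (by
      rintro i (h | h)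
      exacts [h.trans_le (N_le_add_right _ _), (lt_len h).trans_le (N_le_add_left _ _)])
  have h1 : ¬ M.mem j L := by
    rw [hL]
    exact not_or.2 ⟨lt_irrefl _, h j (lt_succN j)⟩
  have hS (i) : M.mem i (M.ssucc L) ↔ i = j ∨ M.mem i s := by
    rw [mem_ssucc h1 fun i hi => (hL i).2 (.inl hi), hL, or_comm]
    refine or_congr_right ⟨?_, fun hi => ⟨?_, .inr hi⟩⟩
    · rintro ⟨h2, h3 | h3⟩
      exacts [absurd h2 h3.not_gt, h3]
    · by_contra h2
      exact h i (lt_succN_iff.2 (not_lt.1 h2)) hi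
  refine ⟨L, len_le_iff.2 fun i hi => ?_, len_le_iff.2 fun i hi => ?_, hL, hS⟩
  · rcases (hL i).1 hi with h | h
    exacts [h.trans hj, (lt_len h).trans_le hs]
  · rcases (hS i).1 hi with rfl | h
    exacts [hj, (lt_len h).trans_le hs]

variable {R : Sig} {I : Interp R M} {n m k : ℕ}

/-- Induction on strings of bounded length. -/
theorem IsW11With.string_induction (h : M.IsW11With R I) (e : Fin n → M.N)
    (E : Fin m → M.S) (F : Fin k → M.H) (l : M.N) [Ctx.Param l e] (A : M.S → Prop)
    [hA : (Ctx.fixed M I e E F).consS.Def (fun p => A p.2)] (h0 : A M.empty)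
    (hs : ∀ X, M.len (M.ssucc X) ≤ l → A X → A (M.ssucc X)) (X : M.S) (hX : M.len X ≤ l) :
    A X := by
  have hA' {Γ : Type 1} {n' m' k' : ℕ} {C : Ctx R Γ n' m' k'} [hC : C.Over M I e E F]
    (X : Γ → M.S) [C.IsSVar X] : C.Def (fun γ => A (X γ)) := hC.def_consS hA X
  -- Induction on the dimension `j`: if `A` holds at the least element `s` of a cube, then it holds
  -- on the whole cube. For `j = l` and `s` empty the cube consists of all strings of length at most
  -- `l`.
  refine h.num_induction e E F (fun j => ∀ s, M.len s ≤ l → ∀ X, M.len X ≤ l →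
    (∀ i, i < j → ¬ M.mem i s) ∧ M.Cube l j s X → A s → A X) ?_ ?_ l M.empty (len_empty_le _) X hX
    ⟨fun i _ => not_mem_empty i, fun i hi hi' => absurd hi' hi.not_ge⟩ h0
  · rintro s hs X hX ⟨-, h1⟩ h2
    rwa [h1.eq_of_zero hs hX]
  · rintro j ih s hsl X hX ⟨h1, h2⟩ h3
    have h4 (i) (hi : i < j) : ¬ M.mem i s := h1 i (hi.trans (lt_succN j))
    by_cases hj : M.mem j X
    -- `X` lies in the upper half. The hypothesis for the lower half reaches its last element `L`,
    -- one successor step leads to the least element of the upper half, and the hypothesis applies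
    -- again.
    · obtain ⟨L, hL1, hL2, hL3, hL4⟩ := exists_cube_last ((lt_len hj).trans_le hX) hsl h1
      have h5 : A L := ih s hsl L hL1 ⟨h4, fun i _ hi => by
        rw [hL3]
        exact or_iff_right hi.not_gt⟩ h3
      refine ih _ hL2 X hX ⟨fun i hi => ?_, fun i hi hji => ?_⟩ (hs L hL2 h5)
      · rw [hL4]
        exact not_or.2 ⟨hi.ne, h4 i hi⟩
      · rw [hL4]
        rcases hji.eq_or_lt with rfl | hji
        · simp [hj]
        · rw [h2 i hi (succN_le_iff.2 hji)]
          exact (or_iff_right hji.ne').symm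
    · exact ih s hsl X hX ⟨h4, h2.of_succN (iff_of_false hj (h1 j (lt_succN j)))⟩ h3

theorem slt_trichotomy (X Y : M.S) : X < Y ∨ X = Y ∨ Y < X := by
  by_cases h : ∃ i, ¬ (M.mem i X ↔ M.mem i Y)
  · obtain ⟨i, hi⟩ := h
    obtain ⟨z, h1, h2⟩ := M.w11.exists_greatest ![] ![X, Y] ![]
      (fun i => ¬ (M.mem i X ↔ M.mem i Y)) (c := M.len X + M.len Y) hi fun i hi => by
        by_contra h
        refine hi (iff_of_false (fun h' => h ?_) (fun h' => h ?_))
        exacts [(lt_len h').trans_le (N_le_add_right _ _),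
          (lt_len h').trans_le (N_le_add_left _ _)]
    have h3 (j) (hj : z < j) := not_not.1 (h2 j hj)
    by_cases hz : M.mem z X
    · exact .inr (.inr ⟨z, by tauto, hz, fun j hj => (h3 j hj).symm⟩)
    · exact .inl ⟨z, hz, by tauto, h3⟩
  · push Not at h
    exact .inr (.inl (str_ext h))

theorem slt_trans {X Y Z : M.S} (h1 : X < Y) (h2 : Y < Z) : X < Z := by
  obtain ⟨i, hi1, hi2, hi3⟩ := h1
  obtain ⟨j, hj1, hj2, hj3⟩ := h2
  rcases lt_trichotomy i j with h | rfl | h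
  · exact ⟨j, by rwa [hi3 j h], hj2, fun k hk => (hi3 k (h.trans hk)).trans (hj3 k hk)⟩
  · exact absurd hi2 hj1
  · exact ⟨i, hi1, (hj3 i h).1 hi2, fun k hk => (hi3 k hk).trans (hj3 k (h.trans hk))⟩

theorem slt_ssucc (X : M.S) : X < M.ssucc X := slt_ssucc_iff.2 (.inr rfl)

/-- The string successor is strictly monotone. -/
theorem ssucc_slt_ssucc {X Y : M.S} (h : X < Y) : M.ssucc X < M.ssucc Y := by
  rcases slt_trichotomy (M.ssucc X) (M.ssucc Y) with h1 | h1 | h1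
  · exact h1
  · rcases slt_ssucc_iff.1 (h1 ▸ slt_ssucc Y) with h2 | rfl
    exacts [absurd (slt_trans h h2) (slt_irrefl _), absurd h (slt_irrefl _)]
  · rcases slt_ssucc_iff.1 (slt_trans (slt_ssucc Y) h1) with h2 | rfl
    exacts [absurd (slt_trans h h2) (slt_irrefl _), absurd h (slt_irrefl _)]

end Struct
end BoundedArith

/-! ### Runs on cubes and bounded recursion on strings -/

namespace BoundedArith
namespace Struct

/-- `Z` codes, by pairs `(X, V)`, a function with values of length at most `b` on the cube of
dimension `j` at `s`, with the value `Y` at `s` and with step relation `G`. -/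
def RunOn (M : Struct) (l b j : M.N) (s Y : M.S) (G : M.S → M.S → M.S → Prop) (Z : M.H) : Prop :=
  (∀ X, M.len X ≤ l → M.Cube l j s X → ∃ V, M.len V ≤ b ∧
    ∀ V', M.len V' ≤ b → (M.hmem (M.spair l X V') Z ↔ V' = V)) ∧
  M.hmem (M.spair l s Y) Z ∧
  ∀ X, M.len X ≤ l → ∀ X', M.len X' ≤ l → M.Cube l j s X ∧ M.Cube l j s X' ∧ X' = M.ssucc X →
    ∀ V, M.len V ≤ b → M.hmem (M.spair l X V) Z →
      ∀ V', M.len V' ≤ b → (M.hmem (M.spair l X' V') Z ↔ G X V V')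

end Struct

set_option synthInstance.maxSize 4096 in
instance Ctx.def_runOn {R : Sig} {Γ : Type 1} {n m k : ℕ} {C : Ctx R Γ n m k}
    (l b j : (γ : Γ) → (C.M γ).N) (s Y : (γ : Γ) → (C.M γ).S)
    (G : (γ : Γ) → (C.M γ).S → (C.M γ).S → (C.M γ).S → Prop) (Z : (γ : Γ) → (C.M γ).H)
    [C.IsTm l] [C.IsTm b] [C.IsTm j] [C.IsSVar s] [C.IsSVar Y] [C.IsHVar Z]
    [C.consS.consS.consS.consS.Def (fun p => G p.1.1.1.1 p.1.1.1.2 p.1.2 p.2)] :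
    C.Def (fun γ => (C.M γ).RunOn (l γ) (b γ) (j γ) (s γ) (Y γ) (G γ) (Z γ)) := by
  unfold Struct.RunOn
  infer_instance

namespace Struct

variable {M : Struct} [hM : M.W11] {R : Sig} {I : Interp R M} {n m k : ℕ}

theorem cube_top {l : M.N} (s X : M.S) : M.Cube l l s X := fun _ h h' => absurd h' h.not_ge

/-- A cube of dimension `0` is the single string `s`, so the pair of `s` and `Y` is the whole run
and there is no step to verify. -/
theorem exists_runOn_zero {l b : M.N} {s Y : M.S} (G : M.S → M.S → M.S → Prop) (hs : M.len s ≤ l)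
    (hY : M.len Y ≤ b) : ∃ Z, M.RunOn l b 0 s Y G Z := by
  obtain ⟨Z, hZ⟩ := M.w11.exists_hyp ![l] ![s, Y] ![] (l + b) (fun D => M.IsPair l s Y D)
  have hZ' (V) (hV : M.len V ≤ b) : M.hmem (M.spair l s V) Z ↔ V = Y := by
    rw [hZ _ (len_spair_le_of_le hV), isPair_iff_eq, spair_inj hs hs]
    exact and_iff_right rfl
  refine ⟨Z, fun X hX h => ⟨Y, hY, ?_⟩, (hZ' Y hY).2 rfl, ?_⟩
  · rw [h.eq_of_zero hs hX]
    exact hZ'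
  · rintro X hX _ hX' ⟨h1, h2, rfl⟩
    have := slt_ssucc X
    rw [h2.eq_of_zero hs hX', h1.eq_of_zero hs hX] at this
    exact absurd this (slt_irrefl s)

/-- Doubling: bit `j` divides the cube into two cubes of dimension `j`. The run on the upper half
starts with the value that `f` gives at the last element `L` of the lower half, and comprehension
glues the two runs. -/
theorem exists_runOn_succN {l b j : M.N} {s Y : M.S} {f : M.S → M.S → M.S} (hj : j < l)
    (hs : M.len s ≤ l) (hY : M.len Y ≤ b) (h : ∀ i, i < M.succN j → ¬ M.mem i s)
    (hf : ∀ X V, M.len V ≤ b → M.len (f X V) ≤ b)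
    (ih : ∀ s, M.len s ≤ l → ∀ Y, M.len Y ≤ b → (∀ i, i < j → ¬ M.mem i s) →
      ∃ Z, M.RunOn l b j s Y (fun X V V' => V' = f X V) Z) :
    ∃ Z, M.RunOn l b (M.succN j) s Y (fun X V V' => V' = f X V) Z := by
  have h1 (i) (hi : i < j) : ¬ M.mem i s := h i (hi.trans (lt_succN j))
  have hjs : ¬ M.mem j s := h j (lt_succN j)
  obtain ⟨Z1, hZ1⟩ := ih s hs Y hY h1
  obtain ⟨L, hL1, hL2, hL3, hL4⟩ := exists_cube_last hj hs h
  have hL : M.Cube l j s L := fun i _ hi => by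
    rw [hL3]
    exact or_iff_right hi.not_gt
  obtain ⟨V1, hV1, hV1'⟩ := hZ1.1 L hL1 hL
  have h2 (i) (hi : i < j) : ¬ M.mem i (M.ssucc L) := by
    rw [hL4]
    exact not_or.2 ⟨hi.ne, h1 i hi⟩
  obtain ⟨Z2, hZ2⟩ := ih (M.ssucc L) hL2 (f L V1) (hf _ _ hV1) h2
  -- As `j < l`, the code of a pair has the same bit `j` as its first component, so the case
  -- distinction can be made on the code.
  obtain ⟨Z, hZ⟩ := M.w11.exists_hyp ![j] ![] ![Z1, Z2] (l + b)
    (fun C => (M.mem j C ∧ M.hmem C Z2) ∨ (¬ M.mem j C ∧ M.hmem C Z1))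
  have hZ' (X V) (hV : M.len V ≤ b) : M.hmem (M.spair l X V) Z ↔
      (M.mem j X ∧ M.hmem (M.spair l X V) Z2) ∨ (¬ M.mem j X ∧ M.hmem (M.spair l X V) Z1) := by
    rw [hZ _ (len_spair_le_of_le hV), mem_spair_low hj]
  have hlow {X} (hX : M.Cube l (M.succN j) s X) (hj : ¬ M.mem j X) : M.Cube l j s X :=
    hX.of_succN (iff_of_false hj hjs)
  have hhigh {X} (hX : M.Cube l (M.succN j) s X) (hj : M.mem j X) : M.Cube l j (M.ssucc L) X :=
    Cube.of_succN (fun i hi hji => by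
      rw [hL4, hX i hi hji]
      exact (or_iff_right (succN_le_iff.1 hji).ne').symm) (iff_of_true hj ((hL4 j).2 (.inl rfl)))
  refine ⟨Z, fun X hX hc => ?_, (hZ' s Y hY).2 (.inr ⟨hjs, hZ1.2.1⟩), ?_⟩
  · by_cases hjX : M.mem j X
    · obtain ⟨V, hV, hV'⟩ := hZ2.1 X hX (hhigh hc hjX)
      exact ⟨V, hV, fun V' h => by simp [hZ' X V' h, hjX, hV' V' h]⟩
    · obtain ⟨V, hV, hV'⟩ := hZ1.1 X hX (hlow hc hjX)
      exact ⟨V, hV, fun V' h => by simp [hZ' X V' h, hjX, hV' V' h]⟩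
  · rintro X hX _ hX' ⟨hc, hc', rfl⟩ V hV hXV V' hV'
    rw [hZ' _ V' hV']
    rw [hZ' X V hV] at hXV
    obtain ⟨z, hz1, hz2⟩ := exists_lowest_zero X
    have hS := mem_ssucc hz1 hz2
    -- The increment flips bit `z`, whereas the elements of the cube agree on all bits above `j`.
    have hzj : z ≤ j := by
      by_contra! hjz
      have := succN_le_iff.2 hjz
      exact hz1 ((hc.mem_iff hs hX this).2 ((hc'.mem_iff hs hX' this).1 ((hS z).2 (.inr rfl))))
    -- If the lowest zero is `j`, then `X` is `L` and the step crosses from the lower to the upper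
    -- half; otherwise `X` and its successor lie in the same half.
    rcases hzj.eq_or_lt with rfl | hzj
    · have hXL : X = L := by
        refine str_ext fun i => ?_
        rw [hL3]
        rcases lt_trichotomy i z with hi | rfl | hi
        · exact iff_of_true (hz2 i hi) (.inl hi)
        · exact iff_of_false hz1 (not_or.2 ⟨lt_irrefl _, hjs⟩)
        · rw [hc.mem_iff hs hX (succN_le_iff.2 hi)]
          exact (or_iff_right hi.not_gt).symm
      subst hXL
      have hm : M.mem z (M.ssucc X) := (hS z).2 (.inr rfl)
      simp only [hz1, false_and, not_false_eq_true, true_and, false_or] at hXV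
      simp only [hm, true_and, not_true_eq_false, false_and, or_false]
      obtain rfl := (hV1' V hV).1 hXV
      obtain ⟨W, hW, hW'⟩ := hZ2.1 _ hX' (fun _ _ _ => Iff.rfl)
      rw [(hW' _ (hf X V hV)).1 hZ2.2.1]
      exact hW' V' hV'
    · have hm : M.mem j (M.ssucc X) ↔ M.mem j X := by
        rw [hS]
        simp [hzj, hzj.ne']
      rw [hm]
      by_cases hjX : M.mem j X
      · simp only [hjX, true_and, not_true_eq_false, false_and, or_false] at hXV ⊢
        exact hZ2.2.2 X hX _ hX' ⟨hhigh hc hjX, hhigh hc' (hm.2 hjX), rfl⟩ V hV hXV V' hV'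
      · simp only [hjX, false_and, not_false_eq_true, true_and, false_or] at hXV ⊢
        exact hZ1.2.2 X hX _ hX' ⟨hlow hc hjX, hlow hc' (mt hm.1 hjX), rfl⟩ V hV hXV V' hV'

-- Number induction on the dimension. Quantifying over all base points `s` and all starts `Y` lets
-- the hypothesis be used twice; this is where induction for `∀²𝚺^B_1` formulas is needed.
set_option synthInstance.maxSize 4096 in
theorem IsW11With.exists_runOn (h : M.IsW11With R I) (e : Fin n → M.N) (E : Fin m → M.S)
    (F : Fin k → M.H) (l b : M.N) [Ctx.Param l e] [Ctx.Param b e] (f : M.S → M.S → M.S)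
    [hG : (Ctx.fixed M I e E F).consS.consS.consS.Def (fun p => p.2 = f p.1.1.2 p.1.2)]
    (hf : ∀ X V, M.len V ≤ b → M.len (f X V) ≤ b) {Y : M.S} (hY : M.len Y ≤ b) :
    ∃ Z, M.RunOn l b l M.empty Y (fun X V V' => V' = f X V) Z := by
  have hG' {Γ : Type 1} {n' m' k' : ℕ} {C : Ctx R Γ n' m' k'} [hC : C.Over M I e E F]
    (X V V' : Γ → M.S) [C.IsSVar X] [C.IsSVar V] [C.IsSVar V'] :
    C.Def (fun γ => V' γ = f (X γ) (V γ)) :=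
    hC.def_consS_consS_consS (G := fun X V V' => V' = f X V) hG X V V'
  -- Some hyper string, to serve as a default value when the conditions on `j` and `s` fail.
  have := M.w11.exists_hyp ![] ![] ![] 0 (fun X => X = X)
  -- The conditions on `j` and `s` are placed inside `∃ Z`, so that the induction formula has the
  -- prescribed prefix.
  refine Exists.imp (fun Z hZ => hZ ⟨le_rfl, fun i _ => not_mem_empty i⟩)
    (h.num_induction e E F (fun j => ∀ s, M.len s ≤ l → ∀ Y, M.len Y ≤ b → ∃ Z,
      j ≤ l ∧ (∀ i, i < j → ¬ M.mem i s) → M.RunOn l b j s Y (fun X V V' => V' = f X V) Z)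
      ?_ ?_ l M.empty (len_empty_le _) Y hY)
  · intro s hs Y hY
    obtain ⟨Z, hZ⟩ := exists_runOn_zero (fun X V V' => V' = f X V) hs hY
    exact ⟨Z, fun _ => hZ⟩
  · intro j ih s hs Y hY
    by_cases hj : M.succN j ≤ l ∧ ∀ i, i < M.succN j → ¬ M.mem i s
    · have hjl := succN_le_iff.1 hj.1
      obtain ⟨Z, hZ⟩ := exists_runOn_succN hjl hs hY hj.2 hf fun s hs Y hY h =>
        (ih s hs Y hY).imp fun Z hZ => hZ ⟨hjl.le, h⟩
      exact ⟨Z, fun _ => hZ⟩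
    · exact ⟨this.choose, fun h => absurd h hj⟩

/-- The hyper string `Z` codes the graph of `g` on arguments of length at most `l`. -/
def Codes (l b : M.N) (g : M.S → M.S) (Z : M.H) : Prop :=
  ∀ X, M.len X ≤ l → ∀ V, M.len V ≤ b → (M.hmem (M.spair l X V) Z ↔ V = g X)

/-- Uniqueness of runs, by string induction: the starts agree and both runs take the same step.
Allowing different `l` and `l'` is what makes values read off from runs of different lengths fit
together. -/
theorem RunOn.hmem_iff {l b : M.N} {Y : M.S} {f : M.S → M.S → M.S} {Z : M.H}
    (h : M.RunOn l b l M.empty Y (fun X V V' => V' = f X V) Z)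
    {l' : M.N} {Z' : M.H} (h' : M.RunOn l' b l' M.empty Y (fun X V V' => V' = f X V) Z')
    (hY : M.len Y ≤ b)
    {X V : M.S} (hX : M.len X ≤ l) (hX' : M.len X ≤ l') (hV : M.len V ≤ b) :
    M.hmem (M.spair l X V) Z ↔ M.hmem (M.spair l' X V) Z' := by
  refine M.w11.string_induction ![M.len X, l, l', b] ![] ![Z, Z'] (M.len X)
    (fun X => ∀ V, M.len V ≤ b → (M.hmem (M.spair l X V) Z ↔ M.hmem (M.spair l' X V) Z'))
    ?_ ?_ X le_rfl V hV
  · intro V hV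
    obtain ⟨W, hW, hW'⟩ := h.1 M.empty (len_empty_le _) (cube_top _ _)
    obtain ⟨U, hU, hU'⟩ := h'.1 M.empty (len_empty_le _) (cube_top _ _)
    rw [hW' V hV, hU' V hV, ← (hW' Y hY).1 h.2.1, ← (hU' Y hY).1 h'.2.1]
  · intro T hT ih V hV
    have hT' := (len_le_len_ssucc T).trans hT
    obtain ⟨W, hW, hW'⟩ := h.1 T (hT'.trans hX) (cube_top _ _)
    rw [h.2.2 T (hT'.trans hX) _ (hT.trans hX) ⟨cube_top _ _, cube_top _ _, rfl⟩ W hW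
        ((hW' W hW).2 rfl) V hV,
      h'.2.2 T (hT'.trans hX') _ (hT.trans hX') ⟨cube_top _ _, cube_top _ _, rfl⟩ W hW
        ((ih W hW).1 ((hW' W hW).2 rfl)) V hV]

theorem Codes.runOn {l b : M.N} {g : M.S → M.S} {Y : M.S} {f : M.S → M.S → M.S} {Z : M.H}
    (h : Codes l b g Z) (hg : ∀ X, M.len (g X) ≤ b) (h0 : g M.empty = Y)
    (hs : ∀ X, g (M.ssucc X) = f X (g X)) :
    M.RunOn l b l M.empty Y (fun X V V' => V' = f X V) Z := by
  refine ⟨fun X hX _ => ⟨g X, hg X, h X hX⟩, (h _ (len_empty_le _) _ (h0 ▸ hg _)).2 h0.symm, ?_⟩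
  rintro X hX _ hX' ⟨-, -, rfl⟩ V hV hXV V' hV'
  rw [h _ hX' V' hV', hs, (h X hX V hV).1 hXV]

theorem RunOn.codes {l b : M.N} {g : M.S → M.S} {Y : M.S} {f : M.S → M.S → M.S} {Z Z' : M.H}
    (h : M.RunOn l b l M.empty Y (fun X V V' => V' = f X V) Z) (h' : Codes l b g Z')
    (hg : ∀ X, M.len (g X) ≤ b) (h0 : g M.empty = Y) (hs : ∀ X, g (M.ssucc X) = f X (g X)) :
    Codes l b g Z := fun X hX V hV => by
  rw [h.hmem_iff (h'.runOn hg h0 hs) (h0 ▸ hg _) hX hX hV, h' X hX V hV]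

/-- Functions on strings defined by bounded recursion. -/
theorem IsW11With.exists_rec (h : M.IsW11With R I) (e : Fin n → M.N) (E : Fin m → M.S)
    (F : Fin k → M.H) (b : M.N) [Ctx.Param b e] (f : M.S → M.S → M.S)
    (hG : ∀ l, (Ctx.fixed M I (Matrix.vecCons l e) E F).consS.consS.consS.Def
      (fun p => p.2 = f p.1.1.2 p.1.2))
    (hf : ∀ X V, M.len V ≤ b → M.len (f X V) ≤ b) {Y : M.S} (hY : M.len Y ≤ b) :
    ∃ g : M.S → M.S, g M.empty = Y ∧ (∀ X, g (M.ssucc X) = f X (g X)) ∧ (∀ X, M.len (g X) ≤ b) ∧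
      ∀ l, ∃ Z, Codes l b g Z := by
  -- `g X` is read off from the run on strings of length at most that of `X`. By uniqueness of runs
  -- every longer run has the same value at `X`. Thus `g` is a function outside the model, coded in
  -- it on each bounded set of arguments.
  choose Z hZ using fun l =>
    h.exists_runOn (Matrix.vecCons l e) E F l b f (hG := hG l) hf hY
  choose g hg hg' using fun X => (hZ (M.len X)).1 X le_rfl (cube_top _ _)
  have hc (l) : Codes l b g (Z l) := fun X hX V hV => by
    rw [(hZ l).hmem_iff (hZ (M.len X)) hY hX le_rfl hV, hg' X V hV]
  refine ⟨g, ?_, fun X => ?_, hg, fun l => ⟨Z l, hc l⟩⟩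
  · exact ((hc 0 _ len_empty.le Y hY).1 (hZ 0).2.1).symm
  · have hX := len_le_len_ssucc X
    have := (hZ (M.len (M.ssucc X))).2.2 X hX _ le_rfl ⟨cube_top _ _, cube_top _ _, rfl⟩ (g X) (hg X)
      ((hc _ X hX _ (hg X)).2 rfl) (f X (g X)) (hf _ _ (hg X))
    exact ((hc _ _ le_rfl _ (hf _ _ (hg X))).1 (this.2 rfl)).symm

end Struct
end BoundedArith

/-! ### Further definable predicates; predecessors of strings -/

namespace BoundedArith
namespace Ctx

variable {R : Sig} {Γ : Type 1} {n m k : ℕ} {C : Ctx R Γ n m k}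

instance def_hmem_spair_spair (l l' : (γ : Γ) → (C.M γ).N) (X Y V : (γ : Γ) → (C.M γ).S)
    (Z : (γ : Γ) → (C.M γ).H) [C.IsTm l] [C.IsTm l'] [C.IsSVar X] [C.IsSVar Y] [C.IsSVar V]
    [C.IsHVar Z] : C.Def (fun γ => (C.M γ).hmem
      ((C.M γ).spair (l γ) ((C.M γ).spair (l' γ) (X γ) (Y γ)) (V γ)) (Z γ)) := by
  have h : C.Def (fun γ => ∃ D, (C.M γ).len D ≤ l' γ + (C.M γ).len (Y γ) ∧
      (C.M γ).IsPair (l' γ) (X γ) (Y γ) D ∧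
        (C.M γ).hmem ((C.M γ).spair (l γ) D (V γ)) (Z γ)) := inferInstance
  refine h.congr fun γ => ?_
  have := C.ok γ
  simp only [Struct.isPair_iff_eq]
  exact ⟨fun h => ⟨_, Struct.len_spair_le _ _ _, rfl, h⟩, by rintro ⟨_, -, rfl, h⟩; exact h⟩

instance def_len_ssucc_le (X : (γ : Γ) → (C.M γ).S) (t : (γ : Γ) → (C.M γ).N) [C.IsSVar X]
    [C.IsTm t] : C.Def (fun γ => (C.M γ).len ((C.M γ).ssucc (X γ)) ≤ t γ) := by
  have h : C.Def (fun γ => ∃ X', (C.M γ).len X' ≤ t γ ∧ X' = (C.M γ).ssucc (X γ)) :=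
    inferInstance
  exact h.congr fun γ => ⟨fun h => ⟨_, h, rfl⟩, by rintro ⟨_, h, rfl⟩; exact h⟩

open Classical in
instance def_eq_ite (P : Γ → Prop) (X Y Z : (γ : Γ) → (C.M γ).S) [C.Def P]
    [C.Def (fun γ => Z γ = X γ)] [C.Def (fun γ => Z γ = Y γ)] :
    C.Def (fun γ => Z γ = if P γ then X γ else Y γ) :=
  (def_or (fun γ => P γ ∧ Z γ = X γ) (fun γ => ¬ P γ ∧ Z γ = Y γ)).congr fun γ => by
    by_cases h : P γ <;> simp [h]

end Ctx

namespace Struct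

variable {M : Struct} [hM : M.W11] {R : Sig} {I : Interp R M} {n m k : ℕ}

/-- String induction for a predicate that is definable on strings of bounded length. -/
theorem IsW11With.string_induction_of_iff (h : M.IsW11With R I) (e : Fin n → M.N)
    (E : Fin m → M.S) (F : Fin k → M.H) (l : M.N) [Ctx.Param l e] {A : M.S → Prop}
    (B : M.S → Prop) [hB : (Ctx.fixed M I e E F).consS.Def (fun p => B p.2)]
    (hAB : ∀ X, M.len X ≤ l → (A X ↔ B X)) (h0 : A M.empty)
    (hs : ∀ X, M.len (M.ssucc X) ≤ l → A X → A (M.ssucc X)) (X : M.S) (hX : M.len X ≤ l) :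
    A X :=
  (hAB X hX).2 (h.string_induction e E F l B ((hAB _ (len_empty_le l)).1 h0)
    (fun X hX hB => (hAB _ hX).1 (hs X hX ((hAB X ((len_le_len_ssucc X).trans hX)).2 hB))) X hX)

/-- String induction in which the induction hypothesis plays no part. The bound on `Y` keeps the
induction formula bounded. -/
theorem exists_spred {X : M.S} (hX : X ≠ M.empty) : ∃ Y, X = M.ssucc Y := by
  have := M.w11.string_induction ![M.len X] ![] ![] (M.len X)
    (fun X => M.len X ≤ 0 ∨ ∃ Y, M.len Y ≤ M.len X ∧ X = M.ssucc Y) (.inl len_empty.le)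
    (fun Y hY _ => .inr ⟨Y, len_le_len_ssucc Y, rfl⟩) X le_rfl
  rcases this with h | ⟨Y, -, h⟩
  exacts [absurd (len_le_zero_iff.1 h) hX, ⟨Y, h⟩]

/-! ### Recursion with a parameter -/

/-- With `X` in the low bits, a pair is a two-digit number in base `2^l`: incrementing it increments
`X` as long as there is no overflow. -/
theorem ssucc_spair {l : M.N} {X : M.S} (h : M.len (M.ssucc X) ≤ l) (T : M.S) :
    M.ssucc (M.spair l X T) = M.spair l (M.ssucc X) T := by
  obtain ⟨z, h1, h2⟩ := exists_lowest_zero X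
  have hz : z < l := (lt_len ((mem_ssucc h1 h2 z).2 (.inr rfl))).trans_le h
  refine str_ext fun i => ?_
  rw [mem_ssucc (z := z) (by rwa [mem_spair_low hz])
    fun j hj => (mem_spair_low (hj.trans hz) _ _).2 (h2 j hj)]
  rcases lt_or_ge i l with hi | hi
  · rw [mem_spair_low hi, mem_spair_low hi, mem_ssucc h1 h2]
  · obtain ⟨j, -, rfl⟩ := exists_add_of_le hi
    rw [mem_spair_high, mem_spair_high]
    simp [hz.trans_le hi, (hz.trans_le hi).ne']

/-- Overflow happens only when `X` has ones at all positions below `l`. The low digit is then reset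
and the carry goes to `T`. -/
theorem ssucc_spair_of_not_le {l : M.N} {X : M.S} (hX : M.len X ≤ l)
    (h : ¬ M.len (M.ssucc X) ≤ l) (T : M.S) :
    M.ssucc (M.spair l X T) = M.spair l M.empty (M.ssucc T) := by
  have hX' (i) (hi : i < l) : M.mem i X := by
    obtain ⟨z, h1, h2⟩ := exists_lowest_zero X
    by_contra hm
    have hz : z < l := (not_lt.1 fun h => hm (h2 i h)).trans_lt hi
    refine h (len_le_iff.2 fun j hj => ?_)
    rcases (mem_ssucc h1 h2 j).1 hj with ⟨-, hj⟩ | rfl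
    exacts [(lt_len hj).trans_le hX, hz]
  obtain ⟨z, h1, h2⟩ := exists_lowest_zero T
  refine str_ext fun i => ?_
  rw [mem_ssucc (z := l + z) (by rwa [mem_spair_high])]
  · rcases lt_or_ge i l with hi | hi
    · have := hi.trans_le (N_le_add_right l z)
      rw [mem_spair_low hi, mem_spair_low hi]
      simp [this.not_gt, this.ne, not_mem_empty]
    · obtain ⟨j, -, rfl⟩ := exists_add_of_le hi
      rw [mem_spair_high, mem_spair_high, mem_ssucc h1 h2, N_add_lt_add_iff]
      exact or_congr_right ⟨N_add_left_cancel, fun h => h ▸ rfl⟩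
  · intro j hj
    rcases lt_or_ge j l with hi | hi
    · exact (mem_spair_low hi _ _).2 (hX' j hi)
    · obtain ⟨j, -, rfl⟩ := exists_add_of_le hi
      exact (mem_spair_high _ _ _ _).2 (h2 j (N_add_lt_add_iff.1 hj))

theorem exists_eq_spair (l : M.N) (C : M.S) :
    ∃ X T, M.len X ≤ l ∧ M.len T ≤ M.len C ∧ C = M.spair l X T := by
  obtain ⟨X, hX, hX'⟩ := M.w11.exists_str ![] ![C] ![] l (fun i => M.mem i C)
  obtain ⟨T, hT, hT'⟩ := M.w11.exists_str ![l] ![C] ![] (M.len C) (fun i => M.mem (l + i) C)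
  refine ⟨X, T, hX, hT, str_ext fun i => ?_⟩
  rcases lt_or_ge i l with hi | hi
  · rw [mem_spair_low hi, hX' i hi]
  · obtain ⟨j, -, rfl⟩ := exists_add_of_le hi
    rw [mem_spair_high]
    refine ⟨fun h => (hT' j ((N_le_add_left _ _).trans_lt (lt_len h))).2 h, fun h => ?_⟩
    exact (hT' j ((lt_len h).trans_le hT)).1 h

theorem spair_empty_empty (l : M.N) : M.spair l M.empty M.empty = M.empty := by
  rw [eq_empty_iff]
  intro i
  rcases lt_or_ge i l with hi | hi
  · rw [mem_spair_low hi]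
    exact not_mem_empty i
  · obtain ⟨j, -, rfl⟩ := exists_add_of_le hi
    rw [mem_spair_high]
    exact not_mem_empty j

theorem exists_max_str (l : M.N) : ∃ X, M.len X ≤ l ∧ ¬ M.len (M.ssucc X) ≤ l := by
  obtain ⟨X, hX⟩ := M.w11.exists_str_of_bdd ![l] ![] ![] l (fun i => i < l) fun _ => id
  refine ⟨X, len_le_iff.2 fun i hi => (hX i).1 hi, fun h => ?_⟩
  have h1 : ¬ M.mem l X := fun h => lt_irrefl _ ((hX l).1 h)
  exact absurd (lt_len ((mem_ssucc h1 (fun j hj => (hX j).2 hj) l).2 (.inr rfl))) h.not_gt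

/-- The step relation, on pairs `(X, T)` in the order of their codes, of the recursion with
parameter `T`, start `st` and step `f`. -/
def PairStep (M : Struct) (l : M.N) (f : M.S → M.S → M.S → M.S → Prop) (st : M.S → M.S → Prop)
    (C V V' : M.S) : Prop :=
  ∃ X, M.len X ≤ l ∧ ∃ T, M.len T ≤ M.len C ∧ M.IsPair l X T C ∧
    ((M.len (M.ssucc X) ≤ l ∧ f T X V V') ∨
      (¬ M.len (M.ssucc X) ≤ l ∧ ∃ T', M.len T' ≤ M.succN (M.len T) ∧ T' = M.ssucc T ∧ st T' V'))

end Struct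

instance Ctx.def_pairStep {R : Sig} {Γ : Type 1} {n m k : ℕ} {C : Ctx R Γ n m k}
    (l : (γ : Γ) → (C.M γ).N)
    (f : (γ : Γ) → (C.M γ).S → (C.M γ).S → (C.M γ).S → (C.M γ).S → Prop)
    (st : (γ : Γ) → (C.M γ).S → (C.M γ).S → Prop) (D V V' : (γ : Γ) → (C.M γ).S)
    [C.IsTm l] [C.IsSVar D] [C.IsSVar V] [C.IsSVar V']
    [C.consS.consS.Def (fun p => f p.1.1 p.2 p.1.2 (V p.1.1) (V' p.1.1))]
    [C.consS.consS.consS.Def (fun p => st p.1.1.1 p.2 (V' p.1.1.1))] :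
    C.Def (fun γ => (C.M γ).PairStep (l γ) (f γ) (st γ) (D γ) (V γ) (V' γ)) := by
  unfold Struct.PairStep
  infer_instance

namespace Struct

variable {M : Struct} [hM : M.W11] {R : Sig} {I : Interp R M} {n m k : ℕ}

/-- One recursion along the codes serves all parameters: without overflow it applies `f`, and at
overflow it forgets its value and starts afresh with the next parameter. -/
theorem exists_pairStep (l b : M.N) (f : M.S → M.S → M.S → M.S) (st : M.S → M.S)
    (hf : ∀ T X V, M.len V ≤ b → M.len (f T X V) ≤ b) (hst : ∀ T, M.len (st T) ≤ b) :
    ∃ g : M.S → M.S → M.S, (∀ C V, M.len V ≤ b → M.len (g C V) ≤ b) ∧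
      (∀ C V V', V' = g C V ↔
        M.PairStep l (fun T X V V' => V' = f T X V) (fun T V => V = st T) C V V') ∧
      (∀ X T V, M.len (M.ssucc X) ≤ l → g (M.spair l X T) V = f T X V) ∧
      ∀ X T V, M.len X ≤ l → ¬ M.len (M.ssucc X) ≤ l → g (M.spair l X T) V = st (M.ssucc T) := by
  classical
  choose X T hX hT hC using exists_eq_spair (M := M) l
  have key (X' T') (h : M.len X' ≤ l) :
      X (M.spair l X' T') = X' ∧ T (M.spair l X' T') = T' := by
    have := hC (M.spair l X' T')
    rw [spair_inj h (hX _)] at this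
    exact ⟨this.1.symm, this.2.symm⟩
  refine ⟨fun C V => if M.len (M.ssucc (X C)) ≤ l then f (T C) (X C) V else st (M.ssucc (T C)),
    ?_, ?_, ?_, ?_⟩
  · intro C V hV
    dsimp only
    split_ifs
    exacts [hf _ _ _ hV, hst _]
  · intro C V V'
    dsimp only
    constructor
    · rintro rfl
      refine ⟨X C, hX C, T C, hT C, isPair_iff_eq.2 (hC C), ?_⟩
      by_cases h : M.len (M.ssucc (X C)) ≤ l
      · exact .inl ⟨h, if_pos h⟩
      · exact .inr ⟨h, _, len_ssucc_le _, rfl, if_neg h⟩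
    · rintro ⟨X', hX', T', -, h, h'⟩
      obtain rfl := isPair_iff_eq.1 h
      rw [(key X' T' hX').1, (key X' T' hX').2]
      rcases h' with ⟨h1, rfl⟩ | ⟨h1, _, -, rfl, rfl⟩
      exacts [(if_pos h1).symm, (if_neg h1).symm]
  · intro X' T' V h
    have := key X' T' ((len_le_len_ssucc X').trans h)
    dsimp only
    rw [this.1, this.2, if_pos h]
  · intro X' T' V hX' h
    have := key X' T' hX'
    dsimp only
    rw [this.1, this.2, if_neg h]

/-- Recursion with a parameter `T`. -/
theorem IsW11With.exists_rec_pair (h : M.IsW11With R I) (e : Fin n → M.N) (E : Fin m → M.S)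
    (F : Fin k → M.H) (l b : M.N) [Ctx.Param b e] (f : M.S → M.S → M.S → M.S) (st : M.S → M.S)
    (hG : ∀ L, (Ctx.fixed M I (Matrix.vecCons L e) E F).consS.consS.consS.Def (fun p =>
      M.PairStep l (fun T X V V' => V' = f T X V) (fun T V => V = st T) p.1.1.2 p.1.2 p.2))
    (hf : ∀ T X V, M.len V ≤ b → M.len (f T X V) ≤ b) (hst : ∀ T, M.len (st T) ≤ b) :
    ∃ (s : M.S → M.S → M.S) (g : M.S → M.S), g M.empty = st M.empty ∧
      (∀ X, g (M.ssucc X) = s X (g X)) ∧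
      (∀ C V V', V' = s C V ↔
        M.PairStep l (fun T X V V' => V' = f T X V) (fun T V => V = st T) C V V') ∧
      (∀ X, M.len (g X) ≤ b) ∧ (∀ L, ∃ Z, Codes L b g Z) ∧
      (∀ T, g (M.spair l M.empty T) = st T) ∧
      ∀ T X, M.len (M.ssucc X) ≤ l →
        g (M.spair l (M.ssucc X) T) = f T X (g (M.spair l X T)) := by
  obtain ⟨s, h1, h2, h3, h4⟩ := exists_pairStep l b f st hf hst
  obtain ⟨g, hg1, hg2, hg3, hg4⟩ := h.exists_rec e E F b s
    (fun L => (hG L).congr fun p => h2 _ _ _) h1 (hst M.empty)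
  refine ⟨s, g, hg1, hg2, h2, hg3, hg4, fun T => ?_, fun T X hX => ?_⟩
  -- For `T` not empty, the code of `(∅, T)` is the successor of the code of the pair formed by the
  -- greatest `X` and the predecessor of `T`. So the value there is the fresh start, whatever came
  -- before.
  · by_cases hT : T = M.empty
    · rw [hT, spair_empty_empty, hg1]
    · obtain ⟨T, rfl⟩ := exists_spred hT
      obtain ⟨X, hX, hX'⟩ := exists_max_str (M := M) l
      rw [← ssucc_spair_of_not_le hX hX', hg2, h4 X T _ hX hX']
  · rw [← ssucc_spair hX, hg2, h3 X T _ hX]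

end Struct
end BoundedArith

namespace BoundedArith
namespace Struct

variable {M : Struct} [hM : M.W11]

/-! ### The pigeonhole principle -/

/-- `w` is one of the values `g s`, `s < t`, of the function `g` coded by `Z`. -/
def Visited (M : Struct) (x l : M.N) (Z : M.H) (t w : M.S) : Prop :=
  M.len w ≤ x ∧ ∃ s, M.len s ≤ l ∧ s < t ∧ M.hmem (M.spair l s w) Z

end Struct

instance Ctx.def_visited {R : Sig} {Γ : Type 1} {n m k : ℕ} {C : Ctx R Γ n m k}
    (x l : (γ : Γ) → (C.M γ).N) (Z : (γ : Γ) → (C.M γ).H) (t w : (γ : Γ) → (C.M γ).S)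
    [C.IsTm x] [C.IsTm l] [C.IsHVar Z] [C.IsSVar t] [C.IsSVar w] :
    C.Def (fun γ => (C.M γ).Visited (x γ) (l γ) (Z γ) (t γ) (w γ)) := by
  unfold Struct.Visited
  infer_instance

namespace Struct

variable {M : Struct} [hM : M.W11]

theorem Codes.visited_iff {x l : M.N} {g : M.S → M.S} {Z : M.H} (h : Codes l x g Z)
    (hg : ∀ s, M.len (g s) ≤ x) {t : M.S} (ht : M.len t ≤ l) (w : M.S) :
    M.Visited x l Z t w ↔ ∃ s, s < t ∧ g s = w := by
  constructor
  · rintro ⟨hw, s, hs, hst, hsw⟩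
    exact ⟨s, hst, ((h s hs w hw).1 hsw).symm⟩
  · rintro ⟨s, hst, rfl⟩
    have hs := (len_le_of_slt hst).trans ht
    exact ⟨hg s, s, hs, hst, (h s hs _ (hg s)).2 rfl⟩

/-- The successor, cut off at length `b`. -/
noncomputable def bump (b : M.N) (c : M.S) : M.S :=
  open Classical in if M.len (M.ssucc c) ≤ b then M.ssucc c else c

set_option synthInstance.maxSize 4096 in
/-- Counting the values of a function `W`: `c t w` is the number of those `v < w` that are of the
form `W s` with `s < t`. -/
theorem exists_count {x l b : M.N} {W : M.S → M.S} (hW : ∀ s, M.len (W s) ≤ x) {Z : M.H}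
    (hZ : Codes l x W Z) : ∃ c : M.S → M.S → M.S,
      (∀ t, c t M.empty = M.empty) ∧ (∀ t w, M.len (c t w) ≤ b) ∧
      (∀ t w, M.len t ≤ l → M.len (M.ssucc w) ≤ l → (∃ s, s < t ∧ W s = w) →
        c t (M.ssucc w) = bump b (c t w)) ∧
      (∀ t w, M.len t ≤ l → M.len (M.ssucc w) ≤ l → (¬ ∃ s, s < t ∧ W s = w) →
        c t (M.ssucc w) = c t w) ∧
      ∃ L Z', ∀ t w, M.len t ≤ l → M.len w ≤ l → ∀ v, M.len v ≤ b →
        (M.hmem (M.spair L (M.spair l w t) v) Z' ↔ v = c t w) := by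
  classical
  -- Recursion on `w` with parameter `t`: the counter goes up when `w` is one of the values. Coding
  -- both arguments is necessary, as counts for different `t` are compared in an induction formula.
  obtain ⟨-, g, -, -, -, h2, h3, h4, h5⟩ := M.w11.exists_rec_pair ![x, l, b] ![] ![Z] l b
    (fun t w c => if M.Visited x l Z t w then if M.len (M.ssucc c) ≤ b then M.ssucc c else c else c)
    (fun _ => M.empty) (fun L => by
      -- The empty string is not a term of the vocabulary.
      have (v : M.S) : v = M.empty ↔ M.len v ≤ 0 := len_le_zero_iff.symm
      simp only [this]
      infer_instance)
    (fun t w c hc => by split_ifs <;> assumption) (fun _ => len_empty_le b)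
  obtain ⟨Z', hZ'⟩ := h3 (l + l)
  refine ⟨fun t w => g (M.spair l w t), h4, fun t w => h2 _, ?_, ?_, l + l, Z', ?_⟩
  · intro t w ht hw h
    dsimp only
    rw [h5 t w hw, if_pos ((hZ.visited_iff hW ht w).2 h)]
    rfl
  · intro t w ht hw h
    dsimp only
    rw [h5 t w hw, if_neg (mt (hZ.visited_iff hW ht w).1 h)]
  · intro t w ht hw v hv
    exact hZ' _ (len_spair_le_of_le ht) v hv

theorem exists_singleton (x : M.N) : ∃ T, ∀ i, M.mem i T ↔ i = x :=
  M.w11.exists_str_of_bdd ![x] ![] ![] (M.succN x) (fun i => i = x) fun _ h => h ▸ lt_succN _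

theorem slt_of_len_le {x : M.N} {X T : M.S} (hX : M.len X ≤ x) (hT : ∀ i, M.mem i T ↔ i = x) :
    X < T :=
  ⟨x, fun h => absurd (lt_len h) hX.not_gt, (hT x).2 rfl, fun j hj => iff_of_false
    (fun h => absurd (hj.trans (lt_len h)) hX.not_gt) (fun h => hj.ne' ((hT j).1 h))⟩

theorem slt_ssucc_of_slt {X Y : M.S} (h : X < Y) : X < M.ssucc Y := slt_ssucc_iff.2 (.inl h)

set_option synthInstance.maxSize 4096 in
/-- A function from the strings of length at most `x + 1` to those of length at most `x` is not
injective. -/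
theorem exists_collision {x : M.N} {W : M.S → M.S} (hW : ∀ s, M.len (W s) ≤ x)
    (hc : ∃ Z, Codes (M.succN (M.succN x)) x W Z) :
    ∃ U U', U < U' ∧ M.len U' ≤ M.succN x ∧ W U = W U' := by
  by_contra! hinj
  obtain ⟨Z, hZ⟩ := hc
  -- `T` below has length at most `x + 1`, so its successor fits into length `x + 2`. The counters
  -- have the same bound, and the cut-off in `bump` does no harm where it matters.
  set l := M.succN (M.succN x) with hl
  obtain ⟨c, hc0, hcb, hc1, hc2, L, Z', hZ'⟩ := exists_count (b := l) hW hZ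
  -- `T` is the binary number `2^x`, larger than every value of `W`. The arguments up to `T` have
  -- length at most `x + 1` and are one more than the possible values.
  obtain ⟨T, hT⟩ := exists_singleton x
  have hTl : M.len T ≤ M.succN x := len_le_iff.2 fun i hi => (hT i).1 hi ▸ lt_succN x
  have hSTl : M.len (M.ssucc T) ≤ l := (len_ssucc_le T).trans (succN_le_succN.2 hTl)
  have hxl : M.succN x ≤ l := (lt_succN _).le
  have hbump_slt (c w) (h : c < M.ssucc w) : bump l c < M.ssucc (M.ssucc w) := by
    unfold bump
    split_ifs
    exacts [ssucc_slt_ssucc h, slt_ssucc_of_slt h]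
  -- the count is at most `w`
  have h1 (t) (ht : M.len t ≤ l) (w) (hw : M.len w ≤ l) : c t w < M.ssucc w := by
    refine M.w11.string_induction_of_iff ![L, l] ![t] ![Z'] l (A := fun w => c t w < M.ssucc w)
      (fun w => ∃ v, M.len v ≤ l ∧ M.hmem (M.spair L (M.spair l w t) v) Z' ∧ (v < w ∨ v = w))
      (fun w hw => ?_) ?_ ?_ w hw
    · rw [slt_ssucc_iff]
      refine ⟨fun h => ⟨c t w, hcb t w, (hZ' t w ht hw _ (hcb t w)).2 rfl, h⟩, ?_⟩
      rintro ⟨v, hv, h, h'⟩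
      rwa [← (hZ' t w ht hw v hv).1 h]
    · rw [hc0]
      exact slt_ssucc _
    · intro w hw ih
      by_cases h : ∃ s, s < t ∧ W s = w
      · rw [hc1 t w ht hw h]
        exact hbump_slt _ _ ih
      · rw [hc2 t w ht hw h]
        exact slt_ssucc_of_slt ih
  -- the effect of increasing `t`
  have h2 (t) (ht : M.len (M.ssucc t) ≤ l) (hlt : t < M.ssucc T) (w) (hw : M.len w ≤ l) :
      (W t < w → c (M.ssucc t) w = bump l (c t w)) ∧
        (¬ W t < w → c (M.ssucc t) w = c t w) := by
    have ht' := (len_le_len_ssucc t).trans ht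
    have hne (s) (hs : s < t) : W s ≠ W t := by
      refine hinj s t hs ?_
      rcases slt_ssucc_iff.1 hlt with h | rfl
      exacts [(len_le_of_slt h).trans hTl, hTl]
    -- The strings `M.ssucc t` and `W t` are not terms. Named, they can be parameters of the
    -- induction formula.
    obtain ⟨t', ht''⟩ : ∃ t', t' = M.ssucc t := ⟨_, rfl⟩
    obtain ⟨u, hu⟩ : ∃ u, u = W t := ⟨_, rfl⟩
    rw [← ht''] at ht ⊢
    rw [← hu] at hne ⊢
    refine M.w11.string_induction_of_iff ![L, l] ![t, t', u] ![Z'] l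
      (A := fun w => (u < w → c t' w = bump l (c t w)) ∧ (¬ u < w → c t' w = c t w))
      (fun w => ∃ v, M.len v ≤ l ∧ ∃ v', M.len v' ≤ l ∧
        M.hmem (M.spair L (M.spair l w t) v) Z' ∧ M.hmem (M.spair L (M.spair l w t') v') Z' ∧
        (u < w → (M.len (M.ssucc v) ≤ l ∧ v' = M.ssucc v) ∨
          (¬ M.len (M.ssucc v) ≤ l ∧ v' = v)) ∧ (¬ u < w → v' = v))
      (fun w hw => ?_) ?_ ?_ w hw
    · have hb (v v' : M.S) : v' = bump l v ↔ (M.len (M.ssucc v) ≤ l ∧ v' = M.ssucc v) ∨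
          (¬ M.len (M.ssucc v) ≤ l ∧ v' = v) := by
        unfold bump
        split_ifs with h <;> simp [h]
      simp only [← hb]
      refine ⟨fun h => ⟨c t w, hcb t w, c t' w, hcb t' w, (hZ' t w ht' hw _ (hcb t w)).2 rfl,
        (hZ' t' w ht hw _ (hcb t' w)).2 rfl, h⟩, ?_⟩
      rintro ⟨v, hv, v', hv', h, h', h''⟩
      obtain rfl := (hZ' t w ht' hw v hv).1 h
      obtain rfl := (hZ' t' w ht hw v' hv').1 h'
      exact h''
    · exact ⟨fun h => absurd h (not_slt_empty u), fun _ => (hc0 t').trans (hc0 t).symm⟩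
    · intro w hw ih
      have hv : (∃ s, s < t' ∧ W s = w) ↔ (∃ s, s < t ∧ W s = w) ∨ u = w := by
        simp only [ht'', slt_ssucc_iff, hu]
        constructor
        · rintro ⟨s, h | rfl, h'⟩
          exacts [.inl ⟨s, h, h'⟩, .inr h']
        · rintro (⟨s, h, h'⟩ | h)
          exacts [⟨s, .inl h, h'⟩, ⟨t, .inr rfl, h⟩]
      have hcase : (¬ ∃ s, s < t ∧ W s = w) → ¬ u = w → c t' (M.ssucc w) = c t' w ∧
          c t (M.ssucc w) = c t w := fun h h' =>
        ⟨hc2 t' w ht hw (by rw [hv]; exact not_or.2 ⟨h, h'⟩), hc2 t w ht' hw h⟩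
      rw [slt_ssucc_iff]
      -- At `w = W t` only the count for `t + 1` goes up, since by injectivity `w` was not a value
      -- before. At every other `w` both counts behave alike.
      by_cases huw : u = w
      · have h1 : ¬ ∃ s, s < t ∧ W s = w := fun ⟨s, hs, hs'⟩ => hne s hs (hs'.trans huw.symm)
        have h2 : ¬ u < w := huw ▸ slt_irrefl u
        refine ⟨fun _ => ?_, fun h => absurd (.inr huw) h⟩
        rw [hc1 t' w ht hw (hv.2 (.inr huw)), hc2 t w ht' hw h1, ih.2 h2]
      · simp only [huw, or_false] at hv ⊢
        by_cases h : ∃ s, s < t ∧ W s = w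
        · rw [hc1 t' w ht hw (hv.2 h), hc1 t w ht' hw h]
          exact ⟨fun h => by rw [ih.1 h], fun h => by rw [ih.2 h]⟩
        · rw [hc2 t' w ht hw (mt hv.1 h), hc2 t w ht' hw h]
          exact ih
  -- all `t` values are counted
  have h3 (t) (ht : M.len t ≤ l) : t < M.ssucc (M.ssucc T) → c t T = t := by
    have hTl' := hTl.trans hxl
    obtain ⟨T', hT'⟩ : ∃ T', T' = M.ssucc T := ⟨_, rfl⟩
    refine M.w11.string_induction_of_iff ![L, l] ![T, T'] ![Z'] l
      (A := fun t => t < M.ssucc (M.ssucc T) → c t T = t)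
      (fun t => (t < T' ∨ t = T') → M.hmem (M.spair L (M.spair l T t) t) Z')
      (fun t ht => ?_) ?_ ?_ t ht
    · rw [slt_ssucc_iff, ← hT', hZ' t T ht hTl' t ht, @eq_comm _ t (c t T)]
    · rintro -
      refine M.w11.string_induction_of_iff ![L, l] ![M.empty] ![Z'] l
        (A := fun w => c M.empty w = M.empty)
        (fun w => M.hmem (M.spair L (M.spair l w M.empty) M.empty) Z') (fun w hw => ?_) ?_ ?_ T hTl'
      · rw [hZ' _ w (len_empty_le l) hw _ (len_empty_le l), eq_comm]
      · exact hc0 _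
      · intro w hw ih
        rw [hc2 _ w (len_empty_le l) hw (fun ⟨s, hs, _⟩ => not_slt_empty s hs), ih]
    · intro t ht ih hlt
      have hlt' : t < M.ssucc T := by
        rcases slt_ssucc_iff.1 hlt with h | h
        exacts [slt_trans (slt_ssucc t) h, h ▸ slt_ssucc t]
      rw [(h2 t ht hlt' T hTl').1 (slt_of_len_le (hW t) hT), ih (slt_ssucc_of_slt hlt')]
      exact if_pos ht
  have := h1 (M.ssucc T) hSTl T (hTl.trans hxl)
  rw [h3 _ hSTl (slt_ssucc _)] at this
  exact slt_irrefl _ this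

/-! ### Subtraction -/

theorem N_lt_add_left {x : M.N} (hx : 0 < x) (y : M.N) : y < x + y := by
  refine M.w11.num_induction ![x] ![] ![] (fun y => y < x + y) ?_ ?_ y
  · rwa [N_add_zero]
  · intro b ih
    rwa [N_add_succN, succN_lt_succN]

theorem N_lt_add_right {x y : M.N} (hy : 0 < y) : x < x + y := by
  simpa only [N_add_zero] using N_add_lt_add x hy

/-- The length bound in `IsAdd` is automatic. When only a carry produces bit `i`, bit `i - 1`
belongs to `U` or `V`, so `i` is at most the length of one summand. The carry originates at a common
bit, so the other summand has positive length. -/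
theorem lt_add_len_of_xor {U V : M.S} {i : M.N}
    (h : Xor (Xor (M.mem i U) (M.mem i V)) (M.Carry i U V)) : i < M.len U + M.len V := by
  by_cases h1 : M.mem i U
  · exact (lt_len h1).trans_le (N_le_add_right _ _)
  by_cases h2 : M.mem i V
  · exact (lt_len h2).trans_le (N_le_add_left _ _)
  obtain ⟨k, hk, h3, h4, h5⟩ : M.Carry i U V := by
    unfold Xor at h
    tauto
  obtain ⟨j, rfl⟩ := exists_pred ((N_zero_le k).trans_lt hk)
  have hUV : M.mem j U ∨ M.mem j V := by
    rcases (lt_succN_iff.1 hk).eq_or_lt with rfl | hk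
    exacts [.inl h3, h5 j (lt_succN j) hk]
  rcases hUV with h | h
  · exact (succN_le_iff.2 (lt_len h)).trans_lt (N_lt_add_right ((N_zero_le k).trans_lt (lt_len h4)))
  · exact (succN_le_iff.2 (lt_len h)).trans_lt (N_lt_add_left ((N_zero_le k).trans_lt (lt_len h3)) _)

theorem carry_succN {X Y : M.S} {i : M.N} : M.Carry (M.succN i) X Y ↔
    (M.mem i X ∧ M.mem i Y) ∨ ((M.mem i X ∨ M.mem i Y) ∧ M.Carry i X Y) := by
  change (∃ k, k < M.succN i ∧ M.mem k X ∧ M.mem k Y ∧ ∀ j, j < M.succN i → k < j → _) ↔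
    _ ∨ (_ ∧ ∃ k, k < i ∧ M.mem k X ∧ M.mem k Y ∧ ∀ j, j < i → k < j → _)
  constructor
  · rintro ⟨k, h1, h2, h3, h4⟩
    rcases (lt_succN_iff.1 h1).eq_or_lt with rfl | h1
    · exact .inl ⟨h2, h3⟩
    · exact .inr ⟨h4 i (lt_succN i) h1, k, h1, h2, h3, fun j hj => h4 j (hj.trans (lt_succN i))⟩
  · rintro (⟨h2, h3⟩ | ⟨h1, k, h2, h3, h4, h5⟩)
    · exact ⟨i, lt_succN i, h2, h3, fun j hj hj' => absurd (lt_succN_iff.1 hj) hj'.not_ge⟩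
    · refine ⟨k, h2.trans (lt_succN i), h3, h4, fun j hj hj' => ?_⟩
      rcases (lt_succN_iff.1 hj).eq_or_lt with rfl | hj
      exacts [h1, h5 j hj hj']

theorem not_carry_zero (X Y : M.S) : ¬ M.Carry 0 X Y := fun ⟨k, h, _⟩ => N_not_lt_zero k h

/-- A borrow in the subtraction of `X` from `Y` arises at position `i`. -/
def Borrow (M : Struct) (i : M.N) (X Y : M.S) : Prop :=
  ∃ k, k < i ∧ (M.mem k X ∧ ¬ M.mem k Y) ∧ ∀ j, j < i → k < j → M.mem j X ∨ ¬ M.mem j Y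

theorem borrow_succN {X Y : M.S} {i : M.N} : M.Borrow (M.succN i) X Y ↔
    (M.mem i X ∧ ¬ M.mem i Y) ∨ ((M.mem i X ∨ ¬ M.mem i Y) ∧ M.Borrow i X Y) := by
  constructor
  · rintro ⟨k, h1, h2, h4⟩
    rcases (lt_succN_iff.1 h1).eq_or_lt with rfl | h1
    · exact .inl h2
    · exact .inr ⟨h4 i (lt_succN i) h1, k, h1, h2, fun j hj => h4 j (hj.trans (lt_succN i))⟩
  · rintro (h2 | ⟨h1, k, h2, h3, h5⟩)
    · exact ⟨i, lt_succN i, h2, fun j hj hj' => absurd (lt_succN_iff.1 hj) hj'.not_ge⟩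
    · refine ⟨k, h2.trans (lt_succN i), h3, fun j hj hj' => ?_⟩
      rcases (lt_succN_iff.1 hj).eq_or_lt with rfl | hj
      exacts [h1, h5 j hj hj']

/-- Subtraction of strings. -/
theorem exists_isAdd {U W : M.S} (h : U < W) :
    ∃ V, M.len V ≤ M.len W ∧ V ≠ M.empty ∧ M.IsAdd U V W := by
  have : (Ctx.fixed M (Interp.none M) ![] ![U, W] ![]).consN.Def (fun p => M.Borrow p.2 U W) := by
    unfold Borrow
    infer_instance
  -- Schoolbook subtraction of `U` from `W`. Up to the length of `W` the carries of `U + V` turn out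
  -- to be exactly the borrows, whence the bits of `U + V` are those of `W`.
  obtain ⟨V, hV, hV'⟩ := M.w11.exists_str ![] ![U, W] ![] (M.len W)
    (fun i => Xor (Xor (M.mem i U) (M.mem i W)) (M.Borrow i U W))
  obtain ⟨z, hz1, hz2, hz3⟩ := h
  have hzW := lt_len hz2
  have hUW := len_le_of_slt ⟨z, hz1, hz2, hz3⟩
  -- `z` is the highest bit where `U` and `W` differ, and there `W` has a one; this stops every
  -- borrow from below, and none arises above.
  have hborrow (i) (hi : z < i) : ¬ M.Borrow i U W := by
    rintro ⟨k, -, ⟨h1, h2⟩, h3⟩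
    rcases lt_trichotomy k z with h | rfl | h
    · rcases h3 z hi h with h | h
      exacts [hz1 h, h hz2]
    · exact hz1 h1
    · exact h2 ((hz3 k h).1 h1)
  have hcarry (i) : i ≤ M.len W → (M.Carry i U V ↔ M.Borrow i U W) := by
    refine M.w11.num_induction ![] ![U, V, W] ![]
      (fun i => i ≤ M.len W → (M.Carry i U V ↔ M.Borrow i U W)) (hA := ?_) ?_ ?_ i
    · unfold Borrow
      infer_instance
    · exact fun _ => iff_of_false (not_carry_zero U V) fun ⟨k, h, _⟩ => N_not_lt_zero k h
    · intro b ih hb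
      have hb := succN_le_iff.1 hb
      rw [carry_succN, borrow_succN, ih hb.le, hV' b hb]
      unfold Xor
      tauto
  have hmem (i) (hi : M.len W ≤ i) : ¬ M.mem i U ∧ ¬ M.mem i V ∧ ¬ M.mem i W :=
    ⟨fun h => absurd (lt_len h) (hUW.trans hi).not_gt,
      fun h => absurd (lt_len h) (hV.trans hi).not_gt, fun h => absurd (lt_len h) hi.not_gt⟩
  have hcarry' (i) (hi : M.len W ≤ i) : ¬ M.Carry i U V := by
    rintro ⟨k, h1, h2, h3, h4⟩
    have hk := (lt_len h3).trans_le hV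
    -- A carry beyond the length of `W` would have to pass through that position, where it would be
    -- a borrow.
    refine hborrow _ hzW ((hcarry _ le_rfl).1 ⟨k, hk, h2, h3, fun j hj => ?_⟩)
    exact h4 j (show j < i from lt_of_lt_of_le hj hi)
  have hadd : M.IsAdd U V W := by
    intro i
    rcases lt_or_ge i (M.len W) with hi | hi
    · have h1 := hcarry i hi.le
      have h2 := hV' i hi
      have h3 : M.mem i W ↔ Xor (Xor (M.mem i U) (M.mem i V)) (M.Carry i U V) := by
        rw [h1, h2]
        unfold Xor
        tauto
      rw [← h3]
      exact ⟨fun h => ⟨lt_add_len_of_xor (h3.1 h), h⟩, fun h => h.2⟩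
    · have := hmem i hi
      have h2 := hcarry' i hi
      refine iff_of_false this.2.2 ?_
      unfold Xor
      tauto
  refine ⟨V, hV, ?_, hadd⟩
  -- Adding the empty string causes no carry and would leave bit `z` as it is in `U`, although `U`
  -- and `W` differ there.
  rintro rfl
  have hne (i) := (hadd i).1
  have h3 : ¬ M.Carry z U M.empty := fun ⟨k, _, _, h, _⟩ => not_mem_empty k h
  have h4 := (hne z hz2).2
  have h5 := not_mem_empty (M := M) z
  unfold Xor at h4
  tauto

end Struct
end BoundedArith

namespace BoundedArith

/-! ### Iterations of an operator -/

/-- `V'` is the string of all `i < x` with `φ(i, V)`. -/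
def Operator.Step (φ : Operator) (M : Struct) (a : Fin φ.p → M.N) (A : Fin φ.q → M.S) (x : M.N)
    (V V' : M.S) : Prop :=
  M.len V' ≤ x ∧ ∀ i, i < x → (M.mem i V' ↔ φ.App M a A i V)

/-- `V` is the string of all `i < x` with `Y(i)`. -/
def Struct.Trunc (M : Struct) (x : M.N) (Y V : M.S) : Prop :=
  M.len V ≤ x ∧ ∀ i, i < x → (M.mem i V ↔ M.mem i Y)

/-- `Z` codes the iteration of `φ` from `Y` up to `X`. -/
def Operator.Run (φ : Operator) (M : Struct) (a : Fin φ.p → M.N) (A : Fin φ.q → M.S) (x : M.N)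
    (Y O X : M.S) (Z : M.H) : Prop :=
  ∃ V, M.len V ≤ x ∧ M.Trunc x Y V ∧
    M.RunOn (M.len X) x (M.len X) O V (fun _ V V' => φ.Step M a A x V V') Z

/-- `Z` codes the iterations of `φ` from all `Y` of length at most `x`. -/
def Operator.RunAll (φ : Operator) (M : Struct) (a : Fin φ.p → M.N) (A : Fin φ.q → M.S) (x : M.N)
    (O : M.S) (Z : M.H) : Prop :=
  M.RunOn (M.succN (M.succN x) + x) x (M.succN (M.succN x) + x) O O
    (fun C V V' => M.PairStep (M.succN (M.succN x)) (fun _ _ V V' => φ.Step M a A x V V')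
      (fun T V => M.Trunc x T V) C V V') Z

/-- The iteration from `Y` coded in `Z` has the same value at some `U` and `U + V`, `V ≠ ∅`. -/
def Struct.Collide (M : Struct) (x : M.N) (Y : M.S) (Z : M.H) : Prop :=
  ∃ U, M.len U ≤ M.succN x ∧ ∃ V, M.len V ≤ M.succN x ∧ ¬ M.IsEmptyStr V ∧
    ∃ W, M.len W ≤ M.succN x ∧ M.IsAdd U V W ∧ ∃ T, M.len T ≤ x ∧
      M.hmem (M.spair (M.succN (M.succN x) + x) (M.spair (M.succN (M.succN x)) U Y) T) Z ∧
      M.hmem (M.spair (M.succN (M.succN x) + x) (M.spair (M.succN (M.succN x)) W Y) T) Z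

namespace Ctx

variable {R : Sig} {Γ : Type 1} {n m k : ℕ} {C : Ctx R Γ n m k}

theorem def_step (φ : Operator) (a : (γ : Γ) → Fin φ.p → (C.M γ).N)
    (A : (γ : Γ) → Fin φ.q → (C.M γ).S) (x : (γ : Γ) → (C.M γ).N) (V V' : (γ : Γ) → (C.M γ).S)
    [C.IsTms a] [C.IsSVars A] [C.IsTm x] [C.IsSVar V] [C.IsSVar V'] :
    C.Def (fun γ => φ.Step (C.M γ) (a γ) (A γ) (x γ) (V γ) (V' γ)) := by
  unfold Operator.Step
  infer_instance

attribute [instance] def_step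

instance def_trunc (x : (γ : Γ) → (C.M γ).N) (Y V : (γ : Γ) → (C.M γ).S)
    [C.IsTm x] [C.IsSVar Y] [C.IsSVar V] : C.Def (fun γ => (C.M γ).Trunc (x γ) (Y γ) (V γ)) := by
  unfold Struct.Trunc
  infer_instance

theorem def_run (φ : Operator) (a : (γ : Γ) → Fin φ.p → (C.M γ).N)
    (A : (γ : Γ) → Fin φ.q → (C.M γ).S) (x : (γ : Γ) → (C.M γ).N) (Y O X : (γ : Γ) → (C.M γ).S)
    (Z : (γ : Γ) → (C.M γ).H) [C.IsTms a] [C.IsSVars A] [C.IsTm x] [C.IsSVar Y] [C.IsSVar O]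
    [C.IsSVar X] [C.IsHVar Z] :
    C.Def (fun γ => φ.Run (C.M γ) (a γ) (A γ) (x γ) (Y γ) (O γ) (X γ) (Z γ)) := by
  unfold Operator.Run
  infer_instance

attribute [instance] def_run

set_option synthInstance.maxSize 4096 in
theorem def_runAll (φ : Operator) (a : (γ : Γ) → Fin φ.p → (C.M γ).N)
    (A : (γ : Γ) → Fin φ.q → (C.M γ).S) (x : (γ : Γ) → (C.M γ).N) (O : (γ : Γ) → (C.M γ).S)
    (Z : (γ : Γ) → (C.M γ).H) [C.IsTms a] [C.IsSVars A] [C.IsTm x] [C.IsSVar O]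
    [C.IsHVar Z] :
    C.Def (fun γ => φ.RunAll (C.M γ) (a γ) (A γ) (x γ) (O γ) (Z γ)) := by
  unfold Operator.RunAll
  infer_instance

attribute [instance] def_runAll

set_option synthInstance.maxSize 4096 in
instance def_collide (x : (γ : Γ) → (C.M γ).N) (Y : (γ : Γ) → (C.M γ).S)
    (Z : (γ : Γ) → (C.M γ).H) [C.IsTm x] [C.IsSVar Y] [C.IsHVar Z] :
    C.Def (fun γ => (C.M γ).Collide (x γ) (Y γ) (Z γ)) := by
  unfold Struct.Collide
  infer_instance

theorem def_rel (r : R.Sym) (v : (γ : Γ) → Fin (R.nAr r) → (C.M γ).N)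
    (V : (γ : Γ) → Fin (R.sAr r) → (C.M γ).S) [hv : C.IsTms v] [hV : C.IsSVars V] :
    C.Def (fun γ => C.I γ r (v γ) (V γ)) := by
  choose t ht using fun i => (hv.out i).out
  choose X hX using fun i => (hV.out i).out
  refine ⟨.rel r t X, trivial, fun γ => ?_⟩
  have h1 : (fun i => (t i).val (C.M γ) (C.e γ) (C.E γ)) = v γ :=
    funext fun i => eq_of_heq (ht i γ)
  have h2 : (fun i => C.E γ (X i)) = V γ := funext fun i => eq_of_heq (hX i γ)
  simp only [Fm.Holds, h1, h2]

end Ctx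

namespace Struct

variable {M : Struct} [hM : M.W11]

theorem str_ext_of_lt {x : M.N} {X Y : M.S} (hX : M.len X ≤ x) (hY : M.len Y ≤ x)
    (h : ∀ i, i < x → (M.mem i X ↔ M.mem i Y)) : X = Y := by
  refine str_ext fun i => ?_
  by_cases hi : i < x
  · exact h i hi
  · exact iff_of_false (fun h => hi ((lt_len h).trans_le hX)) fun h => hi ((lt_len h).trans_le hY)

theorem exists_eq_trunc (x : M.N) : ∃ st : M.S → M.S, ∀ Y V, V = st Y ↔ M.Trunc x Y V := by
  choose st h1 h2 using fun Y => M.w11.exists_str ![] ![Y] ![] x (fun i => M.mem i Y)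
  refine ⟨st, fun Y V => ⟨by rintro rfl; exact ⟨h1 Y, h2 Y⟩, fun h => ?_⟩⟩
  exact str_ext_of_lt h.1 (h1 Y) fun i hi => (h.2 i hi).trans (h2 Y i hi).symm

variable {φ : Operator} {a : Fin φ.p → M.N} {A : Fin φ.q → M.S} {x : M.N}

theorem exists_eq_step (φ : Operator) (a : Fin φ.p → M.N) (A : Fin φ.q → M.S) (x : M.N) :
    ∃ f : M.S → M.S, ∀ V V', V' = f V ↔ φ.Step M a A x V V' := by
  choose f h1 h2 using fun V => M.w11.exists_str a (Matrix.vecCons V A) ![] x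
    (fun i => φ.App M a A i V)
  refine ⟨f, fun V V' => ⟨by rintro rfl; exact ⟨h1 V, h2 V⟩, fun h => ?_⟩⟩
  exact str_ext_of_lt h.1 (h1 V) fun i hi => (h.2 i hi).trans (h2 V i hi).symm

/-- `g` is the iteration of `φ` from `Y` along the strings. -/
structure IsIter (φ : Operator) (a : Fin φ.p → M.N) (A : Fin φ.q → M.S) (x : M.N) (Y : M.S)
    (g : M.S → M.S) : Prop where
  start : M.Trunc x Y (g M.empty)
  step : ∀ X, φ.Step M a A x (g X) (g (M.ssucc X))
  len_le : ∀ X, M.len (g X) ≤ x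
  exists_codes : ∀ l, ∃ Z, Codes l x g Z

theorem exists_isIter (φ : Operator) (a : Fin φ.p → M.N) (A : Fin φ.q → M.S) (x : M.N) (Y : M.S) :
    ∃ g, IsIter φ a A x Y g := by
  obtain ⟨f, hf⟩ := exists_eq_step φ a A x
  obtain ⟨st, hst⟩ := exists_eq_trunc x
  obtain ⟨g, h1, h2, h3, h4⟩ := M.w11.exists_rec (Matrix.vecCons x a) A ![] x (fun _ V => f V)
    (fun l => by
      simp only [hf]
      infer_instance) (fun _ V _ => ((hf V _).1 rfl).1) ((hst Y _).1 rfl).1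
  exact ⟨g, (hst _ _).1 h1, fun X => (hf _ _).1 (h2 X), h3, h4⟩

namespace IsIter

variable {Y : M.S} {g : M.S → M.S}

/-- Every `Z` that the formula accepts as a run codes the true iteration. The variable `O` stands
for the empty string, which formulas can only describe by its length. -/
theorem run_iff (h : IsIter φ a A x Y g) {O X : M.S} {Z : M.H} (hO : M.len O ≤ 0) :
    φ.Run M a A x Y O X Z ↔ Codes (M.len X) x g Z := by
  obtain ⟨f, hf⟩ := exists_eq_step φ a A x
  obtain ⟨st, hst⟩ := exists_eq_trunc x
  obtain rfl := len_le_zero_iff.1 hO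
  have h1 : g M.empty = st Y := (hst _ _).2 h.start
  have h2 (X) : g (M.ssucc X) = f (g X) := (hf _ _).2 (h.step X)
  obtain ⟨Z', hZ'⟩ := h.exists_codes (M.len X)
  simp only [Operator.Run, ← hf, ← hst]
  constructor
  · rintro ⟨V, hV, rfl, hZ⟩
    exact hZ.codes hZ' h.len_le h1 h2
  · exact fun hZ => ⟨st Y, ((hst Y _).1 rfl).1, rfl, hZ.runOn h.len_le h1 h2⟩

theorem mem_iff_exists (h : IsIter φ a A x Y g) (i : M.N) (X : M.S) :
    (∃ Z, ∃ O, M.len O ≤ 0 ∧ φ.Run M a A x Y O X Z ∧ ∃ V, M.len V ≤ x ∧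
      M.hmem (M.spair (M.len X) X V) Z ∧ M.mem i V) ↔ M.mem i (g X) := by
  constructor
  · rintro ⟨Z, O, hO, hZ, V, hV, hXV, hi⟩
    rwa [← ((h.run_iff hO).1 hZ X le_rfl V hV).1 hXV]
  · intro hi
    obtain ⟨Z, hZ⟩ := h.exists_codes (M.len X)
    exact ⟨Z, M.empty, len_empty.le, (h.run_iff len_empty.le).2 hZ, g X, h.len_le X,
      (hZ X le_rfl _ (h.len_le X)).2 rfl, hi⟩

/-- The `𝚷^B_1` counterpart of `mem_iff_exists`: runs exist and all have the same value at `X`. -/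
theorem mem_iff_forall (h : IsIter φ a A x Y g) (i : M.N) (X : M.S) :
    (∀ Z, ∀ O, M.len O ≤ 0 → φ.Run M a A x Y O X Z → ∀ V, M.len V ≤ x →
      M.hmem (M.spair (M.len X) X V) Z → M.mem i V) ↔ M.mem i (g X) := by
  constructor
  · intro h'
    obtain ⟨Z, hZ⟩ := h.exists_codes (M.len X)
    exact h' Z M.empty len_empty.le ((h.run_iff len_empty.le).2 hZ) (g X) (h.len_le X)
      ((hZ X le_rfl _ (h.len_le X)).2 rfl)
  · intro hi Z O hO hZ V hV hXV
    rwa [((h.run_iff hO).1 hZ X le_rfl V hV).1 hXV]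

theorem isIteration (h : IsIter φ a A x Y g) {P : M.N → M.N → M.S → Prop}
    (hP : ∀ i X, P i x X ↔ M.mem i (g X)) {B : M.N → Prop} (hB : ∀ i, i < x → (B i ↔ M.mem i Y)) :
    M.IsIteration P (φ.App M a A) B x := by
  have hit (X) : M.IsIterate P x X (g X) := fun j => by
    rw [hP]
    exact (and_iff_left_of_imp fun hj => (lt_len hj).trans_le (h.len_le X)).symm
  refine ⟨fun X => ⟨g X, h.len_le X, hit X⟩, fun O hO i hi => ?_, fun X X' Z hX hZ i hi => ?_⟩
  · rw [hP, isEmptyStr_iff.1 hO, hB i hi]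
    exact h.start.2 i hi
  · have : Z = g X := str_ext fun j => (hZ j).trans (hit X j).symm
    rw [hP, isSucc_iff_eq.1 hX, this]
    exact (h.step X).2 i hi

/-- The collision gives `U < W` of length at most `x + 1`, and subtraction gives `V`. Only counters
of that length matter, so `P` may be either `D_φ` or the symbol `P_φ`. -/
theorem idAx (h : IsIter φ a A x Y g) {P : M.N → M.N → M.S → Prop}
    (hP : ∀ i X, i < x → M.len X ≤ M.succN x → (P i x X ↔ M.mem i (g X))) : M.IDAx P x := by
  obtain ⟨U, W, h1, h2, h3⟩ := exists_collision h.len_le (h.exists_codes _)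
  obtain ⟨V, h4, h5, h6⟩ := exists_isAdd h1
  have hU := (len_le_of_slt h1).trans h2
  refine ⟨U, V, W, hU, h4.trans h2, mt isEmptyStr_iff.1 h5, h6, fun i hi => ?_⟩
  rw [hP i W hi h2, hP i U hi hU, h3]

/-- Uniqueness of iterations, for definable predicates. -/
theorem iff_mem (h : IsIter φ a A x Y g) {R : Sig} {I : Interp R M} (hI : M.IsW11With R I)
    {n m : ℕ} (e : Fin n → M.N) (E : Fin m → M.S) {P : M.N → M.N → M.S → Prop}
    (hP : ∀ Z, (Ctx.fixed M I (Matrix.vecCons (M.succN x) (Matrix.vecCons x e)) E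
      ![Z]).consS.consN.Def (fun p => P p.2 x p.1.2)) {B : M.N → Prop}
    (hB : ∀ i, i < x → (B i ↔ M.mem i Y)) (h0 : M.BaseAx P B x)
    (hs : ∀ X, M.len X ≤ M.succN x → M.StepAx P (φ.App M a A) x X) (i : M.N) (X : M.S)
    (hi : i < x) (hX : M.len X ≤ M.succN x) : P i x X ↔ M.mem i (g X) := by
  obtain ⟨Z, hZ⟩ := h.exists_codes (M.succN x)
  have := hP Z
  -- `g` lies outside the model, so the induction formula refers to it through its code `Z`. The
  -- induction takes place in the expanded vocabulary, where `P` is definable.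
  refine hI.string_induction_of_iff (Matrix.vecCons (M.succN x) (Matrix.vecCons x e)) E ![Z]
    (M.succN x) (A := fun X => ∀ i, i < x → (P i x X ↔ M.mem i (g X)))
    (fun X => ∀ i, i < x → (P i x X ↔ ∃ V, M.len V ≤ x ∧
      M.hmem (M.spair (M.succN x) X V) Z ∧ M.mem i V)) (fun X hX => ?_) ?_ ?_ X hX i hi
  · refine forall_congr' fun i => imp_congr_right fun _ => iff_congr Iff.rfl ⟨fun hi => ?_, ?_⟩
    · exact ⟨g X, h.len_le X, (hZ X hX _ (h.len_le X)).2 rfl, hi⟩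
    · rintro ⟨V, hV, hXV, hi⟩
      rwa [← (hZ X hX V hV).1 hXV]
  · intro i hi
    rw [h0 _ (isEmptyStr_iff.2 rfl) i hi, hB i hi]
    exact (h.start.2 i hi).symm
  · intro X hX ih i hi
    rw [hs X ((len_le_len_ssucc X).trans hX) _ (g X) (isSucc_ssucc X) (fun j => ?_) i hi]
    · exact ((h.step X).2 i hi).symm
    · refine ⟨fun hj => ?_, fun hj => (ih j hj.2).1 hj.1⟩
      have := (lt_len hj).trans_le (h.len_le X)
      exact ⟨(ih j this).2 hj, this⟩

end IsIter

/-- A single hyper string codes the iterations from all `Y` of length at most `x`, by recursion with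
`Y` as the parameter. This avoids having to collect a hyper string for each `Y`. -/
theorem exists_runAll (φ : Operator) (a : Fin φ.p → M.N) (A : Fin φ.q → M.S) (x : M.N) :
    ∃ Z, φ.RunAll M a A x M.empty Z ∧ ∀ Y, M.len Y ≤ x → M.Collide x Y Z := by
  obtain ⟨f, hf⟩ := exists_eq_step φ a A x
  obtain ⟨st, hst⟩ := exists_eq_trunc x
  have h0 : M.empty = st M.empty := (hst _ _).2 ⟨len_empty_le x, fun _ _ => Iff.rfl⟩
  set l := M.succN (M.succN x) with hl
  obtain ⟨s, g, h1, h2, h3, h4, h5, -, -⟩ := M.w11.exists_rec_pair (Matrix.vecCons x a) A ![] l x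
    (fun _ _ V => f V) st (fun L => by
      simp only [hf, hst]
      infer_instance) (fun _ _ V _ => ((hf V _).1 rfl).1) (fun T => ((hst T _).1 rfl).1)
  obtain ⟨Z, hZ⟩ := h5 (l + x)
  refine ⟨Z, ?_, fun Y hY => ?_⟩
  · have := hZ.runOn h4 (h1.trans h0.symm) h2
    simp only [h3, hf, hst] at this
    exact this
  · have hZ' (X V) (hV : M.len V ≤ x) :
        M.hmem (M.spair (l + x) (M.spair l X Y) V) Z ↔ V = g (M.spair l X Y) :=
      hZ _ (len_spair_le_of_le hY) V hV
    obtain ⟨U, W, h6, h7, h8⟩ := exists_collision (W := fun X => g (M.spair l X Y))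
      (fun X => h4 _) (x := x) (by
        -- The section of `Z` at `Y`, as the pigeonhole principle asks for a code of a function of
        -- one argument.
        obtain ⟨Z1, hZ1⟩ := M.w11.exists_hyp ![l, x] ![Y] ![Z] (l + x)
          (fun C => ∃ X, M.len X ≤ l ∧ ∃ V, M.len V ≤ x ∧ M.IsPair l X V C ∧
            M.hmem (M.spair (l + x) (M.spair l X Y) V) Z)
        refine ⟨Z1, fun X hX V hV => ?_⟩
        rw [← hl, hZ1 _ (len_spair_le_of_le hV), ← hZ' X V hV]
        constructor
        · rintro ⟨X', hX', V', hV', h, h'⟩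
          obtain ⟨rfl, rfl⟩ := (spair_inj hX hX').1 (isPair_iff_eq.1 h)
          exact h'
        · exact fun h => ⟨X, hX, V, hV, isPair_spair l X V, h⟩)
    obtain ⟨V, h9, h10, h11⟩ := exists_isAdd h6
    exact ⟨U, (len_le_of_slt h6).trans h7, V, h9.trans h7, mt isEmptyStr_iff.1 h10, W, h7, h11,
      g (M.spair l U Y), h4 _, (hZ' U _ (h4 _)).2 rfl, (hZ' W _ (h4 _)).2 h8⟩

end Struct

/-! ### Formulas for the iterations -/

namespace Operator

/-- Models of `W^1_1` with an assignment to the parameters of `φ`. -/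
abbrev Assignment (φ : Operator) : Type 1 :=
  Σ M : {M : Struct // M.W11}, (Fin φ.p → M.1.N) × (Fin φ.q → M.1.S)

/-- The parameters of `φ`, as a context. -/
abbrev ctx (φ : Operator) : Ctx Sig.none φ.Assignment φ.p φ.q 0 where
  M γ := γ.1.1
  I γ := Interp.none γ.1.1
  ok γ := γ.1.2
  e γ := γ.2.1
  E γ := γ.2.2
  F _ := Fin.elim0

/-- The number parameters. -/
def Assignment.num {φ : Operator} (γ : φ.Assignment) : Fin φ.p → γ.1.1.N := γ.2.1

/-- The string parameters. -/
def Assignment.str {φ : Operator} (γ : φ.Assignment) : Fin φ.q → γ.1.1.S := γ.2.2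

instance (φ : Operator) : φ.ctx.IsTms (fun γ => γ.num) := ⟨fun i => ⟨.var i, fun _ => .rfl⟩⟩

instance (φ : Operator) : φ.ctx.IsSVars (fun γ => γ.str) := ⟨fun i => ⟨i, fun _ => .rfl⟩⟩

set_option synthInstance.maxSize 4096 in
/-- The formula `D(i, x, X, Y)` for the iteration of `φ` from `Y`, in both forms. -/
theorem exists_relFormula (φ : Operator) : ∃ D : Fm Sig.none (φ.p + 2) (φ.q + 2) 0,
    D.IsDelta1 ∧ ∀ (M : Struct) [M.W11] (a : Fin φ.p → M.N) (A : Fin φ.q → M.S) (x : M.N)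
      (Y : M.S) (g : M.S → M.S), Struct.IsIter φ a A x Y g →
        ∀ i X, φ.TRel D M a A Y i x X ↔ M.mem i (g X) := by
  -- Variables are added in the order `x`, `i`, `Y`, `X`, so that `i` and `X` receive the index `0`.
  have h1 : φ.ctx.consN.consN.consS.consS.Sig1 (fun p => ∃ Z, ∃ O, (φ.ctx.M p.1.1.1.1).len O ≤ 0 ∧
      φ.Run (φ.ctx.M p.1.1.1.1) p.1.1.1.1.num p.1.1.1.1.str p.1.1.1.2 p.1.2 O p.2 Z ∧
      ∃ V, (φ.ctx.M p.1.1.1.1).len V ≤ p.1.1.1.2 ∧ (φ.ctx.M p.1.1.1.1).hmem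
        ((φ.ctx.M p.1.1.1.1).spair ((φ.ctx.M p.1.1.1.1).len p.2) p.2 V) Z ∧
        (φ.ctx.M p.1.1.1.1).mem p.1.1.2 V) := inferInstance
  have h2 : φ.ctx.consN.consN.consS.consS.Pi1 (fun p => ∀ Z, ∀ O, (φ.ctx.M p.1.1.1.1).len O ≤ 0 →
      φ.Run (φ.ctx.M p.1.1.1.1) p.1.1.1.1.num p.1.1.1.1.str p.1.1.1.2 p.1.2 O p.2 Z →
      ∀ V, (φ.ctx.M p.1.1.1.1).len V ≤ p.1.1.1.2 → (φ.ctx.M p.1.1.1.1).hmem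
        ((φ.ctx.M p.1.1.1.1).spair ((φ.ctx.M p.1.1.1.1).len p.2) p.2 V) Z →
        (φ.ctx.M p.1.1.1.1).mem p.1.1.2 V) := inferInstance
  obtain ⟨D, hD, hD'⟩ := h1.out
  obtain ⟨D₂, hD₂, hD₂'⟩ := h2.out
  have key (M : Struct) [hM : M.W11] (a : Fin φ.p → M.N) (A : Fin φ.q → M.S) (x : M.N) (Y : M.S)
      (g : M.S → M.S) (hg : Struct.IsIter φ a A x Y g) (i : M.N) (X : M.S) :
      φ.TRel D M a A Y i x X ↔ M.mem i (g X) :=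
    (hD' ⟨⟨⟨⟨⟨⟨M, hM⟩, a, A⟩, x⟩, i⟩, Y⟩, X⟩).trans (hg.mem_iff_exists i X)
  refine ⟨D, ⟨hD, D₂, hD₂, fun M hM e E => ?_⟩, key⟩
  have : M.W11 := ⟨hM⟩
  obtain ⟨i, e, rfl⟩ : ∃ i e', e = Fin.cons i e' := ⟨_, _, (Fin.cons_self_tail e).symm⟩
  obtain ⟨x, a, rfl⟩ : ∃ i e', e = Fin.cons i e' := ⟨_, _, (Fin.cons_self_tail e).symm⟩
  obtain ⟨X, E, rfl⟩ : ∃ X E', E = Fin.cons X E' := ⟨_, _, (Fin.cons_self_tail E).symm⟩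
  obtain ⟨Y, A, rfl⟩ : ∃ X E', E = Fin.cons X E' := ⟨_, _, (Fin.cons_self_tail E).symm⟩
  -- Both forms describe the bits of the same iteration `g`, which exists in every model.
  obtain ⟨g, hg⟩ := Struct.exists_isIter φ a A x Y
  exact (key M a A x Y g hg i X).trans ((hg.mem_iff_forall i X).symm.trans
    (hD₂' ⟨⟨⟨⟨⟨⟨M, this⟩, a, A⟩, x⟩, i⟩, Y⟩, X⟩).symm)

/-- The formula `D(i, x, X)` for the iteration of `φ` from the empty string. -/
theorem exists_formula (φ : Operator) : ∃ D : Fm Sig.none (φ.p + 2) (φ.q + 1) 0,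
    D.IsDelta1 ∧ ∀ (M : Struct) [M.W11] (a : Fin φ.p → M.N) (A : Fin φ.q → M.S) (x : M.N)
      (g : M.S → M.S), Struct.IsIter φ a A x M.empty g →
        ∀ i X, φ.T D M a A i x X ↔ M.mem i (g X) := by
  have h1 : φ.ctx.consN.consN.consS.Sig1 (fun p => ∃ Z, ∃ O, (φ.ctx.M p.1.1.1).len O ≤ 0 ∧
      φ.Run (φ.ctx.M p.1.1.1) p.1.1.1.num p.1.1.1.str p.1.1.2 O O p.2 Z ∧
      ∃ V, (φ.ctx.M p.1.1.1).len V ≤ p.1.1.2 ∧ (φ.ctx.M p.1.1.1).hmem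
        ((φ.ctx.M p.1.1.1).spair ((φ.ctx.M p.1.1.1).len p.2) p.2 V) Z ∧
        (φ.ctx.M p.1.1.1).mem p.1.2 V) := inferInstance
  have h2 : φ.ctx.consN.consN.consS.Pi1 (fun p => ∀ Z, ∀ O, (φ.ctx.M p.1.1.1).len O ≤ 0 →
      φ.Run (φ.ctx.M p.1.1.1) p.1.1.1.num p.1.1.1.str p.1.1.2 O O p.2 Z →
      ∀ V, (φ.ctx.M p.1.1.1).len V ≤ p.1.1.2 → (φ.ctx.M p.1.1.1).hmem
        ((φ.ctx.M p.1.1.1).spair ((φ.ctx.M p.1.1.1).len p.2) p.2 V) Z →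
        (φ.ctx.M p.1.1.1).mem p.1.2 V) := inferInstance
  obtain ⟨D, hD, hD'⟩ := h1.out
  obtain ⟨D₂, hD₂, hD₂'⟩ := h2.out
  have hO (M : Struct) [M.W11] (O : M.S) : M.len O ≤ 0 ↔ O = M.empty := Struct.len_le_zero_iff
  have key (M : Struct) [hM : M.W11] (a : Fin φ.p → M.N) (A : Fin φ.q → M.S) (x : M.N)
      (g : M.S → M.S) (hg : Struct.IsIter φ a A x M.empty g) (i : M.N) (X : M.S) :
      φ.T D M a A i x X ↔ M.mem i (g X) := by
    refine (hD' ⟨⟨⟨⟨⟨M, hM⟩, a, A⟩, x⟩, i⟩, X⟩).trans (Iff.trans ?_ (hg.mem_iff_exists i X))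
    simp only [hO, exists_eq_left, Assignment.num, Assignment.str]
  refine ⟨D, ⟨hD, D₂, hD₂, fun M hM e E => ?_⟩, key⟩
  have : M.W11 := ⟨hM⟩
  obtain ⟨i, e, rfl⟩ : ∃ i e', e = Fin.cons i e' := ⟨_, _, (Fin.cons_self_tail e).symm⟩
  obtain ⟨x, a, rfl⟩ : ∃ i e', e = Fin.cons i e' := ⟨_, _, (Fin.cons_self_tail e).symm⟩
  obtain ⟨X, A, rfl⟩ : ∃ X E', E = Fin.cons X E' := ⟨_, _, (Fin.cons_self_tail E).symm⟩
  obtain ⟨g, hg⟩ := Struct.exists_isIter φ a A x M.empty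
  refine (key M a A x g hg i X).trans ((hg.mem_iff_forall i X).symm.trans
    (Iff.trans ?_ (hD₂' ⟨⟨⟨⟨⟨M, this⟩, a, A⟩, x⟩, i⟩, X⟩).symm))
  simp only [hO, forall_eq, Assignment.num, Assignment.str]

/-- The axiom of inductive definitions for `φ`, as a `𝚺^B_1` formula on a code of the
iterations. -/
theorem exists_idFormula (φ : Operator) : ∃ ψ : Fm Sig.none (φ.p + 1) φ.q 0, ψ.IsSigma1 ∧
    ∀ (M : Struct) [M.W11] (a : Fin φ.p → M.N) (A : Fin φ.q → M.S) (x : M.N),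
      ψ.Sat M (Fin.cons x a) A := by
  have h : φ.ctx.consN.Sig1 (fun p => ∃ Z, ∃ O, (φ.ctx.M p.1).len O ≤ 0 ∧
      φ.RunAll (φ.ctx.M p.1) p.1.num p.1.str p.2 O Z ∧ (φ.ctx.M p.1).Collide p.2 O Z) :=
    inferInstance
  obtain ⟨ψ, h1, h2⟩ := h.out
  refine ⟨ψ, h1, fun M hM a A x => (h2 ⟨⟨⟨M, hM⟩, a, A⟩, x⟩).2 ?_⟩
  obtain ⟨Z, hZ, hZ'⟩ := Struct.exists_runAll φ a A x
  exact ⟨Z, M.empty, Struct.len_empty.le, hZ, hZ' _ (Struct.len_empty_le x)⟩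

/-- The relativised axiom of inductive definitions for `φ`, as a `𝚺^B_1` formula on a code of the
iterations. -/
theorem exists_ridFormula (φ : Operator) : ∃ ψ : Fm Sig.none (φ.p + 1) φ.q 0, ψ.IsSigma1 ∧
    ∀ (M : Struct) [M.W11] (a : Fin φ.p → M.N) (A : Fin φ.q → M.S) (x : M.N),
      ψ.Sat M (Fin.cons x a) A := by
  have h : φ.ctx.consN.Sig1 (fun p => ∃ Z, ∃ O, (φ.ctx.M p.1).len O ≤ 0 ∧
      φ.RunAll (φ.ctx.M p.1) p.1.num p.1.str p.2 O Z ∧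
      ∀ Y, (φ.ctx.M p.1).len Y ≤ p.2 → (φ.ctx.M p.1).Collide p.2 Y Z) :=
    inferInstance
  obtain ⟨ψ, h1, h2⟩ := h.out
  refine ⟨ψ, h1, fun M hM a A x => (h2 ⟨⟨⟨M, hM⟩, a, A⟩, x⟩).2 ?_⟩
  obtain ⟨Z, hZ, hZ'⟩ := Struct.exists_runAll φ a A x
  exact ⟨Z, M.empty, Struct.len_empty.le, hZ, hZ'⟩

theorem def_P (φ : Operator) {Γ : Type 1} {n m k : ℕ} {C : Ctx LID Γ n m k}
    (a : (γ : Γ) → Fin φ.p → (C.M γ).N) (A : (γ : Γ) → Fin φ.q → (C.M γ).S)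
    (i x : (γ : Γ) → (C.M γ).N) (X : (γ : Γ) → (C.M γ).S) [C.IsTms a] [C.IsSVars A] [C.IsTm i]
    [C.IsTm x] [C.IsSVar X] :
    C.Def (fun γ => φ.P (C.I γ) (a γ) (A γ) (i γ) (x γ) (X γ)) :=
  Ctx.def_rel (R := LID) (Sum.inl φ) (fun γ => (Fin.cons (i γ) (Fin.cons (x γ) (a γ)) : Fin (φ.p + 2) → (C.M γ).N))
    (fun γ => (Fin.cons (X γ) (A γ) : Fin (φ.q + 1) → (C.M γ).S))
    (hv := Ctx.isTms_cons i (fun γ => (Fin.cons (x γ) (a γ) : Fin (φ.p + 1) → (C.M γ).N)))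
    (hV := Ctx.isSVars_cons X A)

theorem def_PRel (φ : Operator) {Γ : Type 1} {n m k : ℕ} {C : Ctx LID Γ n m k}
    (a : (γ : Γ) → Fin φ.p → (C.M γ).N) (A : (γ : Γ) → Fin φ.q → (C.M γ).S)
    (i x : (γ : Γ) → (C.M γ).N) (X Y : (γ : Γ) → (C.M γ).S) [C.IsTms a] [C.IsSVars A] [C.IsTm i]
    [C.IsTm x] [C.IsSVar X] [C.IsSVar Y] :
    C.Def (fun γ => φ.PRel (C.I γ) (a γ) (A γ) (Y γ) (i γ) (x γ) (X γ)) :=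
  Ctx.def_rel (R := LID) (Sum.inr φ) (fun γ => (Fin.cons (i γ) (Fin.cons (x γ) (a γ)) : Fin (φ.p + 2) → (C.M γ).N))
    (fun γ => (Fin.cons (X γ) (Fin.cons (Y γ) (A γ)) : Fin (φ.q + 2) → (C.M γ).S))
    (hv := Ctx.isTms_cons i (fun γ => (Fin.cons (x γ) (a γ) : Fin (φ.p + 1) → (C.M γ).N)))
    (hV := Ctx.isSVars_cons X (fun γ => (Fin.cons (Y γ) (A γ) : Fin (φ.q + 1) → (C.M γ).S)))

/-- The atomic formula `P_φ` is admitted in the schemes of `W^1_1(LID)`, so the defining axioms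
determine it by string induction. -/
theorem P_iff_mem (φ : Operator) {M : Struct} [M.W11] {I : Interp LID M} (hI : M.IsW11LID I)
    {a : Fin φ.p → M.N} {A : Fin φ.q → M.S} {x : M.N} {g : M.S → M.S}
    (hg : Struct.IsIter φ a A x M.empty g) (i : M.N) (X : M.S) (hi : i < x)
    (hX : M.len X ≤ M.succN x) : φ.P I a A i x X ↔ M.mem i (g X) :=
  hg.iff_mem hI.w11 a A
    (fun Z => φ.def_P (C := (Ctx.fixed M I _ A ![Z]).consS.consN) (fun _ => a) (fun _ => A)
      (fun p => p.2) (fun _ => x) (fun p => p.1.2))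
    (fun i _ => iff_of_false (Struct.N_not_lt_zero i) (Struct.not_mem_empty i))
    (hI.base φ a A x) (hI.step φ a A x) i X hi hX

theorem PRel_iff_mem (φ : Operator) {M : Struct} [M.W11] {I : Interp LID M} (hI : M.IsW11LID I)
    {a : Fin φ.p → M.N} {A : Fin φ.q → M.S} {x : M.N} {Y : M.S} {g : M.S → M.S}
    (hg : Struct.IsIter φ a A x Y g) (i : M.N) (X : M.S) (hi : i < x)
    (hX : M.len X ≤ M.succN x) : φ.PRel I a A Y i x X ↔ M.mem i (g X) :=
  hg.iff_mem hI.w11 a (Matrix.vecCons Y A)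
    (fun Z => φ.def_PRel (C := (Ctx.fixed M I _ (Matrix.vecCons Y A) ![Z]).consS.consN)
      (fun _ => a) (fun _ => A) (fun p => p.2) (fun _ => x) (fun p => p.1.2) (fun _ => Y))
    (fun _ _ => Iff.rfl) (hI.baseRel φ a A Y x) (hI.stepRel φ a A Y x) i X hi hX

end Operator
end BoundedArith

/-! ### The theorem -/

theorem mainTheorem7 (φ : BoundedArith.Operator) :
    (∃ D : BoundedArith.Fm BoundedArith.Sig.none (φ.p + 2) (φ.q + 1) 0,
      D.IsDelta1 ∧
      (∀ M : BoundedArith.Struct, M.IsW11 →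
        ∀ (a : Fin φ.p → M.N) (A : Fin φ.q → M.S) (x : M.N),
          M.IsIteration (φ.T D M a A) (φ.App M a A) (fun i => M.lt i M.zero) x ∧
          M.IDAx (φ.T D M a A) x) ∧
      (∀ (M : BoundedArith.Struct) (I : BoundedArith.Interp BoundedArith.LID M), M.IsW11LID I →
        ∀ (a : Fin φ.p → M.N) (A : Fin φ.q → M.S) (x i : M.N) (X : M.S),
          M.lt i x → M.le (M.len X) (M.succN x) → (φ.P I a A i x X ↔ φ.T D M a A i x X)) ∧
      ∃ ψ : BoundedArith.Fm BoundedArith.Sig.none (φ.p + 1) φ.q 0,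
        ψ.IsSigma1 ∧
        (∀ M : BoundedArith.Struct, M.IsW11 →
          ∀ (a : Fin φ.p → M.N) (A : Fin φ.q → M.S) (x : M.N),
            ψ.Sat M (Fin.cons x a) A ∧ (ψ.Sat M (Fin.cons x a) A ↔ M.IDAx (φ.T D M a A) x)) ∧
        ∀ (M : BoundedArith.Struct) (I : BoundedArith.Interp BoundedArith.LID M), M.IsW11LID I →
          ∀ (a : Fin φ.p → M.N) (A : Fin φ.q → M.S) (x : M.N),
            ψ.Sat M (Fin.cons x a) A ↔ M.IDAx (φ.P I a A) x) ∧
    (∃ D : BoundedArith.Fm BoundedArith.Sig.none (φ.p + 2) (φ.q + 2) 0,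
      D.IsDelta1 ∧
      (∀ M : BoundedArith.Struct, M.IsW11 →
        ∀ (a : Fin φ.p → M.N) (A : Fin φ.q → M.S) (x : M.N),
          (∀ Y : M.S,
            M.IsIteration (φ.TRel D M a A Y) (φ.App M a A) (fun i => M.mem i Y) x) ∧
          M.RIDAx (φ.TRel D M a A) x) ∧
      (∀ (M : BoundedArith.Struct) (I : BoundedArith.Interp BoundedArith.LID M), M.IsW11LID I →
        ∀ (a : Fin φ.p → M.N) (A : Fin φ.q → M.S) (x i : M.N) (X Y : M.S),
          M.lt i x → M.le (M.len X) (M.succN x) →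
            (φ.PRel I a A Y i x X ↔ φ.TRel D M a A Y i x X)) ∧
      ∃ ψ : BoundedArith.Fm BoundedArith.Sig.none (φ.p + 1) φ.q 0,
        ψ.IsSigma1 ∧
        (∀ M : BoundedArith.Struct, M.IsW11 →
          ∀ (a : Fin φ.p → M.N) (A : Fin φ.q → M.S) (x : M.N),
            ψ.Sat M (Fin.cons x a) A ∧
            (ψ.Sat M (Fin.cons x a) A ↔ M.RIDAx (φ.TRel D M a A) x)) ∧
        ∀ (M : BoundedArith.Struct) (I : BoundedArith.Interp BoundedArith.LID M), M.IsW11LID I →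
          ∀ (a : Fin φ.p → M.N) (A : Fin φ.q → M.S) (x : M.N),
            ψ.Sat M (Fin.cons x a) A ↔ M.RIDAx (φ.PRel I a A) x) := by
  constructor
  · obtain ⟨D, hD, hD'⟩ := φ.exists_formula
    have h0 {M : BoundedArith.Struct} [M.W11] (x i : M.N) (_ : i < x) :
        M.lt i M.zero ↔ M.mem i M.empty :=
      iff_of_false (BoundedArith.Struct.N_not_lt_zero i) (BoundedArith.Struct.not_mem_empty i)
    obtain ⟨ψ, hψ, hψ'⟩ := φ.exists_idFormula
    have hID (M : BoundedArith.Struct) (hM : M.IsW11) (a : Fin φ.p → M.N) (A : Fin φ.q → M.S)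
        (x : M.N) : M.IsIteration (φ.T D M a A) (φ.App M a A) (fun i => M.lt i M.zero) x ∧
          M.IDAx (φ.T D M a A) x := by
      have : M.W11 := ⟨hM⟩
      obtain ⟨g, hg⟩ := BoundedArith.Struct.exists_isIter φ a A x M.empty
      have h := hD' M a A x g hg
      exact ⟨hg.isIteration h (h0 x), hg.idAx fun i X _ _ => h i X⟩
    refine ⟨D, hD, hID, fun M I hI a A x i X hi hX => ?_, ψ, hψ, fun M hM a A x => ?_,
      fun M I hI a A x => ?_⟩
    · have := hI.w11.w11
      obtain ⟨g, hg⟩ := BoundedArith.Struct.exists_isIter φ a A x M.empty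
      rw [hD' M a A x g hg i X]
      exact φ.P_iff_mem hI hg i X hi hX
    · have : M.W11 := ⟨hM⟩
      exact ⟨hψ' M a A x, iff_of_true (hψ' M a A x) (hID M hM a A x).2⟩
    · have := hI.w11.w11
      obtain ⟨g, hg⟩ := BoundedArith.Struct.exists_isIter φ a A x M.empty
      -- Both sides hold in every model; the axiom for `P_φ` holds because `P_φ` agrees with the
      -- iteration `g` on the counters it mentions.
      exact iff_of_true (hψ' M a A x) (hg.idAx (φ.P_iff_mem hI hg))
  · obtain ⟨D, hD, hD'⟩ := φ.exists_relFormula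
    obtain ⟨ψ, hψ, hψ'⟩ := φ.exists_ridFormula
    have hRID (M : BoundedArith.Struct) (hM : M.IsW11) (a : Fin φ.p → M.N) (A : Fin φ.q → M.S)
        (x : M.N) : (∀ Y : M.S,
          M.IsIteration (φ.TRel D M a A Y) (φ.App M a A) (fun i => M.mem i Y) x) ∧
            M.RIDAx (φ.TRel D M a A) x := by
      have : M.W11 := ⟨hM⟩
      choose g hg using BoundedArith.Struct.exists_isIter φ a A x
      have h (Y) := hD' M a A x Y (g Y) (hg Y)
      exact ⟨fun Y => (hg Y).isIteration (h Y) fun _ _ => Iff.rfl,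
        fun Y _ => (hg Y).idAx fun i X _ _ => h Y i X⟩
    refine ⟨D, hD, hRID, fun M I hI a A x i X Y hi hX => ?_, ψ, hψ, fun M hM a A x => ?_,
      fun M I hI a A x => ?_⟩
    · have := hI.w11.w11
      obtain ⟨g, hg⟩ := BoundedArith.Struct.exists_isIter φ a A x Y
      rw [hD' M a A x Y g hg i X]
      exact φ.PRel_iff_mem hI hg i X hi hX
    · have : M.W11 := ⟨hM⟩
      exact ⟨hψ' M a A x, iff_of_true (hψ' M a A x) (hRID M hM a A x).2⟩
    · have := hI.w11.w11
      -- One iteration for each start `Y`; the choice is made outside the model, which suffices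
      -- since the axiom is checked for each `Y` separately.
      choose g hg using BoundedArith.Struct.exists_isIter φ a A x
      exact iff_of_true (hψ' M a A x) fun Y _ => (hg Y).idAx (φ.PRel_iff_mem hI (hg Y))
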